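/- Let $d\in\mathbb N$. Write $\langle f,\varphi\rangle$ for the duality between $\mathcal S'(\mathbb R^d)$ and $\mathcal S(\mathbb R^d)$, conjugate-linear in $\varphi$, and for $s\in\mathbb R$ let $v_s(x,\xi)=(1+|x|^2+|\xi|^2)^{s/2}$ on $\mathbb R^{2d}$. For $0<p,q\le\infty$ and measurable $F$ on $\mathbb R^{2d}$ put $$\|F\|_{L^{p,q}_{v_s}}=\Big(\int_{\mathbb R^d}\Big(\int_{\mathbb R^d}|F(x,\xi)|^p v_s(x,\xi)^p\,dx\Big)^{q/p}d\xi\Big)^{1/q}$$ (with essential suprema if $p=\infty$ or $q=\infty$). Fix a non-zero $\varphi\in\mathcal S(\mathbb R^d)$, let $V_\varphi f(x,\xi)=\langle f,\,e^{2\pi i\,\xi\cdot(\,\cdot\,)}\varphi(\cdot-x)\rangle$ be the short-time Fourier transform of $f\in\mathcal S'(\mathbb R^d)$, and let $M^{p,q}_{v_s}(\mathbb R^d)$ be the set of $f\in\mathcal S'(\mathbb R^d)$ with $\|f\|_{M^{p,q}_{v_s}}:=\|V_\varphi f\|_{L^{p,q}_{v_s}}<\infty$; write $M^1_{v_s}=M^{1,1}_{v_s}$.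 For $\tau\in\mathbb R$ and $f,g\in\mathcal S'(\mathbb R^d)$ let $W_\tau(f,g)\in\mathcal S'(\mathbb R^{2d})$ be the partial Fourier transform in $t$ of the distribution $(f\otimes\bar g)(x+\tau t,\,x-(1-\tau)t)$, i.e., in the sense of distributions, $$W_\tau(f,g)(x,\xi)=\int_{\mathbb R^d}e^{-2\pi i t\cdot\xi}f(x+\tau t)\,\overline{g(x-(1-\tau)t)}\,dt .$$ A distribution on $\mathbb R^{2d}$ belongs to $L^{p,q}_{v_s}(\mathbb R^{2d})$ if it is given by integration against a measurable function $F$ with $\|F\|_{L^{p,q}_{v_s}}<\infty$; its $L^{p,q}_{v_s}$-norm is that of $F$, and is $\infty$ if it is not given by a function. **Proposition 2.16.** Let $\tau\in\mathbb R\setminus\{0,1\}$, $0<p,q\le\infty$ and $s\in\mathbb R$. (i) For every non-zero $g\in\mathcal S(\mathbb R^d)$ and every $f\in\mathcal S'(\mathbb R^d)$, $$f\in M^{p,q}_{v_s}(\mathbb R^d)\iff W_\tau(f,g)\in L^{p,q}_{v_s}(\mathbb R^{2d}),$$ with equivalence of norms: there is $C>0$ such that, for all $f\in\mathcal S'(\mathbb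 R^d)$, $$\|f\|_{M^{p,q}_{v_s}}\le C\,\|W_\tau(f,g)\|_{L^{p,q}_{v_s}}\quad\text{and}\quad \|W_\tau(f,g)\|_{L^{p,q}_{v_s}}\le C\,\|f\|_{M^{p,q}_{v_s}} .$$ (ii) If $s\ge 0$ and $1\le p,q\le\infty$, then the same equivalence, with equivalence of norms, holds for every non-zero window $g\in M^1_{v_s}(\mathbb R^d)$. -/

import Mathlib

open MeasureTheory SchwartzMap LineDeriv
open scoped ENNReal NNReal FourierTransform LineDeriv ContDiff

namespace TauWigner

noncomputable section

variable {E F G V : Type*} [NormedAddCommGroup E] [NormedSpace ℝ E]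
  [NormedAddCommGroup F] [NormedSpace ℝ F] [NormedAddCommGroup G] [NormedSpace ℝ G]
  [NormedAddCommGroup V] [NormedSpace ℝ V]

/-- The slice `t ↦ Φ (x, t)` of a Schwartz function `Φ` of two variables. -/
def slice (x : E) : 𝓢(E × F, ℂ) →L[ℂ] 𝓢(F, ℂ) :=
  compCLM ℂ (g := fun t : F => (x, t))
    (by
      have h : (fun t : F => (x, t)) =
          fun t => ContinuousLinearMap.inr ℝ E F t + (x, 0) := by
        ext t <;> simp
      rw [h]
      exact (ContinuousLinearMap.hasTemperateGrowth _).add (.const _))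
    ⟨1, 1, fun t => by
      have : ‖t‖ ≤ ‖(x, t)‖ := le_max_right _ _
      simp only [pow_one, one_mul]; linarith⟩

@[simp] theorem slice_apply (x : E) (Φ : 𝓢(E × F, ℂ)) (t : F) : slice x Φ t = Φ (x, t) := rfl

theorem norm_iteratedFDeriv_slice_le (x : E) (Φ : 𝓢(E × F, ℂ)) (n : ℕ) (t : F) :
    ‖iteratedFDeriv ℝ n (slice x Φ) t‖ ≤ ‖iteratedFDeriv ℝ n Φ (x, t)‖ := by
  have h : (slice x Φ : F → ℂ) =
      (fun z => Φ (z + (x, 0))) ∘ (ContinuousLinearMap.inr ℝ E F) := by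
    ext t; simp
  have hc : ContDiff ℝ n (fun z => Φ (z + ((x, 0) : E × F))) :=
    (Φ.smooth n).comp (contDiff_id.add contDiff_const)
  rw [h, ContinuousLinearMap.iteratedFDeriv_comp_right _ hc t le_rfl]
  refine (ContinuousMultilinearMap.norm_compContinuousLinearMap_le _ _).trans ?_
  rw [iteratedFDeriv_comp_add_right]
  simp only [Finset.prod_const, Finset.card_univ, Fintype.card_fin]
  have h1 : ‖ContinuousLinearMap.inr ℝ E F‖ ^ n ≤ 1 :=
    pow_le_one₀ (norm_nonneg _) (ContinuousLinearMap.norm_inr_le_one _ _ _)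
  have h2 : ContinuousLinearMap.inr ℝ E F t + (x, 0) = (x, t) := by ext <;> simp
  rw [h2]
  exact mul_le_of_le_one_right (norm_nonneg _) h1

theorem seminorm_slice_le (m k n : ℕ) (x : E) (Φ : 𝓢(E × F, ℂ)) :
    ‖x‖ ^ m * SchwartzMap.seminorm ℂ k n (slice x Φ) ≤ SchwartzMap.seminorm ℂ (m + k) n Φ := by
  rcases eq_or_ne (‖x‖ ^ m) 0 with h | h
  · rw [h, zero_mul]; exact apply_nonneg _ _
  have hp : 0 < ‖x‖ ^ m := lt_of_le_of_ne (by positivity) h.symm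
  rw [← le_div_iff₀' hp]
  refine SchwartzMap.seminorm_le_bound ℂ k n _ (div_nonneg (apply_nonneg _ _) hp.le) fun t => ?_
  rw [le_div_iff₀' hp]
  calc ‖x‖ ^ m * (‖t‖ ^ k * ‖iteratedFDeriv ℝ n (slice x Φ) t‖)
      ≤ ‖(x, t)‖ ^ m * (‖(x, t)‖ ^ k * ‖iteratedFDeriv ℝ n Φ (x, t)‖) := by
        gcongr
        · exact le_max_left _ _
        · exact le_max_right _ _
        · exact norm_iteratedFDeriv_slice_le x Φ n t
    _ = ‖(x, t)‖ ^ (m + k) * ‖iteratedFDeriv ℝ n Φ (x, t)‖ := by ring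
    _ ≤ _ := SchwartzMap.le_seminorm ℂ _ _ _ _

theorem lineDeriv_slice (x : E) (Φ : 𝓢(E × F, ℂ)) (w : F) :
    ∂_{w} (slice x Φ) = slice x (∂_{((0 : E), w)} Φ) := by
  ext t
  rw [slice_apply, lineDerivOp_apply_eq_fderiv, lineDerivOp_apply_eq_fderiv]
  have h1 : HasFDerivAt (fun t : F => (x, t)) (ContinuousLinearMap.inr ℝ E F) t :=
    hasFDerivAt_prodMk_right x t
  have h2 := (Φ.hasFDerivAt (x, t)).comp t h1
  have h3 : (slice x Φ : F → ℂ) = Φ ∘ fun t : F => (x, t) := rfl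
  rw [h3, h2.fderiv]
  simp

theorem fderiv_eq_sum {ι : Type*} [Fintype ι] [FiniteDimensional ℝ V] (b : Module.Basis ι ℝ V)
    (f : V → ℂ) (x : V) :
    fderiv ℝ f x = ∑ i, (LinearMap.toContinuousLinearMap (b.coord i)).smulRight
      (fderiv ℝ f x (b i)) := by
  ext v
  conv_lhs => rw [← b.sum_repr v, map_sum]
  simp

/-- Iterated derivatives are controlled by those of the partial derivatives. -/
theorem exists_norm_iteratedFDeriv_succ_le [FiniteDimensional ℝ V] {ι : Type*} [Fintype ι]
    (b : Module.Basis ι ℝ V) :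
    ∃ C : ℝ, 0 ≤ C ∧ ∀ (f : V → ℂ), ContDiff ℝ ∞ f → ∀ (n : ℕ) (x : V),
      ‖iteratedFDeriv ℝ (n + 1) f x‖ ≤
        C * ∑ i, ‖iteratedFDeriv ℝ n (fun y => fderiv ℝ f y (b i)) x‖ := by
  let T : ι → (ℂ →L[ℝ] (V →L[ℝ] ℂ)) := fun i =>
    ContinuousLinearMap.smulRightL ℝ V ℂ (LinearMap.toContinuousLinearMap (b.coord i))
  refine ⟨∑ i, ‖T i‖, Finset.sum_nonneg fun i _ => (T i).opNorm_nonneg, fun f hf n x => ?_⟩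
  have hd : ∀ i, ContDiff ℝ ∞ (fun y => fderiv ℝ f y (b i)) := fun i =>
    (hf.fderiv_right (m := ∞) (by simp)).clm_apply contDiff_const
  have hfd : fderiv ℝ f = fun y => ∑ i, (T i) (fderiv ℝ f y (b i)) := by
    funext y; exact fderiv_eq_sum b f y
  rw [← norm_iteratedFDeriv_fderiv]
  conv_lhs => rw [hfd]
  have hT : ∀ i, ContDiff ℝ ∞ (fun y => (T i) (fderiv ℝ f y (b i))) := fun i =>
    (T i).contDiff.comp (hd i)
  rw [iteratedFDeriv_fun_sum_apply
    (fun i _ => ((hT i).of_le (mod_cast le_top)).contDiffAt)]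
  refine (norm_sum_le _ _).trans ?_
  rw [Finset.sum_mul]
  refine Finset.sum_le_sum fun i _ => ?_
  have h := (T i).norm_iteratedFDeriv_comp_left (n := n) (N := n) (x := x)
    ((hd i).of_le (mod_cast le_top)).contDiffAt le_rfl
  refine h.trans ?_
  gcongr
  exact Finset.single_le_sum (f := fun i => ‖iteratedFDeriv ℝ n (fun y => fderiv ℝ f y (b i)) x‖)
    (fun j _ => norm_nonneg _) (Finset.mem_univ i)


/-- First order Taylor remainder of `x ↦ slice x Φ`. -/
def sliceRem (Φ : 𝓢(E × F, ℂ)) (x v : E) : 𝓢(F, ℂ) :=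
  slice (x + v) Φ - slice x Φ - slice x (∂_{(v, (0 : F))} Φ)

theorem lineDeriv_comm (Φ : 𝓢(V, ℂ)) (v w : V) :
    (∂_{v} (∂_{w} Φ) : 𝓢(V, ℂ)) = ∂_{w} (∂_{v} Φ) := by
  have key : ∀ (u u' : V) (x : V), (∂_{u} (∂_{u'} Φ) : 𝓢(V, ℂ)) x =
      fderiv ℝ (fderiv ℝ Φ) x u u' := fun u u' x => by
    have hd : DifferentiableAt ℝ (fderiv ℝ Φ) x :=
      ((Φ.smooth ⊤).fderiv_right (m := ∞) (by simp)).differentiable (by simp) x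
    have h : ((∂_{u'} Φ : 𝓢(V, ℂ)) : V → ℂ) = fun y => fderiv ℝ Φ y u' := rfl
    rw [lineDerivOp_apply_eq_fderiv, h, fderiv_clm_apply hd (by fun_prop)]
    simp
  ext x
  rw [key, key]
  exact ((Φ.smooth 2).contDiffAt.isSymmSndFDerivAt (n := 2)
    (by rw [minSmoothness_of_isRCLikeNormedField])).eq _ _

theorem sliceRem_lineDeriv (Φ : 𝓢(E × F, ℂ)) (x v : E) (w : F) :
    ∂_{w} (sliceRem Φ x v) = sliceRem (∂_{((0 : E), w)} Φ) x v := by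
  unfold sliceRem
  rw [lineDeriv_comm Φ (v, (0 : F)) ((0 : E), w), ← lineDeriv_slice, ← lineDeriv_slice,
    ← lineDeriv_slice]
  simp only [← lineDerivOpCLM_apply (R := ℂ), map_sub]

theorem norm_sliceRem_le (Φ : 𝓢(E × F, ℂ)) (k : ℕ) (x v : E) (t : F) :
    ‖t‖ ^ k * ‖sliceRem Φ x v t‖ ≤ SchwartzMap.seminorm ℂ k 2 Φ * ‖v‖ ^ 2 := by
  rcases eq_or_ne (‖t‖ ^ k) 0 with h0 | h0
  · rw [h0, zero_mul]; exact mul_nonneg (apply_nonneg _ _) (by positivity)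
  have hp : 0 < ‖t‖ ^ k := lt_of_le_of_ne (by positivity) h0.symm
  set K := SchwartzMap.seminorm ℂ k 2 Φ with hK
  have hd1 : ∀ z, DifferentiableAt ℝ Φ z := fun z => Φ.differentiableAt
  have hd2 : ∀ z, DifferentiableAt ℝ (fderiv ℝ Φ) z := fun z =>
    ((Φ.smooth ⊤).fderiv_right (m := ∞) (by simp)).differentiable (by simp) z
  let s : Set (E × F) := segment ℝ (x, t) (x + v, t)
  have hs : Convex ℝ s := convex_segment _ _
  have hsub : ((x + v, t) : E × F) - (x, t) = (v, 0) := by simp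
  have hsnd : ∀ z ∈ s, z.2 = t ∧ ‖z - (x, t)‖ ≤ ‖v‖ := by
    rintro z ⟨a, b, ha, hb, hab, rfl⟩
    have hb1 : b ≤ 1 := by linarith
    have e2 : a • t + b • t = t := by rw [← add_smul, hab, one_smul]
    have e1 : a • x + b • (x + v) - x = b • v := by
      rw [smul_add, ← add_assoc, ← add_smul, hab, one_smul]; abel
    refine ⟨by simpa using e2, ?_⟩
    have : a • (x, t) + b • (x + v, t) - (x, t) = (b • v, (0 : F)) := by
      ext
      · simpa using e1
      · simp [e2]
    rw [this, Prod.norm_mk, norm_zero, norm_smul, Real.norm_of_nonneg hb]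
    exact max_le (mul_le_of_le_one_left (norm_nonneg _) hb1) (norm_nonneg _)
  have hb2 : ∀ z ∈ s, ‖fderiv ℝ (fderiv ℝ Φ) z‖ ≤ K / ‖t‖ ^ k := fun z hz => by
    rw [le_div_iff₀' hp]
    have h1 : ‖fderiv ℝ (fderiv ℝ Φ) z‖ = ‖iteratedFDeriv ℝ 2 Φ z‖ := by
      rw [← norm_iteratedFDeriv_fderiv (n := 1), ← norm_iteratedFDeriv_fderiv (n := 0),
        norm_iteratedFDeriv_zero]
    rw [h1]
    refine le_trans ?_ (SchwartzMap.le_seminorm ℂ k 2 Φ z)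
    gcongr
    rw [← (hsnd z hz).1]
    exact norm_snd_le z
  have hx : ((x, t) : E × F) ∈ s := left_mem_segment _ _ _
  have hy : ((x + v, t) : E × F) ∈ s := right_mem_segment _ _ _
  have hb1 : ∀ z ∈ s, ‖fderiv ℝ Φ z - fderiv ℝ Φ (x, t)‖ ≤ K / ‖t‖ ^ k * ‖v‖ := fun z hz =>
    (hs.norm_image_sub_le_of_norm_fderiv_le (fun z _ => hd2 z) hb2 hx hz).trans
      (mul_le_mul_of_nonneg_left (hsnd z hz).2 (div_nonneg (apply_nonneg _ _) hp.le))
  have h := hs.norm_image_sub_le_of_norm_fderiv_le' (fun z _ => hd1 z) hb1 hx hy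
  rw [hsub] at h
  have he : sliceRem Φ x v t = Φ (x + v, t) - Φ (x, t) - fderiv ℝ Φ (x, t) (v, 0) := rfl
  have hv : ‖((v, 0) : E × F)‖ = ‖v‖ := by simp [Prod.norm_mk]
  rw [hv] at h
  rw [he]
  calc _ ≤ ‖t‖ ^ k * (K / ‖t‖ ^ k * ‖v‖ * ‖v‖) := by gcongr
    _ = K * ‖v‖ ^ 2 := by field_simp

theorem exists_seminorm_sliceRem_le [FiniteDimensional ℝ F] (k n : ℕ) :
    ∀ Φ : 𝓢(E × F, ℂ), ∃ C : ℝ, 0 ≤ C ∧ ∀ x v : E,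
      SchwartzMap.seminorm ℂ k n (sliceRem Φ x v) ≤ C * ‖v‖ ^ 2 := by
  obtain ⟨B, hB, hBf⟩ := exists_norm_iteratedFDeriv_succ_le (Module.finBasis ℝ F)
  induction n with
  | zero =>
    refine fun Φ => ⟨_, apply_nonneg (SchwartzMap.seminorm ℂ k 2) Φ, fun x v => ?_⟩
    refine SchwartzMap.seminorm_le_bound ℂ k 0 _ (mul_nonneg (apply_nonneg _ _) (by positivity))
      fun t => ?_
    rw [norm_iteratedFDeriv_zero]
    exact norm_sliceRem_le Φ k x v t
  | succ n ih =>
    intro Φ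
    choose C hC hCb using ih
    refine ⟨B * ∑ i, C (∂_{((0 : E), Module.finBasis ℝ F i)} Φ),
      mul_nonneg hB (Finset.sum_nonneg fun i _ => hC _), fun x v => ?_⟩
    refine SchwartzMap.seminorm_le_bound ℂ k (n + 1) _
      (mul_nonneg (mul_nonneg hB (Finset.sum_nonneg fun i _ => hC _)) (by positivity)) fun t => ?_
    have h1 := hBf (sliceRem Φ x v) ((sliceRem Φ x v).smooth ⊤) n t
    calc ‖t‖ ^ k * ‖iteratedFDeriv ℝ (n + 1) (sliceRem Φ x v) t‖
        ≤ ‖t‖ ^ k * (B * ∑ i, ‖iteratedFDeriv ℝ n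
            (fun y => fderiv ℝ (sliceRem Φ x v) y (Module.finBasis ℝ F i)) t‖) := by gcongr
      _ = B * ∑ i, ‖t‖ ^ k * ‖iteratedFDeriv ℝ n
            (sliceRem (∂_{((0 : E), Module.finBasis ℝ F i)} Φ) x v) t‖ := by
          rw [← Finset.mul_sum, mul_left_comm]
          congr 2
          refine Finset.sum_congr rfl fun i _ => ?_
          rw [← sliceRem_lineDeriv]
          rfl
      _ ≤ B * ∑ i, C (∂_{((0 : E), Module.finBasis ℝ F i)} Φ) * ‖v‖ ^ 2 := by
          refine mul_le_mul_of_nonneg_left (Finset.sum_le_sum fun i _ => ?_) hB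
          exact (SchwartzMap.le_seminorm ℂ k n _ t).trans (hCb _ x v)
      _ = _ := by rw [← Finset.sum_mul, mul_assoc]

/-- `(id ⊗ L) Φ`, i.e. `(x, t) ↦ L (Φ (x, ·)) (t)`, as a bare function. -/
def partialFun (L : 𝓢(F, ℂ) →L[ℂ] 𝓢(G, ℂ)) (Φ : 𝓢(E × F, ℂ)) (z : E × G) : ℂ :=
  L (slice z.1 Φ) z.2

theorem seminorm_smul_sum_apply {ι : Type*} (s : Finset ι) (C : ℝ≥0)
    (p : ι → Seminorm ℂ 𝓢(V, ℂ)) (ψ : 𝓢(V, ℂ)) :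
    (C • ∑ i ∈ s, p i) ψ = C * ∑ i ∈ s, p i ψ := by
  change (C : ℝ) * (∑ i ∈ s, p i) ψ = _
  rw [sum_apply]

theorem exists_finset_bound (L : 𝓢(F, ℂ) →L[ℂ] 𝓢(G, ℂ)) (k : ℕ) :
    ∃ (s : Finset (ℕ × ℕ)) (C : ℝ≥0), ∀ ψ : 𝓢(F, ℂ),
      SchwartzMap.seminorm ℂ k 0 (L ψ) ≤ C * ∑ i ∈ s, SchwartzMap.seminorm ℂ i.1 i.2 ψ := by
  let q : Seminorm ℂ 𝓢(F, ℂ) :=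
    (SchwartzMap.seminorm ℂ k 0).comp (L : 𝓢(F, ℂ) →ₗ[ℂ] 𝓢(G, ℂ))
  have hq : Continuous q :=
    ((schwartz_withSeminorms ℂ G ℂ).continuous_seminorm (k, 0)).comp L.continuous
  obtain ⟨s, C, -, h⟩ := Seminorm.bound_of_continuous (schwartz_withSeminorms ℂ F ℂ) q hq
  refine ⟨s, C, fun ψ => (h ψ).trans ?_⟩
  have h2 := Seminorm.finset_sup_le_sum (schwartzSeminormFamily ℂ F ℂ) s ψ
  refine (mul_le_mul_of_nonneg_left h2 C.2).trans (le_of_eq ?_)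
  exact seminorm_smul_sum_apply s C (schwartzSeminormFamily ℂ F ℂ) ψ

theorem exists_slice_bound (L : 𝓢(F, ℂ) →L[ℂ] 𝓢(G, ℂ)) (m k : ℕ) :
    ∃ q : Seminorm ℂ 𝓢(E × F, ℂ), Continuous q ∧ ∀ (Φ : 𝓢(E × F, ℂ)) (x : E),
      ‖x‖ ^ m * SchwartzMap.seminorm ℂ k 0 (L (slice x Φ)) ≤ q Φ := by
  obtain ⟨s, C, h⟩ := exists_finset_bound L k
  refine ⟨C • ∑ i ∈ s, SchwartzMap.seminorm ℂ (m + i.1) i.2, ?_, fun Φ x => ?_⟩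
  · have : (fun Φ : 𝓢(E × F, ℂ) => (C : ℝ) * ∑ i ∈ s, SchwartzMap.seminorm ℂ (m + i.1) i.2 Φ) =
        ⇑(C • ∑ i ∈ s, SchwartzMap.seminorm ℂ (m + i.1) i.2 : Seminorm ℂ 𝓢(E × F, ℂ)) := by
      funext Φ; rw [seminorm_smul_sum_apply]
    rw [← this]
    exact continuous_const.mul (continuous_finsetSum _ fun i _ =>
      (schwartz_withSeminorms ℂ (E × F) ℂ).continuous_seminorm (m + i.1, i.2))
  · rw [seminorm_smul_sum_apply]
    calc _ ≤ ‖x‖ ^ m * (C * ∑ i ∈ s, SchwartzMap.seminorm ℂ i.1 i.2 (slice x Φ)) := by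
          gcongr; exact h _
      _ = C * ∑ i ∈ s, ‖x‖ ^ m * SchwartzMap.seminorm ℂ i.1 i.2 (slice x Φ) := by
          rw [← Finset.mul_sum]; ring
      _ ≤ C * ∑ i ∈ s, SchwartzMap.seminorm ℂ (m + i.1) i.2 Φ := by
          refine mul_le_mul_of_nonneg_left (Finset.sum_le_sum fun i _ => ?_) C.2
          exact seminorm_slice_le m i.1 i.2 x Φ

theorem exists_partialFun_bound (L : 𝓢(F, ℂ) →L[ℂ] 𝓢(G, ℂ)) (k : ℕ) :
    ∃ q : Seminorm ℂ 𝓢(E × F, ℂ), Continuous q ∧ ∀ (Φ : 𝓢(E × F, ℂ)) (z : E × G),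
      ‖z‖ ^ k * ‖partialFun L Φ z‖ ≤ q Φ := by
  obtain ⟨q₁, hq₁, h₁⟩ := exists_slice_bound (E := E) L k 0
  obtain ⟨q₂, hq₂, h₂⟩ := exists_slice_bound (E := E) L 0 k
  refine ⟨q₁ + q₂, hq₁.add hq₂, fun Φ z => ?_⟩
  have hz : ‖z‖ ^ k ≤ ‖z.1‖ ^ k + ‖z.2‖ ^ k := by
    rcases max_choice ‖z.1‖ ‖z.2‖ with h | h <;> rw [Prod.norm_def, h]
    · exact le_add_of_nonneg_right (by positivity)
    · exact le_add_of_nonneg_left (by positivity)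
  calc _ ≤ (‖z.1‖ ^ k + ‖z.2‖ ^ k) * ‖partialFun L Φ z‖ := by gcongr
    _ = ‖z.1‖ ^ k * ‖L (slice z.1 Φ) z.2‖ + ‖z.2‖ ^ k * ‖L (slice z.1 Φ) z.2‖ := by
      rw [add_mul]; rfl
    _ ≤ q₁ Φ + q₂ Φ := by
      refine add_le_add ?_ ?_
      · refine le_trans ?_ (h₁ Φ z.1)
        gcongr
        exact SchwartzMap.norm_le_seminorm ℂ _ _
      · refine le_trans ?_ (h₂ Φ z.1)
        rw [pow_zero, one_mul]
        exact SchwartzMap.norm_pow_mul_le_seminorm ℂ _ _ _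

theorem exists_norm_sliceRem_le [FiniteDimensional ℝ F]
    (L : 𝓢(F, ℂ) →L[ℂ] 𝓢(G, ℂ)) (Φ : 𝓢(E × F, ℂ)) :
    ∃ C : ℝ, ∀ (x v : E) (t : G), ‖L (sliceRem Φ x v) t‖ ≤ C * ‖v‖ ^ 2 := by
  obtain ⟨s, C, h⟩ := exists_finset_bound L 0
  choose K hK hKb using fun i : ℕ × ℕ => exists_seminorm_sliceRem_le i.1 i.2 Φ
  refine ⟨C * ∑ i ∈ s, K i, fun x v t => ?_⟩
  refine (SchwartzMap.norm_le_seminorm ℂ _ _).trans ((h _).trans ?_)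
  rw [mul_assoc, Finset.sum_mul]
  exact mul_le_mul_of_nonneg_left (Finset.sum_le_sum fun i _ => hKb i x v) C.2

theorem hasFDerivAt_partialFun [FiniteDimensional ℝ E] [FiniteDimensional ℝ F]
    (L : 𝓢(F, ℂ) →L[ℂ] 𝓢(G, ℂ)) (Φ : 𝓢(E × F, ℂ)) (z : E × G) :
    ∃ D : E × G →L[ℝ] ℂ, HasFDerivAt (partialFun L Φ) D z ∧
      ∀ v w, D (v, w) = partialFun L (∂_{(v, (0 : F))} Φ) z +
        partialFun ((lineDerivOpCLM ℂ 𝓢(G, ℂ) w) ∘L L) Φ z := by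
  let b := Module.finBasis ℝ E
  let c : Fin (Module.finrank ℝ E) → E →L[ℝ] ℝ := fun i => LinearMap.toContinuousLinearMap (b.coord i)
  let ψ : Fin (Module.finrank ℝ E) → 𝓢(G, ℂ) := fun i =>
    L (slice z.1 (∂_{(b i, (0 : F))} Φ))
  have hlin : ∀ v : E, L (slice z.1 (∂_{(v, (0 : F))} Φ)) = ∑ i, (c i v : ℂ) • ψ i := by
    intro v
    have hv : ((v, (0 : F)) : E × F) = ∑ i, c i v • ((b i, (0 : F)) : E × F) := by
      ext
      · simp [Prod.fst_sum, c]
      · simp [Prod.snd_sum]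
    have h2 : (∂_{((v, (0 : F)) : E × F)} Φ : 𝓢(E × F, ℂ)) =
        ∑ i, (c i v : ℂ) • (∂_{((b i, (0 : F)) : E × F)} Φ : 𝓢(E × F, ℂ)) := by
      ext y
      rw [lineDerivOp_apply_eq_fderiv, hv, map_sum]
      simp only [map_smul, sum_apply, smul_apply, lineDerivOp_apply_eq_fderiv,
        Complex.coe_smul]
    rw [h2, map_sum, map_sum]
    simp [ψ]
  obtain ⟨C, hC⟩ := exists_norm_sliceRem_le L Φ
  have hdec : partialFun L Φ = fun y : E × G => L (slice z.1 Φ) y.2 +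
      ∑ i, (c i (y.1 - z.1)) • (ψ i y.2) + L (sliceRem Φ z.1 (y.1 - z.1)) y.2 := by
    funext y
    have : slice y.1 Φ = slice z.1 Φ + slice z.1 (∂_{(y.1 - z.1, (0 : F))} Φ) +
        sliceRem Φ z.1 (y.1 - z.1) := by
      unfold sliceRem; rw [add_sub_cancel]; abel
    unfold partialFun
    rw [this, map_add, map_add, hlin]
    simp
  have h1 : HasFDerivAt (fun y : E × G => L (slice z.1 Φ) y.2)
      ((fderiv ℝ (L (slice z.1 Φ)) z.2) ∘L ContinuousLinearMap.snd ℝ E G) z :=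
    ((L (slice z.1 Φ)).hasFDerivAt z.2).comp z hasFDerivAt_snd
  have h2 : ∀ i, HasFDerivAt (fun y : E × G => (c i (y.1 - z.1)) • (ψ i y.2))
      (((c i) ∘L ContinuousLinearMap.fst ℝ E G).smulRight (ψ i z.2)) z := by
    intro i
    have ha : HasFDerivAt (fun y : E × G => c i (y.1 - z.1))
        ((c i) ∘L ContinuousLinearMap.fst ℝ E G) z :=
      (c i).hasFDerivAt.comp z (hasFDerivAt_fst.sub_const _)
    have hb : HasFDerivAt (fun y : E × G => ψ i y.2)
        ((fderiv ℝ (ψ i) z.2) ∘L ContinuousLinearMap.snd ℝ E G) z :=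
      ((ψ i).hasFDerivAt z.2).comp z hasFDerivAt_snd
    have := ha.smul hb
    rw [sub_self, map_zero, zero_smul, zero_add] at this
    exact this
  have h3 : HasFDerivAt (fun y : E × G => L (sliceRem Φ z.1 (y.1 - z.1)) y.2)
      (0 : E × G →L[ℝ] ℂ) z := by
    have hO : (fun y : E × G => L (sliceRem Φ z.1 (y.1 - z.1)) y.2) =O[nhds z]
        fun y => ‖y - z‖ ^ 2 := by
      refine Asymptotics.IsBigO.of_bound |C| (Filter.Eventually.of_forall fun y => ?_)
      rw [Real.norm_of_nonneg (by positivity)]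
      refine (hC z.1 (y.1 - z.1) y.2).trans ?_
      gcongr
      · exact le_abs_self C
      · exact norm_fst_le (y - z)
    exact hO.hasFDerivAt (by norm_num)
  refine ⟨_, by rw [hdec]; exact (h1.add (HasFDerivAt.fun_sum fun i _ => h2 i)).add h3, ?_⟩
  intro v w
  have e1 : partialFun L (∂_{(v, (0 : F))} Φ) z = ∑ i, c i v • ψ i z.2 := by
    unfold partialFun; rw [hlin]; simp
  have e2 : partialFun ((lineDerivOpCLM ℂ 𝓢(G, ℂ) w) ∘L L) Φ z =
      fderiv ℝ (L (slice z.1 Φ)) z.2 w := rfl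
  rw [e1, e2]
  simp [add_comm]

theorem fderiv_partialFun [FiniteDimensional ℝ E] [FiniteDimensional ℝ F]
    (L : 𝓢(F, ℂ) →L[ℂ] 𝓢(G, ℂ)) (Φ : 𝓢(E × F, ℂ)) (v : E × G) :
    (fun z => fderiv ℝ (partialFun L Φ) z v) = fun z =>
      partialFun L (∂_{(v.1, (0 : F))} Φ) z +
        partialFun ((lineDerivOpCLM ℂ 𝓢(G, ℂ) v.2) ∘L L) Φ z := by
  funext z
  obtain ⟨D, h1, h2⟩ := hasFDerivAt_partialFun L Φ z
  rw [h1.fderiv]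
  exact h2 v.1 v.2

theorem contDiff_partialFun [FiniteDimensional ℝ E] [FiniteDimensional ℝ F]
    [FiniteDimensional ℝ G] (L : 𝓢(F, ℂ) →L[ℂ] 𝓢(G, ℂ)) (Φ : 𝓢(E × F, ℂ)) :
    ContDiff ℝ ∞ (partialFun L Φ) := by
  rw [contDiff_infty]
  intro n
  induction n generalizing L Φ with
  | zero =>
    refine contDiff_zero.2 (Differentiable.continuous (𝕜 := ℝ) fun z => ?_)
    obtain ⟨D, h1, -⟩ := hasFDerivAt_partialFun L Φ z
    exact h1.differentiableAt
  | succ n ih =>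
    have hdiff : Differentiable ℝ (partialFun L Φ) := fun z => by
      obtain ⟨D, h1, -⟩ := hasFDerivAt_partialFun L Φ z
      exact h1.differentiableAt
    push_cast
    refine contDiff_succ_iff_fderiv.2 ⟨hdiff, by simp, ?_⟩
    refine contDiff_clm_apply_iff.2 fun v => ?_
    rw [fderiv_partialFun]
    exact (ih _ _).add (ih _ _)

theorem exists_partialFun_iteratedFDeriv_bound [FiniteDimensional ℝ E] [FiniteDimensional ℝ F]
    [FiniteDimensional ℝ G] (k n : ℕ) : ∀ (L : 𝓢(F, ℂ) →L[ℂ] 𝓢(G, ℂ)),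
    ∃ q : Seminorm ℂ 𝓢(E × F, ℂ), Continuous q ∧ ∀ (Φ : 𝓢(E × F, ℂ)) (z : E × G),
      ‖z‖ ^ k * ‖iteratedFDeriv ℝ n (partialFun L Φ) z‖ ≤ q Φ := by
  induction n with
  | zero =>
    intro L
    obtain ⟨q, hq, h⟩ := exists_partialFun_bound (E := E) L k
    exact ⟨q, hq, fun Φ z => by rw [norm_iteratedFDeriv_zero]; exact h Φ z⟩
  | succ n ih =>
    intro L
    let b := Module.finBasis ℝ (E × G)
    obtain ⟨B, hB, hBf⟩ := exists_norm_iteratedFDeriv_succ_le b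
    choose q hq h using ih
    let A : Fin (Module.finrank ℝ (E × G)) → 𝓢(E × F, ℂ) →L[ℂ] 𝓢(E × F, ℂ) := fun i =>
      lineDerivOpCLM ℂ 𝓢(E × F, ℂ) ((b i).1, (0 : F))
    let M : Fin (Module.finrank ℝ (E × G)) → 𝓢(F, ℂ) →L[ℂ] 𝓢(G, ℂ) := fun i =>
      (lineDerivOpCLM ℂ 𝓢(G, ℂ) (b i).2) ∘L L
    lift B to ℝ≥0 using hB
    let Q : Seminorm ℂ 𝓢(E × F, ℂ) := B •
      ∑ i, ((q L).comp (A i : 𝓢(E × F, ℂ) →ₗ[ℂ] 𝓢(E × F, ℂ)) + q (M i))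
    have hQ : ∀ Φ, Q Φ = B * ∑ i, (q L (A i Φ) + q (M i) Φ) := fun Φ => by
      exact seminorm_smul_sum_apply _ _ _ _
    refine ⟨Q, ?_, fun Φ z => ?_⟩
    · have : ⇑Q = fun Φ => B * ∑ i, (q L (A i Φ) + q (M i) Φ) := funext hQ
      rw [this]
      exact continuous_const.mul (continuous_finsetSum _ fun i _ =>
        ((hq L).comp (A i).continuous).add (hq (M i)))
    rw [hQ]
    have h1 := hBf (partialFun L Φ) (contDiff_partialFun L Φ) n z
    calc ‖z‖ ^ k * ‖iteratedFDeriv ℝ (n + 1) (partialFun L Φ) z‖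
        ≤ ‖z‖ ^ k * (B * ∑ i, ‖iteratedFDeriv ℝ n
            (fun y => fderiv ℝ (partialFun L Φ) y (b i)) z‖) := by gcongr
      _ = B * ∑ i, ‖z‖ ^ k * ‖iteratedFDeriv ℝ n
            (fun y => fderiv ℝ (partialFun L Φ) y (b i)) z‖ := by
          rw [← Finset.mul_sum, mul_left_comm]
      _ ≤ _ := by
          refine mul_le_mul_of_nonneg_left (Finset.sum_le_sum fun i _ => ?_) B.2
          rw [fderiv_partialFun]
          have ha : ContDiffAt ℝ n (partialFun L (A i Φ)) z :=
            ((contDiff_partialFun L _).of_le (mod_cast le_top)).contDiffAt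
          have hb : ContDiffAt ℝ n (partialFun (M i) Φ) z :=
            ((contDiff_partialFun (M i) _).of_le (mod_cast le_top)).contDiffAt
          have hadd := iteratedFDeriv_add_apply ha hb
          have : (fun z => partialFun L (∂_{((b i).1, (0 : F))} Φ) z +
              partialFun ((lineDerivOpCLM ℂ 𝓢(G, ℂ) (b i).2) ∘L L) Φ z) =
              partialFun L (A i Φ) + partialFun (M i) Φ := rfl
          rw [this, hadd]
          calc _ ≤ ‖z‖ ^ k * (‖iteratedFDeriv ℝ n (partialFun L (A i Φ)) z‖ +
                ‖iteratedFDeriv ℝ n (partialFun (M i) Φ) z‖) := by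
                gcongr; exact norm_add_le _ _
            _ ≤ _ := by
                rw [mul_add]
                exact add_le_add (h L _ z) (h (M i) _ z)

/-- The operator `id ⊗ L` on Schwartz functions of two variables: `L` acts on the second one. -/
def partialMap [FiniteDimensional ℝ E] [FiniteDimensional ℝ F] [FiniteDimensional ℝ G]
    (L : 𝓢(F, ℂ) →L[ℂ] 𝓢(G, ℂ)) : 𝓢(E × F, ℂ) →L[ℂ] 𝓢(E × G, ℂ) :=
  mkCLM (fun Φ z => L (slice z.1 Φ) z.2)
    (fun Φ Ψ z => by simp) (fun a Φ z => by simp)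
    (contDiff_partialFun L) (fun n => by
      obtain ⟨q, hq, h⟩ := exists_partialFun_iteratedFDeriv_bound (E := E) n.1 n.2 L
      obtain ⟨s, C, -, hC⟩ := Seminorm.bound_of_continuous
        (schwartz_withSeminorms ℂ (E × F) ℂ) q hq
      exact ⟨s, C, C.2, fun Φ z => (h Φ z).trans (hC Φ)⟩)


@[simp] theorem partialMap_apply [FiniteDimensional ℝ E] [FiniteDimensional ℝ F]
    [FiniteDimensional ℝ G] (L : 𝓢(F, ℂ) →L[ℂ] 𝓢(G, ℂ)) (Φ : 𝓢(E × F, ℂ)) (x : E) (t : G) :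
    partialMap L Φ (x, t) = L (slice x Φ) t := rfl

/-- An auxiliary Schwartz function on the one-point space `ℝ⁰`. -/
def unitSchwartz : 𝓢(EuclideanSpace ℝ (Fin 0), ℂ) :=
  HasCompactSupport.toSchwartzMap (f := fun _ => (1 : ℂ))
    (HasCompactSupport.of_compactSpace _) contDiff_const

/-- A tempered distribution as an element of the dual of the Schwartz space. -/
def asCLM (g : 𝓢'(V, ℂ)) : 𝓢(V, ℂ) →L[ℂ] ℂ where
  toFun := fun φ => g φ
  map_add' := fun φ ψ => map_add g φ ψ
  map_smul' := fun c φ => map_smul g c φ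
  cont := g.continuous

/-- Apply a tempered distribution in the second variable: `Φ ↦ (x ↦ g (Φ (x, ·)))`,
as a continuous map from `𝓢(E × F)` to `𝓢(E)`; see `partialPairing_apply`. -/
def partialPairing [FiniteDimensional ℝ E] [FiniteDimensional ℝ F] (g : 𝓢'(F, ℂ)) :
    𝓢(E × F, ℂ) →L[ℂ] 𝓢(E, ℂ) :=
  (compCLMOfContinuousLinearEquiv ℂ
    (ContinuousLinearEquiv.prodUnique ℝ E (EuclideanSpace ℝ (Fin 0))).symm) ∘L
    partialMap ((asCLM g).smulRight unitSchwartz)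

@[simp] theorem partialPairing_apply [FiniteDimensional ℝ E] [FiniteDimensional ℝ F]
    (g : 𝓢'(F, ℂ)) (Φ : 𝓢(E × F, ℂ)) (x : E) :
    partialPairing g Φ x = g (slice x Φ) := by
  change g (slice x Φ) * unitSchwartz _ = _
  have : unitSchwartz 0 = 1 := rfl
  rw [Subsingleton.elim (Prod.snd _) (0 : EuclideanSpace ℝ (Fin 0)), this, mul_one]

/-- The tensor product `f ⊗ g` of two tempered distributions, `(f ⊗ g)(Φ) = f_x (g_y (Φ (x, y)))`. -/
def tensor [FiniteDimensional ℝ E] [FiniteDimensional ℝ F] (f : 𝓢'(E, ℂ)) (g : 𝓢'(F, ℂ)) :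
    𝓢'(E × F, ℂ) :=
  PointwiseConvergenceCLM.precomp ℂ (partialPairing g) f

theorem tensor_apply [FiniteDimensional ℝ E] [FiniteDimensional ℝ F] (f : 𝓢'(E, ℂ))
    (g : 𝓢'(F, ℂ)) (Φ : 𝓢(E × F, ℂ)) : tensor f g Φ = f (partialPairing g Φ) := rfl

/-- Pointwise complex conjugate of a Schwartz function. -/
def conjS (φ : 𝓢(V, ℂ)) : 𝓢(V, ℂ) := postcompCLM (Complex.conjCLE : ℂ →L[ℝ] ℂ) φ

@[simp] theorem conjS_apply (φ : 𝓢(V, ℂ)) (x : V) : conjS φ x = (starRingEnd ℂ) (φ x) := rfl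

/-- Complex conjugate of a tempered distribution, `ḡ(φ) = conj (g (conj φ))`. -/
def conjDist (g : 𝓢'(V, ℂ)) : 𝓢'(V, ℂ) :=
  ContinuousLinearMap.toPointwiseConvergenceCLM _ (RingHom.id ℂ) _ _
    { toFun := fun φ => (starRingEnd ℂ) (g (conjS φ))
      map_add' := fun φ ψ => by
        have : conjS (φ + ψ) = conjS φ + conjS ψ := by ext x; simp
        rw [this, map_add, map_add]
      map_smul' := fun c φ => by
        have : conjS (c • φ) = (starRingEnd ℂ) c • conjS φ := by ext x; simp
        rw [this, map_smul]; simp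
      cont := Complex.continuous_conj.comp (g.continuous.comp
        (postcompCLM (Complex.conjCLE : ℂ →L[ℝ] ℂ)).continuous) }

theorem conjDist_apply (g : 𝓢'(V, ℂ)) (φ : 𝓢(V, ℂ)) :
    conjDist g φ = (starRingEnd ℂ) (g (conjS φ)) := rfl

end

noncomputable section

/-- The Euclidean space `ℝᵈ`. -/
abbrev Rd (d : ℕ) := EuclideanSpace ℝ (Fin d)

variable {d : ℕ}

/-- Partial Fourier transform in the second variable on Schwartz functions,
`(𝓕₂ Φ)(x, ω) = ∫ e^{-2πi y·ω} Φ(x, y) dy`. -/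
def partialFourier : 𝓢(Rd d × Rd d, ℂ) →L[ℂ] 𝓢(Rd d × Rd d, ℂ) :=
  partialMap (FourierTransform.fourierCLM ℂ 𝓢(Rd d, ℂ))

theorem partialFourier_apply (Φ : 𝓢(Rd d × Rd d, ℂ)) (x η : Rd d) :
    partialFourier Φ (x, η) =
      ∫ y : Rd d, Complex.exp (((-2 * Real.pi * inner ℝ y η : ℝ) : ℂ) * Complex.I) * Φ (x, y) := by
  change 𝓕 (slice x Φ : Rd d → ℂ) η = _
  rw [Real.fourier_eq']
  rfl

/-- Partial Fourier transform in the second variable of a tempered distribution (by duality). -/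
def partialFourierDist (T : 𝓢'(Rd d × Rd d, ℂ)) : 𝓢'(Rd d × Rd d, ℂ) :=
  PointwiseConvergenceCLM.precomp ℂ partialFourier T

/-- The change of variables `L_τ (x, t) = (x + τ t, x - (1 - τ) t)`, whose determinant is `± 1`. -/
def tauCoord (τ : ℝ) : (Rd d × Rd d) ≃L[ℝ] (Rd d × Rd d) :=
  LinearEquiv.toContinuousLinearEquiv
    { toFun := fun z => (z.1 + τ • z.2, z.1 - (1 - τ) • z.2)
      invFun := fun z => ((1 - τ) • z.1 + τ • z.2, z.1 - z.2)
      map_add' := fun z w => by ext <;> simp <;> ring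
      map_smul' := fun c z => by ext <;> simp <;> ring
      left_inv := fun z => by ext <;> simp <;> ring
      right_inv := fun z => by ext <;> simp <;> ring }

/-- The composition `T ∘ L_τ` of a tempered distribution with `L_τ`. Since `|det L_τ| = 1`, it is
given by `(T ∘ L_τ)(Φ) = T (Φ ∘ L_τ⁻¹)`. -/
def compTauCoord (τ : ℝ) (T : 𝓢'(Rd d × Rd d, ℂ)) : 𝓢'(Rd d × Rd d, ℂ) :=
  PointwiseConvergenceCLM.precomp ℂ (compCLMOfContinuousLinearEquiv ℂ (tauCoord τ).symm) T

/-- The cross-`τ`-Wigner distribution of two tempered distributions, defined as the tempered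
distribution `W_τ(f, g) = 𝓕₂ ((f ⊗ ḡ) ∘ L_τ)`, i.e. (in the sense of distributions)
`W_τ(f, g)(x, ξ) = ∫ e^{-2πi t·ξ} f(x + τ t) conj (g (x - (1 - τ) t)) dt`. -/
def tauWigner (τ : ℝ) (f g : 𝓢'(Rd d, ℂ)) : 𝓢'(Rd d × Rd d, ℂ) :=
  partialFourierDist (compTauCoord τ (tensor f (conjDist g)))

theorem tauWigner_apply (τ : ℝ) (f g : 𝓢'(Rd d, ℂ)) (Φ : 𝓢(Rd d × Rd d, ℂ)) :
    tauWigner τ f g Φ = f (partialPairing (conjDist g)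
      (compCLMOfContinuousLinearEquiv ℂ (tauCoord τ).symm (partialFourier Φ))) := rfl

/-- The modulation factor `y ↦ e^{2πi y·ξ}`. -/
def modChar (ξ : Rd d) (y : Rd d) : ℂ :=
  Complex.exp (((2 * Real.pi * inner ℝ y ξ : ℝ) : ℂ) * Complex.I)

theorem hasTemperateGrowth_modChar (ξ : Rd d) : (modChar ξ).HasTemperateGrowth := by
  have hexp : (fun r : ℝ => Complex.exp ((r : ℂ) * Complex.I)).HasTemperateGrowth := by
    have hn : ∀ n : ℕ, iteratedDeriv n (fun r : ℝ => Complex.exp ((r : ℂ) * Complex.I)) =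
        fun r : ℝ => Complex.I ^ n * Complex.exp ((r : ℂ) * Complex.I) := by
      intro n
      induction n with
      | zero => simp
      | succ n ih =>
        rw [iteratedDeriv_succ, ih]
        funext r
        have h1 : HasDerivAt (fun r : ℝ => (r : ℂ) * Complex.I) (1 * Complex.I) r :=
          (Complex.ofRealCLM.hasDerivAt (x := r)).mul_const Complex.I
        rw [(h1.cexp.const_mul (Complex.I ^ n)).deriv]
        ring
    refine ⟨?_, fun n => ⟨0, 1, fun r => ?_⟩⟩
    · exact Complex.contDiff_exp.comp (Complex.ofRealCLM.contDiff.mul contDiff_const)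
    · rw [norm_iteratedFDeriv_eq_norm_iteratedDeriv, hn]
      simp [Complex.norm_exp]
  have hlin : (fun y : Rd d => 2 * Real.pi * inner ℝ y ξ).HasTemperateGrowth :=
    (Function.HasTemperateGrowth.const _).mul (Function.hasTemperateGrowth_inner_left ξ)
  exact hexp.comp hlin

/-- The time-frequency shift `π(x, ξ) φ (y) = e^{2πi y·ξ} φ(y - x)` of a Schwartz function. -/
def tfShift (x ξ : Rd d) (φ : 𝓢(Rd d, ℂ)) : 𝓢(Rd d, ℂ) :=
  smulLeftCLM ℂ (modChar ξ) (compSubConstCLM ℂ x φ)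

theorem tfShift_apply (x ξ : Rd d) (φ : 𝓢(Rd d, ℂ)) (y : Rd d) :
    tfShift x ξ φ y =
      Complex.exp (((2 * Real.pi * inner ℝ y ξ : ℝ) : ℂ) * Complex.I) * φ (y - x) := by
  unfold tfShift
  rw [smulLeftCLM_apply_apply (hasTemperateGrowth_modChar ξ)]
  simp [modChar]

/-- The short-time Fourier transform `V_φ f (x, ξ) = ⟨f, π(x, ξ) φ⟩` of a tempered distribution `f`
with Schwartz window `φ`; the brackets are conjugate-linear in the second entry. -/
def stft (φ : 𝓢(Rd d, ℂ)) (f : 𝓢'(Rd d, ℂ)) (z : Rd d × Rd d) : ℂ :=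
  f (conjS (tfShift z.1 z.2 φ))

/-- The weight `v_s(z) = (1 + |z|²)^{s/2}` on `ℝ²ᵈ`, with `|(x, ξ)|² = |x|² + |ξ|²`. -/
def vWeight (s : ℝ) (z : Rd d × Rd d) : ℝ :=
  (1 + (‖z.1‖ ^ 2 + ‖z.2‖ ^ 2)) ^ (s / 2)

/-- The weighted mixed (quasi-)norm
`‖F‖_{L^{p,q}_m} = (∫ (∫ |F(x, ξ)|^p m(x, ξ)^p dx)^{q/p} dξ)^{1/q}` with values in `[0, ∞]`
(with essential suprema for infinite exponents). -/
def mixedNorm (p q : ℝ≥0∞) (m : Rd d × Rd d → ℝ) (F : Rd d × Rd d → ℂ) : ℝ≥0∞ :=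
  eLpNorm (fun ξ : Rd d => eLpNorm (fun x : Rd d => (m (x, ξ) : ℂ) * F (x, ξ)) p volume) q volume

/-- The (quasi-)norm of the modulation space `M^{p,q}_m(ℝᵈ)` with respect to the window `φ`. -/
def modulationNorm (φ : 𝓢(Rd d, ℂ)) (p q : ℝ≥0∞) (m : Rd d × Rd d → ℝ) (f : 𝓢'(Rd d, ℂ)) :
    ℝ≥0∞ :=
  mixedNorm p q m (stft φ f)

/-- The modulation space `M^{p,q}_m(ℝᵈ)`, defined through the window `φ`. -/
def modulationSpace (φ : 𝓢(Rd d, ℂ)) (p q : ℝ≥0∞) (m : Rd d × Rd d → ℝ) : Set 𝓢'(Rd d, ℂ) :=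
  {f | modulationNorm φ p q m f < ⊤}

/-- The tempered distribution `T` is given by the measurable function `F`. -/
def IsGivenBy (T : 𝓢'(Rd d × Rd d, ℂ)) (F : Rd d × Rd d → ℂ) : Prop :=
  AEStronglyMeasurable F volume ∧
    ∀ Φ : 𝓢(Rd d × Rd d, ℂ), Integrable (fun z => F z * Φ z) volume ∧ T Φ = ∫ z, F z * Φ z

/-- The tempered distribution `T` belongs to `L^{p,q}_m(ℝ²ᵈ)`: it is given by a function `F` with
`‖F‖_{L^{p,q}_m} < ∞`. -/
def MemMixedLp (p q : ℝ≥0∞) (m : Rd d × Rd d → ℝ) (T : 𝓢'(Rd d × Rd d, ℂ)) : Prop :=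
  ∃ F : Rd d × Rd d → ℂ, IsGivenBy T F ∧ mixedNorm p q m F < ⊤

/-- The `L^{p,q}_m` (quasi-)norm of a tempered distribution: `‖F‖_{L^{p,q}_m}` if `T` is given by
a function `F` (which is then unique almost everywhere), and `∞` if `T` is not a function. -/
def distMixedNorm (p q : ℝ≥0∞) (m : Rd d × Rd d → ℝ) (T : 𝓢'(Rd d × Rd d, ℂ)) : ℝ≥0∞ :=
  ⨅ (F : Rd d × Rd d → ℂ) (_ : IsGivenBy T F), mixedNorm p q m F

end

end TauWigner

open TauWigner

/-!
For a Schwartz window `g` the substitution `x + τ t ↦ y` shows that, up to a phase factor and a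
constant, `W_τ(f, g)(x, ξ)` is the dilated short-time Fourier transform
`V_χ f (x / (1 - τ), ξ / τ)` with the window `χ(t) = g(-((1 - τ) / τ) t)` (`isGivenBy_tauWigner`).
Since the function that represents a distribution is unique (`ae_eq_of_isGivenBy`) and the weights
`v_s` are moderate, the first part is the independence of the modulation spaces of the Schwartz
window, in the full range `0 < p, q ≤ ∞` (`exists_modulationNorm_le`). That rests on the inversion
formula `stft_inversion`, by which `|V_ψ f|` is dominated by the convolution of `|V_φ f|` with a
Schwartz function, and, where Young's inequality fails, on a maximal function of Peetre type: it
replaces the domination of `|V_ψ f|` by one of `|V_ψ f|^r`, with `r = min(1, p, q)`, after which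
Young's inequality applies with the exponents `p / r` and `q / r` (`exists_stft_rpow_le`).

For a window `g ∈ M^1_{v_s}` and `p, q ≥ 1`, choose `γ` with `⟨ḡ, γ⟩ = 1`. Inverting the partial
Fourier transform and the change of variables on `conj (π(z) φ) ⊗ γ` yields test functions on which
`W_τ(f, g)` takes the values `V_φ f(z)`; up to phases they are translates of a single Schwartz
function, so that Young's inequality bounds the modulation norm
(`exists_modulationNorm_le_distMixedNorm`). Conversely, `g` is a superposition of the Schwartz
functions `π(w) φ` with coefficients `V_φ g(w)`, hence `W_τ(f, g)` is the superposition of the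
`W_τ(f, π(w) φ)` (`tauWigner_expansion`). Their representing functions are known from the first part,
and the superposition converges absolutely by Young's inequality
(`exists_distMixedNorm_le_modulationNorm`).

Everything that moves a tempered distribution under an integral goes through
`distribution_integral_comm`: a tempered distribution extends to a bounded functional on a finite
product of spaces of bounded continuous functions, where the integral is a Bochner integral.
-/


/-! ### Hölder's and Minkowski's inequalities for functions with values in `[0, ∞]` -/

section Minkowski

variable {α β : Type*} [MeasurableSpace α] [MeasurableSpace β] {μ : Measure α} {ν : Measure β}

theorem measurable_eLpNorm_section [SFinite μ] {H : α × β → ℝ≥0∞} (hH : Measurable H)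
    (p : ℝ≥0∞) : Measurable fun y => eLpNorm (fun x => H (x, y)) p μ := by
  rcases eq_or_ne p 0 with rfl | h0
  · simp
  rcases eq_or_ne p ⊤ with rfl | ht
  · simp only [eLpNorm_exponent_top, eLpNormEssSup_eq_essSup_enorm, enorm_eq_self]
    refine measurable_of_Ioi fun a => ?_
    have : (fun y => essSup (fun x => H (x, y)) μ) ⁻¹' Set.Ioi a =
        {y | μ ((fun x => (x, y)) ⁻¹' {z | a < H z}) ≠ 0} := by
      ext y
      simp only [Set.mem_preimage, Set.mem_Ioi, Set.mem_ofPred_eq, Set.preimage_ofPred_eq]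
      rw [← not_le, not_iff_comm, not_not]
      constructor
      · intro h
        refine essSup_le_of_ae_le a ?_
        rw [Filter.EventuallyLE, ae_iff]
        simpa using h
      · intro h
        have h2 := ae_le_essSup (μ := μ) (f := fun x => H (x, y))
        rw [ae_iff] at h2
        refine measure_mono_null (fun x hx => ?_) h2
        simp only [Set.mem_ofPred_eq, not_le] at hx ⊢
        exact h.trans_lt hx
    rw [this]
    exact (measurable_measure_prodMk_right (measurableSet_lt measurable_const hH))
      (measurableSet_singleton (0 : ℝ≥0∞)).compl
  · simp only [eLpNorm_eq_lintegral_rpow_enorm_toReal h0 ht, enorm_eq_self]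
    exact ((hH.pow_const _).lintegral_prod_left').pow_const _

/-- Hölder's inequality for functions with values in `[0, ⊤]`. -/
theorem lintegral_mul_le_eLpNorm_mul_eLpNorm (p q : ℝ≥0∞) [hpq : p.HolderConjugate q]
    {f g : α → ℝ≥0∞} (hf : AEMeasurable f μ) (hg : AEMeasurable g μ) :
    ∫⁻ x, f x * g x ∂μ ≤ eLpNorm f p μ * eLpNorm g q μ := by
  have one_top : ∀ {f g : α → ℝ≥0∞}, AEMeasurable f μ →
      ∫⁻ x, f x * g x ∂μ ≤ eLpNorm f 1 μ * eLpNorm g ⊤ μ := fun {f g} hf => by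
    rw [eLpNorm_one_eq_lintegral_enorm, eLpNorm_exponent_top, eLpNormEssSup_eq_essSup_enorm]
    simp only [enorm_eq_self]
    rw [← lintegral_mul_const'' _ hf]
    refine lintegral_mono_ae ?_
    filter_upwards [ae_le_essSup (μ := μ) (f := g)] with x hx
    gcongr
  rcases eq_or_ne p ⊤ with rfl | hpt
  · have : q = 1 := (ENNReal.HolderConjugate.eq_top_iff_eq_one ⊤ q).1 rfl
    subst this
    simp_rw [mul_comm (f _)]
    rw [mul_comm]
    exact one_top hg
  rcases eq_or_ne q ⊤ with rfl | hqt
  · have : p = 1 := (ENNReal.HolderConjugate.eq_top_iff_eq_one ⊤ p).1 rfl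
    subst this
    exact one_top hf
  have hp0 : p ≠ 0 := ENNReal.HolderConjugate.ne_zero p q
  have hq0 : q ≠ 0 := ENNReal.HolderConjugate.ne_zero q p
  have hc : p.toReal.HolderConjugate q.toReal := ENNReal.HolderConjugate.toReal_of_ne_top hpt hqt
  have := ENNReal.lintegral_mul_le_Lp_mul_Lq μ hc hf hg
  rw [eLpNorm_eq_lintegral_rpow_enorm_toReal hp0 hpt,
    eLpNorm_eq_lintegral_rpow_enorm_toReal hq0 hqt]
  simpa using this

/-- Minkowski's integral inequality. For finite `p > 1`, write `h = h^{1 - 1/p} h^{1/p}` for an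
integrable simple function `h ≤ (∫ H)^p` and apply Hölder's inequality. -/
theorem eLpNorm_lintegral_le [SigmaFinite μ] [SFinite ν] {p : ℝ≥0∞} (hp : 1 ≤ p)
    {H : α × β → ℝ≥0∞} (hH : Measurable H) :
    eLpNorm (fun x => ∫⁻ y, H (x, y) ∂ν) p μ ≤ ∫⁻ y, eLpNorm (fun x => H (x, y)) p μ ∂ν := by
  have hmeas := measurable_eLpNorm_section (μ := μ) hH p
  have hp0 : p ≠ 0 := (zero_lt_one.trans_le hp).ne'
  rcases eq_or_ne p ⊤ with rfl | hpt
  · simp only [eLpNorm_exponent_top, eLpNormEssSup_eq_essSup_enorm, enorm_eq_self] at hmeas ⊢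
    refine essSup_le_of_ae_le _ ?_
    have h1 : ∀ᵐ y ∂ν, ∀ᵐ x ∂μ, H (x, y) ≤ essSup (fun x => H (x, y)) μ :=
      Filter.Eventually.of_forall fun y => ae_le_essSup
    have h2 : ∀ᵐ x ∂μ, ∀ᵐ y ∂ν, H (x, y) ≤ essSup (fun x => H (x, y)) μ := by
      refine (Measure.ae_ae_comm ?_).1 h1
      exact measurableSet_le (hH.comp measurable_swap) (hmeas.comp measurable_fst)
    filter_upwards [h2] with x hx
    exact lintegral_mono_ae hx
  set r := p.toReal with hr
  have hr1 : 1 ≤ r := by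
    have := ENNReal.toReal_mono hpt hp
    simpa using this
  have hr0 : 0 < r := by linarith
  set R := ∫⁻ y, eLpNorm (fun x => H (x, y)) p μ ∂ν with hR
  have key : ∀ g : α → ℝ≥0∞, Measurable g → (∀ x, g x ≤ ∫⁻ y, H (x, y) ∂ν) →
      ∫⁻ x, g x ^ r ∂μ ≠ ⊤ → ∫⁻ x, g x ^ r ∂μ ≤ R ^ r := by
    intro g hg hgle hfin
    set A := ∫⁻ x, g x ^ r ∂μ with hA
    have hA' : ¬ A = ⊤ := hfin
    rcases eq_or_ne A 0 with hA0 | hA0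
    · rw [hA0]; exact zero_le
    have h1 : A ≤ ∫⁻ y, ∫⁻ x, g x ^ (r - 1) * H (x, y) ∂μ ∂ν := by
      rw [lintegral_lintegral_swap
        (((hg.comp measurable_snd).pow_const _).mul (hH.comp measurable_swap)).aemeasurable]
      refine lintegral_mono fun x => ?_
      dsimp only
      rw [lintegral_const_mul (f := fun y => H (x, y)) _ (hH.comp measurable_prodMk_left)]
      calc g x ^ r = g x ^ ((r - 1) + 1) := by ring_nf
        _ = g x ^ (r - 1) * g x := by
          rw [ENNReal.rpow_add_of_nonneg _ _ (by linarith) zero_le_one, ENNReal.rpow_one]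
        _ ≤ _ := by gcongr; exact hgle x
    have h2 : ∀ y, ∫⁻ x, g x ^ (r - 1) * H (x, y) ∂μ ≤
        A ^ (1 - 1 / r) * eLpNorm (fun x => H (x, y)) p μ := fun y => by
      rw [eLpNorm_eq_lintegral_rpow_enorm_toReal hp0 hpt]
      simp only [enorm_eq_self, ← hr]
      rcases eq_or_lt_of_le hr1 with h | h
      · simp [← h]
      have hc := (Real.HolderConjugate.conjExponent h).symm
      have := ENNReal.lintegral_mul_le_Lp_mul_Lq μ hc (f := fun x => g x ^ (r - 1))
        (g := fun x => H (x, y)) (hg.pow_const _).aemeasurable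
        (hH.comp measurable_prodMk_right).aemeasurable
      have e : ∀ x, (g x ^ (r - 1)) ^ (Real.conjExponent r) = g x ^ r := fun x => by
        rw [← ENNReal.rpow_mul, Real.conjExponent, mul_div_cancel₀ _ (by linarith)]
      simp only [Pi.mul_apply, e] at this
      have e2 : 1 / r.conjExponent = 1 - 1 / r := by
        have h3 : r - 1 ≠ 0 := by linarith
        rw [Real.conjExponent]; field_simp
      rw [e2] at this
      exact this
    have h3 : A ≤ A ^ (1 - 1 / r) * R := by
      refine h1.trans ((lintegral_mono h2).trans ?_)
      rw [lintegral_const_mul _ hmeas]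
    have h4 : A ^ (1 / r) ≤ R := by
      have e : A = A ^ (1 - 1 / r) * A ^ (1 / r) := by
        rw [← ENNReal.rpow_add _ _ hA0 hfin]; simp
      have hne0 : A ^ (1 - 1 / r) ≠ 0 := by simp [ENNReal.rpow_eq_zero_iff, hA0, hA']
      have hnet : A ^ (1 - 1 / r) ≠ ⊤ := by simp [ENNReal.rpow_eq_top_iff, hA0, hA']
      rw [← ENNReal.mul_le_mul_iff_right hne0 hnet, ← e]
      exact h3
    calc A = (A ^ (1 / r)) ^ r := by rw [← ENNReal.rpow_mul]; field_simp; simp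
      _ ≤ R ^ r := by gcongr
  rw [eLpNorm_eq_lintegral_rpow_enorm_toReal hp0 hpt]
  simp only [enorm_eq_self, ← hr]
  rw [one_div, ENNReal.rpow_inv_le_iff hr0]
  refine le_of_forall_lt fun L hL => ?_
  rw [lintegral_eq_nnreal] at hL
  simp_rw [lt_iSup_iff] at hL
  obtain ⟨h₀, hle₀, hL₀⟩ := hL
  rw [← SimpleFunc.lintegral_eq_lintegral, SimpleFunc.coe_map] at hL₀
  obtain ⟨h, hle, hfin, hlt⟩ := SimpleFunc.exists_lt_lintegral_simpleFunc_of_lt_lintegral hL₀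
  have e : ∀ x, ((h x : ℝ≥0∞) ^ r⁻¹) ^ r = h x := fun x => by
    rw [← ENNReal.rpow_mul, inv_mul_cancel₀ hr0.ne', ENNReal.rpow_one]
  have := key (fun x => (h x : ℝ≥0∞) ^ r⁻¹) (h.measurable.coe_nnreal_ennreal.pow_const _)
    (fun x => by
      rw [ENNReal.rpow_inv_le_iff hr0]
      exact (ENNReal.coe_le_coe.2 (hle x)).trans (hle₀ x))
    (by simp only [e]; exact hfin.ne)
  simp only [e] at this
  exact hlt.trans_le this

end Minkowski


/-! ### Homogeneity, monotonicity and dilations of `L^p` quasi-norms -/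

section LpNorm

variable {α : Type*} [MeasurableSpace α] {μ : Measure α}

theorem eLpNorm_ennreal_const_mul {c : ℝ≥0∞} (hc : c ≠ ⊤) (f : α → ℝ≥0∞) (p : ℝ≥0∞) :
    eLpNorm (fun x => c * f x) p μ = c * eLpNorm f p μ := by
  rcases eq_or_ne p 0 with rfl | h0
  · simp
  rcases eq_or_ne p ⊤ with rfl | ht
  · simp only [eLpNorm_exponent_top, eLpNormEssSup_eq_essSup_enorm, enorm_eq_self]
    exact ENNReal.essSup_const_mul
  have hp : 0 < p.toReal := ENNReal.toReal_pos h0 ht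
  simp only [eLpNorm_eq_lintegral_rpow_enorm_toReal h0 ht, enorm_eq_self,
    ENNReal.mul_rpow_of_nonneg _ _ hp.le]
  rw [lintegral_const_mul' _ _ (ENNReal.rpow_ne_top_of_nonneg hp.le hc),
    ENNReal.mul_rpow_of_nonneg _ _ (by positivity), ← ENNReal.rpow_mul, mul_one_div_cancel hp.ne',
    ENNReal.rpow_one]

theorem eLpNorm_ennreal_mono_ae {f g : α → ℝ≥0∞} (p : ℝ≥0∞) (h : ∀ᵐ x ∂μ, f x ≤ g x) :
    eLpNorm f p μ ≤ eLpNorm g p μ :=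
  eLpNorm_mono_enorm_ae (by simpa using h)

/-- The constant depends on the dilation only, not on the translation; this uniformity is what Young's
inequality needs. -/
theorem exists_eLpNorm_comp_affine {E : Type*} [NormedAddCommGroup E] [NormedSpace ℝ E]
    [MeasurableSpace E] [BorelSpace E] [FiniteDimensional ℝ E] (μ : Measure E) [μ.IsAddHaarMeasure]
    (p : ℝ≥0∞) {a : ℝ} (ha : a ≠ 0) :
    ∃ C : ℝ≥0, ∀ (f : E → ℝ≥0∞) (u : E),
      eLpNorm (fun x => f (a • x + u)) p μ = C * eLpNorm f p μ := by
  set c : ℝ≥0∞ := ENNReal.ofReal |(a ^ Module.finrank ℝ E)⁻¹| with hc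
  have hc0 : c ≠ 0 := by simp [hc, ha]
  have hct : c ^ (1 / p).toReal ≠ ⊤ :=
    ENNReal.rpow_ne_top_of_nonneg (by positivity) ENNReal.ofReal_ne_top
  refine ⟨(c ^ (1 / p).toReal).toNNReal, fun f u => ?_⟩
  rw [ENNReal.coe_toNNReal hct]
  have h1 : MeasurableEmbedding (fun x : E => a • x) :=
    (Homeomorph.smulOfNeZero a ha).measurableEmbedding
  have h2 : MeasurableEmbedding (fun x : E => x + u) := measurableEmbedding_addRight u
  have e : (fun x => f (a • x + u)) = (fun y => f (y + u)) ∘ fun x => a • x := rfl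
  have e' : (fun x => f (x + u)) = f ∘ fun x => x + u := rfl
  rw [e, ← h1.eLpNorm_map_measure, Measure.map_addHaar_smul μ ha,
    eLpNorm_smul_measure_of_ne_zero hc0, e', ← h2.eLpNorm_map_measure, map_add_right_eq_self,
    smul_eq_mul]

end LpNorm

/-! ### Weighted mixed quasi-norms and Young's inequality -/

section MixedNorm

variable {d : ℕ}

/-- The unweighted mixed `L^{p,q}` quasi-norm of a function with values in `[0, ∞]`. -/
noncomputable def mixN (p q : ℝ≥0∞) (H : Rd d × Rd d → ℝ≥0∞) : ℝ≥0∞ :=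
  eLpNorm (fun ξ : Rd d => eLpNorm (fun x : Rd d => H (x, ξ)) p volume) q volume

/-- The weight `v_s` with values in `[0, ∞]`. -/
noncomputable def wt (s : ℝ) (z : Rd d × Rd d) : ℝ≥0∞ := ENNReal.ofReal (vWeight s z)

theorem mixN_mono_ae {p q : ℝ≥0∞} {H K : Rd d × Rd d → ℝ≥0∞} (h : ∀ᵐ z, H z ≤ K z) :
    mixN p q H ≤ mixN p q K := by
  refine eLpNorm_ennreal_mono_ae q ?_
  have h2 : ∀ᵐ w : Rd d × Rd d, H w.swap ≤ K w.swap :=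
    (Measure.measurePreserving_swap (μ := (volume : Measure (Rd d)))
      (ν := (volume : Measure (Rd d)))).quasiMeasurePreserving.ae h
  filter_upwards [Measure.ae_ae_of_ae_prod h2] with ξ hξ
  exact eLpNorm_ennreal_mono_ae p hξ

theorem mixN_mono {p q : ℝ≥0∞} {H K : Rd d × Rd d → ℝ≥0∞} (h : ∀ z, H z ≤ K z) :
    mixN p q H ≤ mixN p q K := mixN_mono_ae (Filter.Eventually.of_forall h)

theorem mixN_const_mul {c : ℝ≥0∞} (hc : c ≠ ⊤) (p q : ℝ≥0∞) (H : Rd d × Rd d → ℝ≥0∞) :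
    mixN p q (fun z => c * H z) = c * mixN p q H := by
  simp only [mixN, eLpNorm_ennreal_const_mul hc]

theorem mixN_rpow {r : ℝ} (hr : 0 < r) (p q : ℝ≥0∞) (H : Rd d × Rd d → ℝ≥0∞) :
    mixN p q (fun z => H z ^ r) =
      mixN (p * ENNReal.ofReal r) (q * ENNReal.ofReal r) H ^ r := by
  have h : ∀ (f : Rd d → ℝ≥0∞) (p : ℝ≥0∞), eLpNorm (fun x => f x ^ r) p volume =
      eLpNorm f (p * ENNReal.ofReal r) volume ^ r := fun f p => by
    simpa using eLpNorm_enorm_rpow (p := p) (μ := volume) f hr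
  simp only [mixN, h]

theorem exists_mixN_comp_affine (p q : ℝ≥0∞) {a b : ℝ} (ha : a ≠ 0) (hb : b ≠ 0) :
    ∃ C : ℝ≥0, ∀ (H : Rd d × Rd d → ℝ≥0∞) (u : Rd d × Rd d),
      mixN p q (fun z => H (a • z.1 + u.1, b • z.2 + u.2)) = C * mixN p q H := by
  obtain ⟨A, hA⟩ := exists_eLpNorm_comp_affine (volume : Measure (Rd d)) p ha
  obtain ⟨B, hB⟩ := exists_eLpNorm_comp_affine (volume : Measure (Rd d)) q hb
  refine ⟨A * B, fun H u => ?_⟩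
  unfold mixN
  have h1 : ∀ ξ : Rd d, eLpNorm (fun x => H (a • x + u.1, b • ξ + u.2)) p volume =
      A * eLpNorm (fun x => H (x, b • ξ + u.2)) p volume := fun ξ =>
    hA (fun x => H (x, b • ξ + u.2)) u.1
  simp only [h1]
  rw [eLpNorm_ennreal_const_mul ENNReal.coe_ne_top,
    hB (fun ξ => eLpNorm (fun x => H (x, ξ)) p volume) u.2]
  push_cast
  ring

/-- Minkowski's integral inequality for mixed norms. -/
theorem mixN_lintegral_le {β : Type*} [MeasurableSpace β] {ν : Measure β} [SFinite ν]
    {p q : ℝ≥0∞} (hp : 1 ≤ p) (hq : 1 ≤ q) {H : (Rd d × Rd d) × β → ℝ≥0∞} (hH : Measurable H) :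
    mixN p q (fun z => ∫⁻ w, H (z, w) ∂ν) ≤ ∫⁻ w, mixN p q (fun z => H (z, w)) ∂ν := by
  unfold mixN
  have h1 : ∀ ξ : Rd d, eLpNorm (fun x => ∫⁻ w, H ((x, ξ), w) ∂ν) p volume ≤
      ∫⁻ w, eLpNorm (fun x => H ((x, ξ), w)) p volume ∂ν := fun ξ =>
    eLpNorm_lintegral_le hp (H := fun y : Rd d × β => H ((y.1, ξ), y.2))
      (hH.comp (by fun_prop))
  refine (eLpNorm_ennreal_mono_ae q (Filter.Eventually.of_forall h1)).trans ?_
  refine eLpNorm_lintegral_le hq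
    (H := fun y : Rd d × β => eLpNorm (fun x => H ((x, y.1), y.2)) p volume) ?_
  exact measurable_eLpNorm_section (H := fun y : Rd d × (Rd d × β) => H ((y.1, y.2.1), y.2.2))
    (hH.comp (by fun_prop)) p

theorem lintegral_mul_le_mixN_mul_mixN (p q p' q' : ℝ≥0∞) [p.HolderConjugate p']
    [q.HolderConjugate q'] {H K : Rd d × Rd d → ℝ≥0∞} (hH : Measurable H) (hK : Measurable K) :
    ∫⁻ z, H z * K z ≤ mixN p q H * mixN p' q' K := by
  rw [Measure.volume_eq_prod, lintegral_prod_symm (fun z => H z * K z) (hH.mul hK).aemeasurable]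
  refine (lintegral_mono fun ξ => lintegral_mul_le_eLpNorm_mul_eLpNorm p p'
    (hH.comp measurable_prodMk_right).aemeasurable
    (hK.comp measurable_prodMk_right).aemeasurable).trans ?_
  exact lintegral_mul_le_eLpNorm_mul_eLpNorm q q' (measurable_eLpNorm_section hH p).aemeasurable
    (measurable_eLpNorm_section hK p').aemeasurable

theorem mixN_one_one {H : Rd d × Rd d → ℝ≥0∞} (hH : Measurable H) :
    mixN 1 1 H = ∫⁻ z, H z := by
  rw [Measure.volume_eq_prod, lintegral_prod_symm _ hH.aemeasurable]
  simp [mixN, eLpNorm_one_eq_lintegral_enorm]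

theorem vWeight_pos (s : ℝ) (z : Rd d × Rd d) : 0 < vWeight s z := by
  unfold vWeight; positivity

theorem continuous_vWeight (s : ℝ) : Continuous (vWeight s : Rd d × Rd d → ℝ) := by
  unfold vWeight
  exact Continuous.rpow_const (by fun_prop) fun z => Or.inl (by positivity)

theorem measurable_wt (s : ℝ) : Measurable (wt s : Rd d × Rd d → ℝ≥0∞) :=
  (continuous_vWeight s).measurable.ennreal_ofReal

theorem wt_rpow (s r : ℝ) (z : Rd d × Rd d) : wt s z ^ r = wt (s * r) z := by
  unfold wt
  rw [ENNReal.ofReal_rpow_of_pos (vWeight_pos s z)]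
  unfold vWeight
  rw [← Real.rpow_mul (by positivity)]
  ring_nf

theorem one_le_wt {s : ℝ} (hs : 0 ≤ s) (z : Rd d × Rd d) : 1 ≤ wt s z := by
  unfold wt vWeight
  rw [ENNReal.one_le_ofReal]
  exact Real.one_le_rpow (by nlinarith [sq_nonneg ‖z.1‖, sq_nonneg ‖z.2‖]) (by linarith)

theorem mixedNorm_vWeight (p q : ℝ≥0∞) (s : ℝ) (F : Rd d × Rd d → ℂ) :
    mixedNorm p q (vWeight s) F = mixN p q (fun z => wt s z * ‖F z‖ₑ) := by
  unfold mixedNorm mixN wt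
  congr 1
  funext ξ
  refine eLpNorm_congr_enorm_ae (Filter.Eventually.of_forall fun x => ?_)
  rw [enorm_mul, enorm_eq_self]
  congr 1
  rw [← ofReal_norm]
  simp [abs_of_pos (vWeight_pos s _)]

theorem base_add_le (z w : Rd d × Rd d) :
    1 + (‖z.1 + w.1‖ ^ 2 + ‖z.2 + w.2‖ ^ 2) ≤
      2 * (1 + (‖z.1‖ ^ 2 + ‖z.2‖ ^ 2)) * (1 + (‖w.1‖ ^ 2 + ‖w.2‖ ^ 2)) := by
  have h : ∀ x y : Rd d, ‖x + y‖ ^ 2 ≤ 2 * ‖x‖ ^ 2 + 2 * ‖y‖ ^ 2 := fun x y => by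
    have := norm_add_le x y
    nlinarith [norm_nonneg (x + y), sq_nonneg (‖x‖ - ‖y‖)]
  have h1 := h z.1 w.1
  have h2 := h z.2 w.2
  have h3 : 0 ≤ (‖z.1‖ ^ 2 + ‖z.2‖ ^ 2) * (‖w.1‖ ^ 2 + ‖w.2‖ ^ 2) := by positivity
  nlinarith

theorem base_smul_le (a b : ℝ) : ∃ C : ℝ, 1 ≤ C ∧ ∀ z : Rd d × Rd d,
    1 + (‖a • z.1‖ ^ 2 + ‖b • z.2‖ ^ 2) ≤ C * (1 + (‖z.1‖ ^ 2 + ‖z.2‖ ^ 2)) := by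
  refine ⟨1 + a ^ 2 + b ^ 2, by nlinarith [sq_nonneg a, sq_nonneg b], fun z => ?_⟩
  simp only [norm_smul, mul_pow, Real.norm_eq_abs, sq_abs]
  have h1 : 0 ≤ a ^ 2 * ‖z.2‖ ^ 2 := by positivity
  have h2 : 0 ≤ b ^ 2 * ‖z.1‖ ^ 2 := by positivity
  nlinarith [sq_nonneg a, sq_nonneg b, sq_nonneg ‖z.1‖, sq_nonneg ‖z.2‖]

/-- The weights `v_s` are moderate, uniformly under invertible diagonal dilations. -/
theorem exists_wt_le {a b : ℝ} (ha : a ≠ 0) (hb : b ≠ 0) (a' b' s : ℝ) :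
    ∃ C : ℝ≥0, ∀ z w : Rd d × Rd d,
      wt s z ≤ C * (wt s (a • z.1 + a' • w.1, b • z.2 + b' • w.2) * wt |s| w) := by
  let B : Rd d × Rd d → ℝ := fun z => 1 + (‖z.1‖ ^ 2 + ‖z.2‖ ^ 2)
  have hB : ∀ z, 0 < B z := fun z => by positivity
  let T : Rd d × Rd d → Rd d × Rd d → Rd d × Rd d := fun z w =>
    (a • z.1 + a' • w.1, b • z.2 + b' • w.2)
  obtain ⟨C₁, hC₁, h₁⟩ := base_smul_le (d := d) a b
  obtain ⟨C₂, hC₂, h₂⟩ := base_smul_le (d := d) a' b'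
  obtain ⟨C₃, hC₃, h₃⟩ := base_smul_le (d := d) a⁻¹ b⁻¹
  obtain ⟨C₄, hC₄, h₄⟩ := base_smul_le (d := d) (-a') (-b')
  have up : ∀ z w, B (T z w) ≤ (2 * C₁ * C₂) * (B z * B w) := fun z w => by
    have := base_add_le (a • z.1, b • z.2) (a' • w.1, b' • w.2)
    calc B (T z w) ≤ 2 * (C₁ * B z) * (C₂ * B w) := by
          refine this.trans ?_
          have e1 := h₁ z
          have e2 := h₂ w
          dsimp only at e1 e2 ⊢
          gcongr
      _ = _ := by ring
  have down : ∀ z w, B z ≤ (2 * C₃ * C₄) * (B (T z w) * B w) := fun z w => by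
    have := base_add_le (T z w) (-a' • w.1, -b' • w.2)
    have e1 := h₃ (a • z.1, b • z.2)
    simp only [smul_smul, inv_mul_cancel₀ ha, inv_mul_cancel₀ hb, one_smul] at e1
    have e2 := h₄ w
    have e3 : (T z w).1 + -a' • w.1 = a • z.1 := by simp [T]
    have e4 : (T z w).2 + -b' • w.2 = b • z.2 := by simp [T]
    dsimp only at this e2
    rw [e3, e4] at this
    calc B z ≤ C₃ * (1 + (‖a • z.1‖ ^ 2 + ‖b • z.2‖ ^ 2)) := e1
      _ ≤ C₃ * (2 * B (T z w) * (C₄ * B w)) := by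
          refine mul_le_mul_of_nonneg_left (this.trans ?_) (by linarith)
          exact mul_le_mul_of_nonneg_left e2 (by have := hB (T z w); positivity)
      _ = _ := by ring
  set K : ℝ := max (2 * C₁ * C₂) (2 * C₃ * C₄) with hK
  have hK0 : 0 < K := lt_of_lt_of_le (by nlinarith) (le_max_left _ _)
  refine ⟨(K ^ (|s| / 2)).toNNReal, fun z w => ?_⟩
  have hT := hB (T z w)
  have hz := hB z
  have hw := hB w
  have key : vWeight s z ≤ K ^ (|s| / 2) * (vWeight s (T z w) * vWeight |s| w) := by
    change B z ^ (s / 2) ≤ K ^ (|s| / 2) * (B (T z w) ^ (s / 2) * B w ^ (|s| / 2))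
    rcases le_total 0 s with hs | hs
    · rw [abs_of_nonneg hs, ← Real.mul_rpow hT.le hw.le, ← Real.mul_rpow hK0.le (by positivity)]
      refine Real.rpow_le_rpow hz.le ((down z w).trans ?_) (by linarith)
      gcongr
      exact le_max_right _ _
    · rw [abs_of_nonpos hs]
      have h := up z w
      have h5 : B (T z w) ≤ K * (B z * B w) := h.trans (by gcongr; exact le_max_left _ _)
      have h6 : B (T z w) ^ (-s / 2) ≤ K ^ (-s / 2) * (B z ^ (-s / 2) * B w ^ (-s / 2)) := by
        rw [← Real.mul_rpow hz.le hw.le, ← Real.mul_rpow hK0.le (by positivity)]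
        exact Real.rpow_le_rpow hT.le h5 (by linarith)
      have e1 : B z ^ (s / 2) = (B z ^ (-s / 2))⁻¹ := by
        rw [← Real.rpow_neg hz.le]; ring_nf
      have e2 : B (T z w) ^ (s / 2) = (B (T z w) ^ (-s / 2))⁻¹ := by
        rw [← Real.rpow_neg hT.le]; ring_nf
      rw [e1, e2]
      have p1 : 0 < B z ^ (-s / 2) := by positivity
      have p2 : 0 < B (T z w) ^ (-s / 2) := by positivity
      rw [inv_le_iff_one_le_mul₀ p1]
      calc 1 = (B (T z w) ^ (-s / 2))⁻¹ * B (T z w) ^ (-s / 2) := (inv_mul_cancel₀ p2.ne').symm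
        _ ≤ (B (T z w) ^ (-s / 2))⁻¹ * (K ^ (-s / 2) * (B z ^ (-s / 2) * B w ^ (-s / 2))) := by
          gcongr
        _ = _ := by ring
  unfold wt
  rw [← ENNReal.ofReal_mul (vWeight_pos _ _).le]
  change _ ≤ ENNReal.ofReal (K ^ (|s| / 2)) * _
  rw [← ENNReal.ofReal_mul (by positivity)]
  exact ENNReal.ofReal_le_ofReal key

/-- Weighted dilation-invariance of the mixed quasi-norms. -/
theorem exists_mixN_wt_comp_smul_le {a b : ℝ} (ha : a ≠ 0) (hb : b ≠ 0) (p q : ℝ≥0∞) (s : ℝ) :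
    ∃ C : ℝ≥0, ∀ H : Rd d × Rd d → ℝ≥0∞,
      mixN p q (fun z => wt s z * H (a • z.1, b • z.2)) ≤ C * mixN p q (fun z => wt s z * H z) := by
  obtain ⟨A, hA⟩ := exists_wt_le (d := d) ha hb 0 0 s
  obtain ⟨B, hB⟩ := exists_mixN_comp_affine (d := d) p q ha hb
  have h0 : wt |s| (0 : Rd d × Rd d) ≠ ⊤ := ENNReal.ofReal_ne_top
  refine ⟨A * (wt |s| (0 : Rd d × Rd d)).toNNReal * B, fun H => ?_⟩
  calc _ ≤ mixN p q (fun z => (A * wt |s| (0 : Rd d × Rd d)) *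
        (wt s (a • z.1 + 0, b • z.2 + 0) * H (a • z.1 + 0, b • z.2 + 0))) := by
        refine mixN_mono fun z => ?_
        have := hA z 0
        simp only [smul_zero, Prod.fst_zero, Prod.snd_zero] at this
        calc _ ≤ _ := mul_le_mul_left this _
          _ = _ := by simp only [add_zero]; ring
    _ = (A * wt |s| (0 : Rd d × Rd d)) * (B * mixN p q (fun z => wt s z * H z)) := by
        rw [mixN_const_mul (ENNReal.mul_ne_top ENNReal.coe_ne_top h0)]
        congr 1
        exact hB (fun z => wt s z * H z) 0
    _ = _ := by push_cast; rw [ENNReal.coe_toNNReal h0]; ring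

/-- Young's inequality for weighted mixed norms, with dilations in both variables. -/
theorem exists_mixN_young {a b : ℝ} (ha : a ≠ 0) (hb : b ≠ 0) (a' b' : ℝ) {p q : ℝ≥0∞}
    (hp : 1 ≤ p) (hq : 1 ≤ q) (s : ℝ) :
    ∃ C : ℝ≥0, ∀ H k : Rd d × Rd d → ℝ≥0∞, Measurable H → Measurable k →
      (∀ w, k w ≠ ⊤) →
      mixN p q (fun z => wt s z * ∫⁻ w, k w * H (a • z.1 + a' • w.1, b • z.2 + b' • w.2)) ≤
        C * (∫⁻ w, k w * wt |s| w) * mixN p q (fun z => wt s z * H z) := by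
  obtain ⟨A, hA⟩ := exists_wt_le (d := d) ha hb a' b' s
  obtain ⟨B, hB⟩ := exists_mixN_comp_affine (d := d) p q ha hb
  refine ⟨A * B, fun H k hH hk hk' => ?_⟩
  have hw := measurable_wt (d := d) s
  have hw' := measurable_wt (d := d) |s|
  let T : (Rd d × Rd d) × (Rd d × Rd d) → Rd d × Rd d := fun y =>
    (a • y.1.1 + a' • y.2.1, b • y.1.2 + b' • y.2.2)
  have hT : Measurable T := by fun_prop
  let L : (Rd d × Rd d) × (Rd d × Rd d) → ℝ≥0∞ := fun y =>
    (k y.2 * wt |s| y.2) * (wt s (T y) * H (T y))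
  have hL : Measurable L := by fun_prop
  calc _ ≤ mixN p q (fun z => A * ∫⁻ w, L (z, w)) := by
        refine mixN_mono fun z => ?_
        have m1 : Measurable fun w => k w * H (T (z, w)) := by fun_prop
        have m2 : Measurable fun w => L (z, w) := by fun_prop
        change wt s z * (∫⁻ w, k w * H (T (z, w))) ≤ _
        rw [← lintegral_const_mul _ m1, ← lintegral_const_mul _ m2]
        refine lintegral_mono fun w => ?_
        calc _ ≤ (A * (wt s (T (z, w)) * wt |s| w)) * (k w * H (T (z, w))) :=
              mul_le_mul_left (hA z w) _
          _ = _ := by simp only [L]; ring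
    _ = A * mixN p q (fun z => ∫⁻ w, L (z, w)) := mixN_const_mul ENNReal.coe_ne_top _ _ _
    _ ≤ A * ∫⁻ w, mixN p q (fun z => L (z, w)) := by
        gcongr
        exact mixN_lintegral_le hp hq hL
    _ ≤ A * ∫⁻ w, (k w * wt |s| w) * (B * mixN p q (fun z => wt s z * H z)) := by
        gcongr with w
        have h1 := hB (fun z => wt s z * H z) (a' • w.1, b' • w.2)
        rw [← h1, ← mixN_const_mul (c := k w * wt |s| w)
          (ENNReal.mul_ne_top (hk' w) ENNReal.ofReal_ne_top)]
    _ = _ := by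
        rw [lintegral_mul_const (f := fun w => k w * wt |s| w) _ (hk.mul hw')]; push_cast; ring

end MixedNorm


/-! ### Tempered distributions under the integral sign -/

section Interchange

variable {E F : Type*} [NormedAddCommGroup E] [NormedSpace ℝ E]
  [NormedAddCommGroup F] [NormedSpace ℝ F]

/-- A functional that is dominated by the norm of `J x` factors through `J`, by Hahn-Banach. -/
theorem exists_dual_comp_eq {X B : Type*} [AddCommGroup X] [Module ℂ X] [NormedAddCommGroup B]
    [NormedSpace ℂ B] (J : X →ₗ[ℂ] B) (f : X →ₗ[ℂ] ℂ) (C : ℝ) (h : ∀ x, ‖f x‖ ≤ C * ‖J x‖) :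
    ∃ Λ : StrongDual ℂ B, ∀ x, Λ (J x) = f x := by
  have hker : LinearMap.ker J ≤ LinearMap.ker f := fun x hx => by
    have h1 := h x
    rw [LinearMap.mem_ker.1 hx, norm_zero, mul_zero] at h1
    exact norm_le_zero_iff.1 h1
  let f₁ : LinearMap.range J →ₗ[ℂ] ℂ :=
    (LinearMap.ker J).liftQ f hker ∘ₗ J.quotKerEquivRange.symm.toLinearMap
  have hf₁ : ∀ x, f₁ ⟨J x, LinearMap.mem_range_self J x⟩ = f x := fun x => by
    have : J.quotKerEquivRange.symm ⟨J x, LinearMap.mem_range_self J x⟩ =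
        (LinearMap.ker J).mkQ x := J.quotKerEquivRange_symm_apply_image x _
    simp [f₁, this]
  let f₂ : StrongDual ℂ (LinearMap.range J) := f₁.mkContinuous C (by
    rintro ⟨_, x, rfl⟩
    rw [hf₁]
    exact h x)
  obtain ⟨Λ, hΛ, -⟩ := exists_extension_norm_eq _ f₂
  exact ⟨Λ, fun x => (hΛ ⟨J x, LinearMap.mem_range_self J x⟩).trans (hf₁ x)⟩

/-- Bounded continuous functions with values in a normed group `W`, the metric of `W` being the one
that comes from its norm. -/
abbrev NormedBCF (X W : Type*) [TopologicalSpace X] [NormedAddCommGroup W] :=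
  BoundedContinuousFunction X W

/-- The bounded function `x ↦ ‖x‖^k D^n ψ(x)`, whose sup-norm is the Schwartz seminorm `(k, n)`. -/
noncomputable def weightedDeriv (k n : ℕ) :
    𝓢(E, ℂ) →ₗ[ℂ] NormedBCF E (E [×n]→L[ℝ] ℂ) where
  toFun ψ := BoundedContinuousFunction.ofNormedAddCommGroup
    (fun x => (‖x‖ ^ k : ℝ) • iteratedFDeriv ℝ n ψ x)
    ((continuous_norm.pow k).smul ((ψ.smooth ⊤).continuous_iteratedFDeriv (by exact_mod_cast le_top)))
    (SchwartzMap.seminorm ℂ k n ψ) (fun x => by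
      rw [norm_smul, norm_pow, norm_norm]; exact SchwartzMap.le_seminorm ℂ k n ψ x)
  map_add' ψ χ := by
    ext1 x
    have : iteratedFDeriv ℝ n (⇑(ψ + χ)) x = iteratedFDeriv ℝ n ψ x + iteratedFDeriv ℝ n χ x :=
      iteratedFDeriv_add_apply (ψ.smooth n).contDiffAt (χ.smooth n).contDiffAt
    simp only [BoundedContinuousFunction.coe_ofNormedAddCommGroup, this, smul_add,
      BoundedContinuousFunction.coe_add, Pi.add_apply]
  map_smul' c ψ := by
    ext1 x
    have : iteratedFDeriv ℝ n (⇑(c • ψ)) x = c • iteratedFDeriv ℝ n ψ x :=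
      iteratedFDeriv_const_smul_apply (ψ.smooth n).contDiffAt
    simp only [BoundedContinuousFunction.coe_ofNormedAddCommGroup, this, RingHom.id_apply,
      BoundedContinuousFunction.coe_smul]
    rw [smul_comm]

theorem weightedDeriv_apply (k n : ℕ) (ψ : 𝓢(E, ℂ)) (x : E) :
    weightedDeriv k n ψ x = (‖x‖ ^ k : ℝ) • iteratedFDeriv ℝ n ψ x := rfl

theorem norm_weightedDeriv_le (k n : ℕ) (ψ : 𝓢(E, ℂ)) :
    ‖weightedDeriv k n ψ‖ ≤ SchwartzMap.seminorm ℂ k n ψ :=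
  BoundedContinuousFunction.norm_ofNormedAddCommGroup_le _ (apply_nonneg _ _) fun x => by
    rw [norm_smul, norm_pow, norm_norm]; exact SchwartzMap.le_seminorm ℂ k n ψ x

theorem seminorm_le_norm_weightedDeriv (k n : ℕ) (ψ : 𝓢(E, ℂ)) :
    SchwartzMap.seminorm ℂ k n ψ ≤ ‖weightedDeriv k n ψ‖ := by
  refine SchwartzMap.seminorm_le_bound ℂ k n ψ (norm_nonneg _) fun x => ?_
  have := (weightedDeriv k n ψ).norm_coe_le_norm x
  rwa [weightedDeriv_apply, norm_smul, norm_pow, norm_norm] at this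

/-- A tempered distribution factors through finitely many of the maps `weightedDeriv k n`. -/
theorem exists_dual_weightedDeriv (f : 𝓢'(E, ℂ)) :
    ∃ (s : Finset (ℕ × ℕ))
      (Λ : StrongDual ℂ ((i : s) → NormedBCF E (E [×i.1.2]→L[ℝ] ℂ))),
      ∀ ψ : 𝓢(E, ℂ), Λ (fun i => weightedDeriv i.1.1 i.1.2 ψ) = f ψ := by
  let q : Seminorm ℂ 𝓢(E, ℂ) := (normSeminorm ℂ ℂ).comp (asCLM f : 𝓢(E, ℂ) →ₗ[ℂ] ℂ)
  have hq : Continuous q := continuous_norm.comp (asCLM f).continuous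
  obtain ⟨s, C, -, h⟩ := Seminorm.bound_of_continuous (schwartz_withSeminorms ℂ E ℂ) q hq
  refine ⟨s, ?_⟩
  let J : 𝓢(E, ℂ) →ₗ[ℂ] ((i : s) → NormedBCF E (E [×i.1.2]→L[ℝ] ℂ)) :=
    LinearMap.pi fun i => weightedDeriv i.1.1 i.1.2
  refine exists_dual_comp_eq J (asCLM f : 𝓢(E, ℂ) →ₗ[ℂ] ℂ) C fun ψ => (h ψ).trans ?_
  change (C : ℝ) * _ ≤ C * _
  refine mul_le_mul_of_nonneg_left ?_ C.2
  refine Seminorm.finset_sup_apply_le (norm_nonneg _) fun i hi => ?_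
  exact (seminorm_le_norm_weightedDeriv i.1 i.2 ψ).trans (norm_le_pi_norm (J ψ) ⟨i, hi⟩)

theorem seminorm_lineDerivOp_le (k n : ℕ) (Φ : 𝓢(E, ℂ)) (u : E) :
    SchwartzMap.seminorm ℂ k n (∂_{u} Φ) ≤ ‖u‖ * SchwartzMap.seminorm ℂ k (n + 1) Φ := by
  refine SchwartzMap.seminorm_le_bound ℂ k n _ (by positivity) fun x => ?_
  have hd : ContDiff ℝ n (fderiv ℝ Φ) := (Φ.smooth (n + 1)).fderiv_right (m := n) (by simp)
  have h := norm_iteratedFDeriv_clm_apply_const (c := u) hd.contDiffAt (x := x) le_rfl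
  rw [norm_iteratedFDeriv_fderiv] at h
  have e : ((∂_{u} Φ : 𝓢(E, ℂ)) : E → ℂ) = fun y => fderiv ℝ Φ y u := rfl
  rw [e]
  calc _ ≤ ‖x‖ ^ k * (‖u‖ * ‖iteratedFDeriv ℝ (n + 1) Φ x‖) := by gcongr
    _ = ‖u‖ * (‖x‖ ^ k * ‖iteratedFDeriv ℝ (n + 1) Φ x‖) := by ring
    _ ≤ _ := by gcongr; exact SchwartzMap.le_seminorm ℂ _ _ _ _

theorem continuous_slice [FiniteDimensional ℝ E] (Φ : 𝓢(F × E, ℂ)) :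
    Continuous fun w : F => slice w Φ := by
  rw [continuous_iff_continuousAt]
  intro w
  rw [ContinuousAt, (schwartz_withSeminorms ℂ E ℂ).tendsto_nhds]
  rintro ⟨k, n⟩ ε hε
  obtain ⟨C, hC, h⟩ := exists_seminorm_sliceRem_le k n Φ
  have hb : ∀ y : F, SchwartzMap.seminorm ℂ k n (slice y Φ - slice w Φ) ≤
      ‖y - w‖ * SchwartzMap.seminorm ℂ k (n + 1) Φ + C * ‖y - w‖ ^ 2 := fun y => by
    have e : slice y Φ - slice w Φ =
        slice w (∂_{(y - w, (0 : E))} Φ) + sliceRem Φ w (y - w) := by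
      unfold sliceRem; rw [add_sub_cancel, add_sub_cancel]
    rw [e]
    refine (map_add_le_add _ _ _).trans (add_le_add ?_ (h w (y - w)))
    have h1 := seminorm_slice_le 0 k n w (∂_{(y - w, (0 : E))} Φ)
    rw [pow_zero, one_mul, zero_add] at h1
    have h2 := seminorm_lineDerivOp_le k n Φ ((y - w, (0 : E)) : F × E)
    have h3 : ‖((y - w, 0) : F × E)‖ = ‖y - w‖ := by simp [Prod.norm_mk]
    rw [h3] at h2
    exact h1.trans h2
  have hlim : Filter.Tendsto (fun y : F => ‖y - w‖ * SchwartzMap.seminorm ℂ k (n + 1) Φ +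
      C * ‖y - w‖ ^ 2) (nhds w) (nhds 0) := by
    have : Continuous (fun y : F => ‖y - w‖ * SchwartzMap.seminorm ℂ k (n + 1) Φ +
      C * ‖y - w‖ ^ 2) := by fun_prop
    simpa using this.tendsto w
  filter_upwards [hlim.eventually (gt_mem_nhds hε)] with y hy
  exact (hb y).trans_lt hy

theorem continuous_weightedDeriv (k n : ℕ) :
    Continuous (weightedDeriv k n : 𝓢(E, ℂ) → NormedBCF E (E [×n]→L[ℝ] ℂ)) := by
  refine (schwartz_withSeminorms ℂ E ℂ).continuous_normedSpace_rng _ (weightedDeriv k n)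
    ⟨{(k, n)}, 1, fun ψ => ?_⟩
  rw [Finset.sup_singleton, one_smul]
  exact norm_weightedDeriv_le k n ψ

theorem one_add_pow_le {a : ℝ} (ha : 0 ≤ a) (m : ℕ) : (1 + a) ^ m ≤ 2 ^ m * (1 + a ^ m) := by
  rcases le_total a 1 with h | h
  · calc (1 + a) ^ m ≤ 2 ^ m := by gcongr; linarith
      _ ≤ _ := le_mul_of_one_le_right (by positivity) (by linarith [pow_nonneg ha m])
  · calc (1 + a) ^ m ≤ (2 * a) ^ m := by gcongr; linarith
      _ = 2 ^ m * a ^ m := mul_pow _ _ _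
      _ ≤ _ := by gcongr; linarith

/-- A function of at most polynomial growth. -/
def PolyBounded (V : F → ℂ) : Prop := ∃ (C : ℝ) (N : ℕ), ∀ w, ‖V w‖ ≤ C * (1 + ‖w‖) ^ N

omit [NormedSpace ℝ F] in
theorem PolyBounded.one : PolyBounded (fun _ : F => (1 : ℂ)) := ⟨1, 0, fun w => by simp⟩

omit [NormedSpace ℝ F] in
/-- A function of polynomial growth times a rapidly decaying one is integrable. -/
theorem integrable_smul_of_decay [MeasurableSpace F] [BorelSpace F]
    {μ : Measure F} [μ.HasTemperateGrowth] {B : Type*} [NormedAddCommGroup B] [NormedSpace ℂ B]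
    {V : F → ℂ} (hV : AEStronglyMeasurable V μ) (hVb : PolyBounded V) {U : F → B}
    (hU : AEStronglyMeasurable U μ) (hUb : ∀ m : ℕ, ∃ C : ℝ, ∀ w, (1 + ‖w‖) ^ m * ‖U w‖ ≤ C) :
    Integrable (fun w => V w • U w) μ := by
  obtain ⟨C, N, hC⟩ := hVb
  obtain ⟨D, hD⟩ := hUb (N + μ.integrablePower)
  refine ((μ.integrable_pow_neg_integrablePower).const_mul (C * D)).mono' (hV.smul hU)
    (Filter.Eventually.of_forall fun w => ?_)
  have hp : 0 < (1 + ‖w‖) ^ μ.integrablePower := by positivity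
  have hC0 : 0 ≤ C := by
    have := (norm_nonneg _).trans (hC w)
    exact nonneg_of_mul_nonneg_left this (by positivity)
  rw [norm_smul, Real.rpow_neg (by positivity), Real.rpow_natCast, ← div_eq_mul_inv,
    le_div_iff₀ hp]
  calc ‖V w‖ * ‖U w‖ * (1 + ‖w‖) ^ μ.integrablePower
      ≤ (C * (1 + ‖w‖) ^ N) * ‖U w‖ * (1 + ‖w‖) ^ μ.integrablePower := by gcongr; exact hC w
    _ = C * ((1 + ‖w‖) ^ (N + μ.integrablePower) * ‖U w‖) := by ring
    _ ≤ C * D := by gcongr; exact hD w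

theorem decay_one_add (ψ : 𝓢(F, ℂ)) (m : ℕ) : ∃ C : ℝ, ∀ w, (1 + ‖w‖) ^ m * ‖ψ w‖ ≤ C := by
  refine ⟨2 ^ m * ((Finset.Iic (m, 0)).sup fun m => SchwartzMap.seminorm ℂ m.1 m.2) ψ,
    fun w => ?_⟩
  have := SchwartzMap.one_add_le_sup_seminorm_apply (𝕜 := ℂ) (m := (m, 0)) le_rfl le_rfl ψ w
  rwa [norm_iteratedFDeriv_zero] at this

theorem PolyBounded.integrable_mul [MeasurableSpace F] [BorelSpace F] [SecondCountableTopology F]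
    {μ : Measure F}
    [μ.HasTemperateGrowth] {V : F → ℂ} (hV : AEStronglyMeasurable V μ) (hVb : PolyBounded V)
    (ψ : 𝓢(F, ℂ)) : Integrable (fun w => V w * ψ w) μ :=
  integrable_smul_of_decay hV hVb ψ.continuous.aestronglyMeasurable (decay_one_add ψ)

/-- A measurable function of polynomial growth as a tempered distribution. -/
theorem exists_distribution_of_polyBounded [MeasurableSpace F] [BorelSpace F]
    [SecondCountableTopology F] {μ : Measure F}
    [μ.HasTemperateGrowth] {V : F → ℂ} (hV : AEStronglyMeasurable V μ) (hVb : PolyBounded V) :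
    ∃ T : 𝓢'(F, ℂ), ∀ ψ : 𝓢(F, ℂ), T ψ = ∫ w, V w * ψ w ∂μ := by
  obtain ⟨C, N, hC⟩ := id hVb
  have hC0 : 0 ≤ C := by
    have := (norm_nonneg _).trans (hC 0)
    exact nonneg_of_mul_nonneg_left this (by positivity)
  set M := N + μ.integrablePower with hM
  set I := ∫ w, (1 + ‖w‖) ^ (-(μ.integrablePower : ℝ)) ∂μ with hI
  have hI0 : 0 ≤ I := integral_nonneg fun w => by positivity
  let T : 𝓢(F, ℂ) →L[ℂ] ℂ := mkCLMtoNormedSpace (fun ψ => ∫ w, V w * ψ w ∂μ)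
    (fun ψ χ => by
      simp only [add_apply, mul_add]
      exact integral_add (PolyBounded.integrable_mul hV hVb ψ)
        (PolyBounded.integrable_mul hV hVb χ))
    (fun a ψ => by
      simp only [smul_apply, smul_eq_mul, mul_left_comm _ a, RingHom.id_apply]
      exact integral_const_mul _ _)
    ⟨Finset.Iic (M, 0), I * (C * 2 ^ M), by positivity, fun ψ => by
      set S := ((Finset.Iic (M, 0)).sup (schwartzSeminormFamily ℂ F ℂ)) ψ with hS
      calc ‖∫ w, V w * ψ w ∂μ‖
          ≤ ∫ w, (1 + ‖w‖) ^ (-(μ.integrablePower : ℝ)) * (C * 2 ^ M * S) ∂μ := by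
            refine norm_integral_le_of_norm_le
              ((μ.integrable_pow_neg_integrablePower).mul_const _)
              (Filter.Eventually.of_forall fun w => ?_)
            have h := SchwartzMap.one_add_le_sup_seminorm_apply (𝕜 := ℂ) (m := (M, 0))
              le_rfl le_rfl ψ w
            rw [norm_iteratedFDeriv_zero] at h
            have hp : 0 < (1 + ‖w‖) ^ μ.integrablePower := by positivity
            rw [norm_mul, Real.rpow_neg (by positivity), Real.rpow_natCast, mul_comm _⁻¹,
              ← div_eq_mul_inv, le_div_iff₀ hp]
            calc ‖V w‖ * ‖ψ w‖ * (1 + ‖w‖) ^ μ.integrablePower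
                ≤ (C * (1 + ‖w‖) ^ N) * ‖ψ w‖ * (1 + ‖w‖) ^ μ.integrablePower := by
                  gcongr; exact hC w
              _ = C * ((1 + ‖w‖) ^ M * ‖ψ w‖) := by rw [hM]; ring
              _ ≤ C * (2 ^ M * S) := mul_le_mul_of_nonneg_left h hC0
              _ = _ := by ring
        _ = I * (C * 2 ^ M * S) := integral_mul_const _ _
        _ = _ := by ring⟩
  exact ⟨ContinuousLinearMap.toPointwiseConvergenceCLM _ (RingHom.id ℂ) _ _ T, fun ψ => rfl⟩

variable [FiniteDimensional ℝ E] [FiniteDimensional ℝ F]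

theorem lineDerivOp_partialPairing (T : 𝓢'(F, ℂ)) (Φ : 𝓢(E × F, ℂ)) (v : E) :
    ∂_{v} (partialPairing T Φ) = partialPairing T (∂_{(v, (0 : F))} Φ) := by
  ext x
  let L : 𝓢(F, ℂ) →L[ℂ] 𝓢(EuclideanSpace ℝ (Fin 0), ℂ) := (asCLM T).smulRight unitSchwartz
  obtain ⟨D, hD, h⟩ := hasFDerivAt_partialFun L Φ (x, 0)
  have h1 : HasFDerivAt (fun y : E => (y, (0 : EuclideanSpace ℝ (Fin 0))))
      (ContinuousLinearMap.inl ℝ E _) x := hasFDerivAt_prodMk_left x 0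
  have h2 := hD.comp x h1
  have e : ((partialPairing T Φ : 𝓢(E, ℂ)) : E → ℂ) =
      partialFun L Φ ∘ fun y : E => (y, (0 : EuclideanSpace ℝ (Fin 0))) := by
    ext y
    simp [partialFun, L, unitSchwartz]
    rfl
  rw [lineDerivOp_apply_eq_fderiv, e, h2.fderiv]
  have h3 := h v 0
  have h4 : partialFun ((lineDerivOpCLM ℂ 𝓢(EuclideanSpace ℝ (Fin 0), ℂ)
      (0 : EuclideanSpace ℝ (Fin 0))) ∘L L) Φ (x, (0 : EuclideanSpace ℝ (Fin 0))) = 0 := by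
    change (∂_{(0 : EuclideanSpace ℝ (Fin 0))} (L (slice x Φ)) :
      𝓢(EuclideanSpace ℝ (Fin 0), ℂ)) 0 = 0
    rw [lineDerivOp_left_zero, zero_apply]
  rw [h4, add_zero] at h3
  refine h3.trans ?_
  simp [partialFun, L, unitSchwartz]
  rfl

theorem iteratedLineDerivOp_partialPairing (T : 𝓢'(F, ℂ)) (n : ℕ) (m : Fin n → E) :
    ∀ Φ : 𝓢(E × F, ℂ), ∂^{m} (partialPairing T Φ) =
      partialPairing T (∂^{fun i => (m i, (0 : F))} Φ) := by
  induction n with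
  | zero => intro Φ; simp
  | succ n ih =>
    intro Φ
    rw [iteratedLineDerivOp_succ_left, iteratedLineDerivOp_succ_left, ih,
      lineDerivOp_partialPairing]
    rfl

omit [FiniteDimensional ℝ E] [FiniteDimensional ℝ F] in
theorem iteratedLineDerivOp_slice (w : F) (n : ℕ) (m : Fin n → E) :
    ∀ Φ : 𝓢(F × E, ℂ), ∂^{m} (slice w Φ) = slice w (∂^{fun i => ((0 : F), m i)} Φ) := by
  induction n with
  | zero => intro Φ; simp
  | succ n ih =>
    intro Φ
    rw [iteratedLineDerivOp_succ_left, iteratedLineDerivOp_succ_left, ih, lineDeriv_slice]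
    rfl

/-- Exchange of the two factors of a product. -/
noncomputable def swapS : 𝓢(F × E, ℂ) →L[ℂ] 𝓢(E × F, ℂ) :=
  compCLMOfContinuousLinearEquiv ℂ (ContinuousLinearEquiv.prodComm ℝ E F)

omit [FiniteDimensional ℝ E] [FiniteDimensional ℝ F] in
theorem iteratedLineDerivOp_swapS (n : ℕ) (m : Fin n → E) :
    ∀ Φ : 𝓢(F × E, ℂ), ∂^{fun i => (m i, (0 : F))} (swapS Φ) =
      swapS (∂^{fun i => ((0 : F), m i)} Φ) := by
  induction n with
  | zero => intro Φ; simp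
  | succ n ih =>
    intro Φ
    rw [iteratedLineDerivOp_succ_left, iteratedLineDerivOp_succ_left]
    have := ih (fun i => m i.succ) Φ
    have e : Fin.tail (fun i => (m i, (0 : F))) = fun i : Fin n => (m i.succ, (0 : F)) := rfl
    have e' : Fin.tail (fun i => ((0 : F), m i)) = fun i : Fin n => ((0 : F), m i.succ) := rfl
    rw [e, e', this]
    exact lineDerivOp_compCLMOfContinuousLinearEquiv ℂ _ (ContinuousLinearEquiv.prodComm ℝ E F) _

/-- A tempered distribution may be interchanged with the integration of a Schwartz function of two
variables against a measurable function of polynomial growth. The distribution extends to a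
bounded functional on a Banach space, where the integral is a Bochner integral. -/
theorem distribution_integral_comm [MeasurableSpace F] [BorelSpace F]
    {μ : Measure F} [μ.HasTemperateGrowth] (f : 𝓢'(E, ℂ))
    {V : F → ℂ} (hV : AEStronglyMeasurable V μ) (hVb : PolyBounded V) (Φ : 𝓢(F × E, ℂ))
    (Ψ : 𝓢(E, ℂ)) (hΨ : ∀ x, Ψ x = ∫ w, V w * Φ (w, x) ∂μ) :
    f Ψ = ∫ w, V w * f (slice w Φ) ∂μ := by
  obtain ⟨T, hT⟩ := exists_distribution_of_polyBounded hV hVb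
  obtain ⟨s, Λ, hΛ⟩ := exists_dual_weightedDeriv f
  have hΨT : Ψ = partialPairing T (swapS Φ) := by
    ext x
    rw [partialPairing_apply, hT, hΨ]
    rfl
  have hder : ∀ (n : ℕ) (x : E) (m : Fin n → E), iteratedFDeriv ℝ n Ψ x m =
      ∫ w, V w * iteratedFDeriv ℝ n (slice w Φ) x m ∂μ := fun n x m => by
    simp only [← iteratedLineDerivOp_eq_iteratedFDeriv, iteratedLineDerivOp_slice]
    rw [hΨT, iteratedLineDerivOp_partialPairing, partialPairing_apply, hT,
      iteratedLineDerivOp_swapS]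
    rfl
  have hdecay : ∀ k n m : ℕ, ∃ C : ℝ, ∀ w : F,
      (1 + ‖w‖) ^ m * ‖weightedDeriv k n (slice w Φ)‖ ≤ C := fun k n m => by
    refine ⟨2 ^ m * (SchwartzMap.seminorm ℂ (0 + k) n Φ + SchwartzMap.seminorm ℂ (m + k) n Φ),
      fun w => ?_⟩
    have h0 := seminorm_slice_le 0 k n w Φ
    have h1 := seminorm_slice_le m k n w Φ
    have h2 := norm_weightedDeriv_le k n (slice w Φ)
    rw [pow_zero, one_mul] at h0
    calc _ ≤ (2 ^ m * (1 + ‖w‖ ^ m)) * SchwartzMap.seminorm ℂ k n (slice w Φ) := by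
          gcongr; exact one_add_pow_le (norm_nonneg w) m
      _ = 2 ^ m * (SchwartzMap.seminorm ℂ k n (slice w Φ) +
          ‖w‖ ^ m * SchwartzMap.seminorm ℂ k n (slice w Φ)) := by ring
      _ ≤ _ := by gcongr
  have hint : ∀ k n : ℕ, Integrable (fun w => V w • weightedDeriv k n (slice w Φ)) μ :=
    fun k n => integrable_smul_of_decay hV hVb
      ((continuous_weightedDeriv k n).comp (continuous_slice Φ)).aestronglyMeasurable
      (hdecay k n)
  have hcomp : ∀ k n : ℕ, weightedDeriv k n Ψ =
      ∫ w, V w • weightedDeriv k n (slice w Φ) ∂μ := fun k n => by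
    ext x m
    have h1 := (BoundedContinuousFunction.evalCLM ℝ x).integral_comp_comm (hint k n)
    rw [BoundedContinuousFunction.evalCLM_apply] at h1
    rw [← h1]
    have hint' := (BoundedContinuousFunction.evalCLM ℝ x).integrable_comp (hint k n)
    have h2 := (ContinuousMultilinearMap.apply ℝ (fun _ : Fin n => E) ℂ m).integral_comp_comm hint'
    rw [ContinuousMultilinearMap.apply_apply] at h2
    rw [← h2, weightedDeriv_apply, smul_apply, hder, ← integral_smul]
    refine integral_congr_ae (Filter.Eventually.of_forall fun w => ?_)
    simp [weightedDeriv_apply]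
    ring
  have hint2 : Integrable (fun w => V w • fun i : s => weightedDeriv i.1.1 i.1.2 (slice w Φ)) μ :=
    Integrable.of_eval fun i => hint i.1.1 i.1.2
  have h3 := Λ.integral_comp_comm hint2
  simp only [map_smul, hΛ] at h3
  rw [← hΛ Ψ]
  refine Eq.trans ?_ h3.symm
  congr 1
  funext i
  rw [eval_integral (fun i => hint i.1.1 i.1.2)]
  exact hcomp i.1.1 i.1.2

end Interchange


/-! ### Multiplication by chirps -/

section Oscillation

/-- The oscillating exponential `e^{ir}`. -/
noncomputable def osc (r : ℝ) : ℂ := Complex.exp ((r : ℂ) * Complex.I)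

theorem osc_add (r s : ℝ) : osc (r + s) = osc r * osc s := by
  unfold osc; rw [← Complex.exp_add]; push_cast; ring_nf

@[simp] theorem norm_osc (r : ℝ) : ‖osc r‖ = 1 := Complex.norm_exp_ofReal_mul_I r

theorem conj_osc (r : ℝ) : (starRingEnd ℂ) (osc r) = osc (-r) := by
  unfold osc; rw [← Complex.exp_conj]; simp

theorem continuous_osc : Continuous osc := by unfold osc; fun_prop

theorem iteratedDeriv_osc (n : ℕ) : iteratedDeriv n osc = fun r => Complex.I ^ n * osc r := by
  induction n with
  | zero => simp
  | succ n ih =>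
    rw [iteratedDeriv_succ, ih]
    funext r
    have h1 : HasDerivAt (fun r : ℝ => (r : ℂ) * Complex.I) (1 * Complex.I) r :=
      (Complex.ofRealCLM.hasDerivAt (x := r)).mul_const Complex.I
    refine (h1.cexp.const_mul (Complex.I ^ n)).deriv.trans ?_
    unfold osc
    ring

theorem contDiff_osc : ContDiff ℝ ∞ osc :=
  Complex.contDiff_exp.comp (Complex.ofRealCLM.contDiff.mul contDiff_const)

theorem norm_iteratedFDeriv_osc (n : ℕ) (r : ℝ) : ‖iteratedFDeriv ℝ n osc r‖ = 1 := by
  rw [norm_iteratedFDeriv_eq_norm_iteratedDeriv, iteratedDeriv_osc]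
  simp

theorem hasTemperateGrowth_osc : osc.HasTemperateGrowth :=
  ⟨contDiff_osc, fun n => ⟨0, 1, fun r => by simp [norm_iteratedFDeriv_osc]⟩⟩

variable {V H : Type*} [NormedAddCommGroup V] [NormedSpace ℝ V] [NormedAddCommGroup H]
  [InnerProductSpace ℝ H]

theorem hasTemperateGrowth_chirp (c : ℝ) (A B : V →L[ℝ] H) :
    (fun z => osc (c * inner ℝ (A z) (B z))).HasTemperateGrowth := by
  have h : (fun z => inner ℝ (A z) (B z)).HasTemperateGrowth :=
    (innerSL ℝ (E := H)).bilinear_hasTemperateGrowth A.hasTemperateGrowth B.hasTemperateGrowth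
  exact hasTemperateGrowth_osc.comp ((Function.HasTemperateGrowth.const c).mul h)

/-- Multiplication by the chirp `z ↦ e^{i c A z · B z}`. -/
noncomputable def chirpMul (c : ℝ) (A B : V →L[ℝ] H) : 𝓢(V, ℂ) →L[ℂ] 𝓢(V, ℂ) :=
  smulLeftCLM ℂ fun z => osc (c * inner ℝ (A z) (B z))

theorem chirpMul_apply (c : ℝ) (A B : V →L[ℝ] H) (Φ : 𝓢(V, ℂ)) (z : V) :
    chirpMul c A B Φ z = osc (c * inner ℝ (A z) (B z)) * Φ z := by
  unfold chirpMul
  rw [smulLeftCLM_apply_apply (hasTemperateGrowth_chirp c A B), smul_eq_mul]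

end Oscillation

/-! ### Tensor products of Schwartz functions -/

section Tensor

variable {E F : Type*} [NormedAddCommGroup E] [NormedSpace ℝ E] [FiniteDimensional ℝ E]
  [NormedAddCommGroup F] [NormedSpace ℝ F] [FiniteDimensional ℝ F]

/-- The tensor product `(x, y) ↦ φ(x) ψ(y)` of two Schwartz functions. It applies the map `c ↦ c ψ` in
the second variable to `φ`, regarded as a function on `E × ℝ⁰`. -/
noncomputable def tensorS (φ : 𝓢(E, ℂ)) (ψ : 𝓢(F, ℂ)) : 𝓢(E × F, ℂ) :=
  partialMap ((asCLM (TemperedDistribution.delta (0 : EuclideanSpace ℝ (Fin 0)))).smulRight ψ)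
    (compCLMOfContinuousLinearEquiv ℂ
      (ContinuousLinearEquiv.prodUnique ℝ E (EuclideanSpace ℝ (Fin 0))) φ)

end Tensor

/-! ### The short-time Fourier transform of a tempered distribution -/

section TimeFrequency

variable {d : ℕ}

instance : (volume : Measure (Rd d × Rd d)).IsAddHaarMeasure :=
  inferInstanceAs (Measure.IsAddHaarMeasure
    ((volume : Measure (Rd d)).prod (volume : Measure (Rd d))))

theorem tfShift_eq (x ξ : Rd d) (φ : 𝓢(Rd d, ℂ)) (y : Rd d) :
    tfShift x ξ φ y = osc (2 * Real.pi * inner ℝ y ξ) * φ (y - x) := tfShift_apply x ξ φ y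

theorem conjS_tfShift (x ξ : Rd d) (φ : 𝓢(Rd d, ℂ)) :
    conjS (tfShift x ξ φ) = tfShift x (-ξ) (conjS φ) := by
  ext y
  rw [conjS_apply, tfShift_eq, tfShift_eq, map_mul, conj_osc, conjS_apply, inner_neg_right]
  ring_nf

@[simp] theorem conjS_conjS (φ : 𝓢(Rd d, ℂ)) : conjS (conjS φ) = φ := by ext y; simp

/-- The shear `((x, ξ), y) ↦ ((x, ξ), y - x)`. -/
noncomputable def shear : ((Rd d × Rd d) × Rd d) ≃L[ℝ] ((Rd d × Rd d) × Rd d) :=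
  LinearEquiv.toContinuousLinearEquiv
    { toFun := fun w => (w.1, w.2 - w.1.1)
      invFun := fun w => (w.1, w.2 + w.1.1)
      map_add' := fun z w => by ext <;> simp; ring
      map_smul' := fun c z => by ext <;> simp; ring
      left_inv := fun z => by simp
      right_inv := fun z => by simp }

/-- The Schwartz function `(z, y) ↦ χ(z) conj (π(z) φ)(y)`. -/
noncomputable def tfKernel (χ : 𝓢(Rd d × Rd d, ℂ)) (φ : 𝓢(Rd d, ℂ)) :
    𝓢((Rd d × Rd d) × Rd d, ℂ) :=
  chirpMul (-(2 * Real.pi)) (ContinuousLinearMap.snd ℝ (Rd d × Rd d) (Rd d))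
    (ContinuousLinearMap.snd ℝ (Rd d) (Rd d) ∘L ContinuousLinearMap.fst ℝ (Rd d × Rd d) (Rd d))
    (compCLMOfContinuousLinearEquiv ℂ shear (tensorS χ (conjS φ)))

theorem tfKernel_apply (χ : 𝓢(Rd d × Rd d, ℂ)) (φ : 𝓢(Rd d, ℂ)) (z : Rd d × Rd d) (y : Rd d) :
    tfKernel χ φ (z, y) = χ z * conjS (tfShift z.1 z.2 φ) y := by
  have : compCLMOfContinuousLinearEquiv ℂ shear (tensorS χ (conjS φ)) (z, y) =
    χ z * conjS φ (y - z.1) := rfl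
  rw [tfKernel, chirpMul_apply, this, conjS_tfShift, tfShift_eq]
  simp only [ContinuousLinearMap.coe_snd', ContinuousLinearMap.comp_apply,
    ContinuousLinearMap.coe_fst', inner_neg_right]
  ring_nf

theorem slice_tfKernel (χ : 𝓢(Rd d × Rd d, ℂ)) (φ : 𝓢(Rd d, ℂ)) (z : Rd d × Rd d) :
    slice z (tfKernel χ φ) = χ z • conjS (tfShift z.1 z.2 φ) := by
  ext y
  rw [slice_apply, tfKernel_apply, smul_apply, smul_eq_mul]

theorem apply_slice_tfKernel (χ : 𝓢(Rd d × Rd d, ℂ)) (φ : 𝓢(Rd d, ℂ)) (f : 𝓢'(Rd d, ℂ))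
    (z : Rd d × Rd d) : f (slice z (tfKernel χ φ)) = χ z * stft φ f z := by
  rw [slice_tfKernel, map_smul, smul_eq_mul]
  rfl

theorem continuous_stft (φ : 𝓢(Rd d, ℂ)) (f : 𝓢'(Rd d, ℂ)) : Continuous (stft φ f) := by
  rw [continuous_iff_continuousAt]
  intro z
  let b : ContDiffBump z := ⟨1, 2, one_pos, one_lt_two⟩
  let χ : 𝓢(Rd d × Rd d, ℂ) := HasCompactSupport.toSchwartzMap (f := fun w => (b w : ℂ))
    (b.hasCompactSupport.comp_left (g := fun r : ℝ => (r : ℂ)) (by simp))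
    (Complex.ofRealCLM.contDiff.comp b.contDiff)
  have h : ContinuousAt (fun w => partialPairing f (tfKernel χ φ) w) z :=
    (partialPairing f (tfKernel χ φ)).continuous.continuousAt
  refine h.congr ?_
  filter_upwards [b.eventuallyEq_one] with w hw
  have hχ : χ w = 1 := by
    change ((b w : ℝ) : ℂ) = 1
    rw [hw]; simp
  rw [partialPairing_apply, apply_slice_tfKernel, hχ, one_mul]

/-- Schwartz seminorms grow at most polynomially along time-frequency shifts. -/
theorem exists_seminorm_tfShift_le (k n : ℕ) (φ : 𝓢(Rd d, ℂ)) :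
    ∃ C : ℝ, ∀ z : Rd d × Rd d,
      SchwartzMap.seminorm ℂ k n (tfShift z.1 z.2 φ) ≤ C * (1 + ‖z‖) ^ (k + n) := by
  let S : ℕ → ℕ → ℝ := fun k n => SchwartzMap.seminorm ℂ k n φ
  have hS : ∀ k n, 0 ≤ S k n := fun k n => apply_nonneg _ _
  refine ⟨∑ i ∈ Finset.range (n + 1), (n.choose i : ℝ) * (2 * Real.pi) ^ i *
    (2 ^ k * (S 0 (n - i) + S k (n - i))), fun z => ?_⟩
  have hpi := Real.pi_pos
  refine SchwartzMap.seminorm_le_bound ℂ k n _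
    (mul_nonneg (Finset.sum_nonneg fun i _ => by have := hS 0 (n - i); have := hS k (n - i); positivity)
      (by positivity)) fun y => ?_
  let ℓ : Rd d →L[ℝ] ℝ := (2 * Real.pi) • innerSL ℝ z.2
  have hℓ : ‖ℓ‖ ≤ 2 * Real.pi * ‖z.2‖ := by
    rw [norm_smul, innerSL_apply_norm, Real.norm_of_nonneg (by positivity)]
  have e : (tfShift z.1 z.2 φ : Rd d → ℂ) = fun y => (osc ∘ ℓ) y * φ (y - z.1) := by
    funext y
    rw [tfShift_eq]
    simp only [Function.comp_apply, ℓ, smul_apply, innerSL_apply_apply, smul_eq_mul]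
    rw [real_inner_comm]
  have hosc : ∀ i, ‖iteratedFDeriv ℝ i (osc ∘ ℓ) y‖ ≤ (2 * Real.pi) ^ i * (1 + ‖z‖) ^ i := by
    intro i
    rw [ℓ.iteratedFDeriv_comp_right (contDiff_osc.of_le (mod_cast le_top)) y (i := i) le_rfl]
    refine (ContinuousMultilinearMap.norm_compContinuousLinearMap_le _ _).trans ?_
    rw [norm_iteratedFDeriv_osc, one_mul, Finset.prod_const, Finset.card_univ, Fintype.card_fin,
      ← mul_pow]
    gcongr
    refine hℓ.trans ?_
    gcongr
    exact (norm_snd_le z).trans (by linarith)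
  have hφ : ∀ j, ‖y‖ ^ k * ‖iteratedFDeriv ℝ j (fun y => φ (y - z.1)) y‖ ≤
      2 ^ k * (S 0 j + S k j) * (1 + ‖z‖) ^ k := by
    intro j
    have e2 : iteratedFDeriv ℝ j (fun y => φ (y - z.1)) y = iteratedFDeriv ℝ j φ (y - z.1) :=
      iteratedFDeriv_comp_sub j z.1 y
    rw [e2]
    have h1 : ‖y‖ ≤ (1 + ‖y - z.1‖) * (1 + ‖z‖) := by
      have h2 := norm_add_le (y - z.1) z.1
      rw [sub_add_cancel] at h2
      have h3 := norm_fst_le z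
      nlinarith [norm_nonneg (y - z.1), norm_nonneg z, mul_nonneg (norm_nonneg (y - z.1)) (norm_nonneg z)]
    calc _ ≤ ((1 + ‖y - z.1‖) * (1 + ‖z‖)) ^ k * ‖iteratedFDeriv ℝ j φ (y - z.1)‖ := by gcongr
      _ = (1 + ‖y - z.1‖) ^ k * ‖iteratedFDeriv ℝ j φ (y - z.1)‖ * (1 + ‖z‖) ^ k := by
        rw [mul_pow]; ring
      _ ≤ (2 ^ k * (1 + ‖y - z.1‖ ^ k)) * ‖iteratedFDeriv ℝ j φ (y - z.1)‖ * (1 + ‖z‖) ^ k := by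
        gcongr; exact one_add_pow_le (norm_nonneg _) k
      _ = 2 ^ k * (‖iteratedFDeriv ℝ j φ (y - z.1)‖ +
          ‖y - z.1‖ ^ k * ‖iteratedFDeriv ℝ j φ (y - z.1)‖) * (1 + ‖z‖) ^ k := by ring
      _ ≤ _ := by
        gcongr
        · exact SchwartzMap.norm_iteratedFDeriv_le_seminorm ℂ φ j _
        · exact SchwartzMap.le_seminorm ℂ k j φ _
  have hleib := norm_iteratedFDeriv_mul_le (𝕜 := ℝ) (f := osc ∘ ℓ) (g := fun y => φ (y - z.1))
    (contDiff_osc.comp ℓ.contDiff) ((φ.smooth ⊤).comp (contDiff_id.sub contDiff_const)) y (n := n)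
    (mod_cast le_top)
  rw [e]
  calc _ ≤ ‖y‖ ^ k * ∑ i ∈ Finset.range (n + 1), (n.choose i : ℝ) *
        ‖iteratedFDeriv ℝ i (osc ∘ ℓ) y‖ * ‖iteratedFDeriv ℝ (n - i) (fun y => φ (y - z.1)) y‖ := by
        gcongr
    _ = ∑ i ∈ Finset.range (n + 1), (n.choose i : ℝ) * ‖iteratedFDeriv ℝ i (osc ∘ ℓ) y‖ *
        (‖y‖ ^ k * ‖iteratedFDeriv ℝ (n - i) (fun y => φ (y - z.1)) y‖) := by
        rw [Finset.mul_sum]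
        exact Finset.sum_congr rfl fun i _ => by ring
    _ ≤ ∑ i ∈ Finset.range (n + 1), (n.choose i : ℝ) * ((2 * Real.pi) ^ i * (1 + ‖z‖) ^ n) *
        (2 ^ k * (S 0 (n - i) + S k (n - i)) * (1 + ‖z‖) ^ k) := by
        refine Finset.sum_le_sum fun i hi => ?_
        have hi' : i ≤ n := by simpa [Nat.lt_succ_iff] using hi
        have h7 : ‖iteratedFDeriv ℝ i (osc ∘ ℓ) y‖ ≤ (2 * Real.pi) ^ i * (1 + ‖z‖) ^ n := by
          refine (hosc i).trans ?_
          gcongr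
          linarith [norm_nonneg z]
        exact mul_le_mul (mul_le_mul_of_nonneg_left h7 (by positivity)) (hφ _) (by positivity)
          (by positivity)
    _ = _ := by
        rw [Finset.sum_mul]
        exact Finset.sum_congr rfl fun i _ => by ring

theorem polyBounded_stft (φ : 𝓢(Rd d, ℂ)) (f : 𝓢'(Rd d, ℂ)) : PolyBounded (stft φ f) := by
  let q : Seminorm ℂ 𝓢(Rd d, ℂ) := (normSeminorm ℂ ℂ).comp (asCLM f : 𝓢(Rd d, ℂ) →ₗ[ℂ] ℂ)
  have hq : Continuous q := continuous_norm.comp (asCLM f).continuous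
  obtain ⟨s, C, -, h⟩ := Seminorm.bound_of_continuous (schwartz_withSeminorms ℂ (Rd d) ℂ) q hq
  choose D hD using fun k n => exists_seminorm_tfShift_le k n (conjS φ)
  set N := ∑ i ∈ s, (i.1 + i.2) with hN
  refine ⟨C * ∑ i ∈ s, |D i.1 i.2|, N, fun z => ?_⟩
  calc ‖stft φ f z‖ ≤ C * (s.sup (schwartzSeminormFamily ℂ (Rd d) ℂ)) (conjS (tfShift z.1 z.2 φ)) :=
        h _
    _ ≤ C * ∑ i ∈ s, SchwartzMap.seminorm ℂ i.1 i.2 (conjS (tfShift z.1 z.2 φ)) := by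
        have h2 := Seminorm.finset_sup_le_sum (schwartzSeminormFamily ℂ (Rd d) ℂ) s
          (conjS (tfShift z.1 z.2 φ))
        refine mul_le_mul_of_nonneg_left (h2.trans (le_of_eq ?_)) C.2
        rw [sum_apply]
        rfl
    _ ≤ C * ∑ i ∈ s, |D i.1 i.2| * (1 + ‖z‖) ^ N := by
        refine mul_le_mul_of_nonneg_left (Finset.sum_le_sum fun i hi => ?_) C.2
        have h3 := hD i.1 i.2 (z.1, -z.2)
        rw [conjS_tfShift]
        have h4 : ‖(z.1, -z.2)‖ = ‖z‖ := by simp [Prod.norm_def]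
        rw [h4] at h3
        refine h3.trans ?_
        have h5 : i.1 + i.2 ≤ N :=
          Finset.single_le_sum (f := fun i : ℕ × ℕ => i.1 + i.2) (fun _ _ => Nat.zero_le _) hi
        have h6 : 1 ≤ 1 + ‖z‖ := by linarith [norm_nonneg z]
        calc _ ≤ |D i.1 i.2| * (1 + ‖z‖) ^ (i.1 + i.2) := by gcongr; exact le_abs_self _
          _ ≤ _ := by gcongr
    _ = _ := by rw [← Finset.sum_mul]; ring

/-- The linear change of variables `(y, t) ↦ (t, t - y)`. -/
noncomputable def windowCoord : (Rd d × Rd d) ≃L[ℝ] (Rd d × Rd d) :=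
  LinearEquiv.toContinuousLinearEquiv
    { toFun := fun w => (w.2, w.2 - w.1)
      invFun := fun w => (w.1 - w.2, w.1)
      map_add' := fun z w => by ext <;> simp; ring
      map_smul' := fun c z => by ext <;> simp; ring
      left_inv := fun z => by simp
      right_inv := fun z => by simp }

/-- The pairing `(x, ξ) ↦ ∫ ψ(t) (π(x, ξ) φ)(t) dt` as a Schwartz function;
see `analysisS_apply`. -/
noncomputable def analysisS (φ ψ : 𝓢(Rd d, ℂ)) : 𝓢(Rd d × Rd d, ℂ) :=
  partialMap (FourierTransform.fourierInvCLM ℂ 𝓢(Rd d, ℂ))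
    (compCLMOfContinuousLinearEquiv ℂ windowCoord (tensorS ψ φ))

theorem analysisS_apply (φ ψ : 𝓢(Rd d, ℂ)) (z : Rd d × Rd d) :
    analysisS φ ψ z = ∫ t, ψ t * tfShift z.1 z.2 φ t := by
  change (𝓕⁻ (slice z.1 (compCLMOfContinuousLinearEquiv ℂ windowCoord (tensorS ψ φ))) :
    𝓢(Rd d, ℂ)) z.2 = _
  rw [fourierInv_coe, Real.fourierInv_eq']
  refine integral_congr_ae (Filter.Eventually.of_forall fun t => ?_)
  have : slice z.1 (compCLMOfContinuousLinearEquiv ℂ windowCoord (tensorS ψ φ)) t =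
    ψ t * φ (t - z.1) := rfl
  simp only [this, smul_eq_mul]
  rw [tfShift_apply]
  ring

/-- Fourier inversion in the frequency variable, followed by translation invariance of the integral in
the time variable. -/
theorem integral_tfKernel_analysisS (φ ψ : 𝓢(Rd d, ℂ)) (x : Rd d) :
    ∫ z, tfKernel (analysisS φ ψ) φ (z, x) = (∫ y, ‖φ y‖ ^ 2 : ℝ) * ψ x := by
  have hint : Integrable (fun z => tfKernel (analysisS φ ψ) φ (z, x)) :=
    (slice x (swapS (tfKernel (analysisS φ ψ) φ))).integrable
  rw [Measure.volume_eq_prod] at hint ⊢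
  rw [integral_prod _ hint]
  have inner_eq : ∀ y : Rd d, ∫ ξ, tfKernel (analysisS φ ψ) φ ((y, ξ), x) =
      ψ x * (φ (x - y) * (starRingEnd ℂ) (φ (x - y))) := fun y => by
    set h : 𝓢(Rd d, ℂ) := slice y (compCLMOfContinuousLinearEquiv ℂ windowCoord (tensorS ψ φ))
      with hh
    have hx : h x = ψ x * φ (x - y) := rfl
    have e1 : (𝓕 (𝓕⁻ h) : 𝓢(Rd d, ℂ)) x = h x := by rw [FourierTransform.fourier_fourierInv_eq]
    rw [fourier_coe, Real.fourier_eq'] at e1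
    have e2 : ∀ ξ, tfKernel (analysisS φ ψ) φ ((y, ξ), x) =
        (Complex.exp (((-2 * Real.pi * inner ℝ ξ x : ℝ) : ℂ) * Complex.I) • (𝓕⁻ h) ξ) *
          (starRingEnd ℂ) (φ (x - y)) := fun ξ => by
      have e3 : analysisS φ ψ (y, ξ) = (𝓕⁻ h) ξ := rfl
      rw [tfKernel_apply, conjS_tfShift, tfShift_eq, e3, conjS_apply, smul_eq_mul, real_inner_comm]
      unfold osc
      rw [inner_neg_left]
      ring_nf
    simp only [e2]
    rw [integral_mul_const, e1, hx]
    ring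
  simp only [inner_eq]
  rw [integral_const_mul]
  have e4 : ∀ y : Rd d, φ (x - y) * (starRingEnd ℂ) (φ (x - y)) =
      ((‖φ (x - y)‖ ^ 2 : ℝ) : ℂ) := fun y => by rw [Complex.mul_conj']; push_cast; rfl
  simp only [e4]
  rw [integral_complex_ofReal, integral_sub_left_eq_self (fun y => ‖φ y‖ ^ 2) volume x]
  ring

/-- Inversion formula for the short-time Fourier transform of a tempered distribution. -/
theorem stft_inversion (φ ψ : 𝓢(Rd d, ℂ)) (f : 𝓢'(Rd d, ℂ)) :
    (∫ y, ‖φ y‖ ^ 2 : ℝ) * f ψ = ∫ z, analysisS φ ψ z * stft φ f z := by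
  have h := distribution_integral_comm (μ := volume) f
    (V := fun _ : Rd d × Rd d => (1 : ℂ)) aestronglyMeasurable_const PolyBounded.one
    (tfKernel (analysisS φ ψ) φ) (((∫ y, ‖φ y‖ ^ 2 : ℝ) : ℂ) • ψ) (fun x => by
      simp only [one_mul]
      rw [integral_tfKernel_analysisS, smul_apply, smul_eq_mul])
  simp only [one_mul, apply_slice_tfKernel] at h
  rw [← h, map_smul, smul_eq_mul]

theorem integral_norm_sq_pos {φ : 𝓢(Rd d, ℂ)} (hφ : φ ≠ 0) : 0 < ∫ y, ‖φ y‖ ^ 2 := by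
  obtain ⟨x, hx⟩ : ∃ x, φ x ≠ 0 := by
    by_contra! h
    exact hφ (SchwartzMap.ext fun x => by simpa using h x)
  have hint : Integrable (fun y => ‖φ y‖ ^ 2) := (φ.memLp 2).integrable_norm_pow two_ne_zero
  refine integral_pos_of_integrable_nonneg_nonzero (x := x) (by fun_prop) hint
    (fun y => by positivity) (by simpa using hx)

/-- Covariance of `analysisS` under time-frequency shifts, up to a phase. -/
theorem norm_analysisS_tfShift (φ ψ : 𝓢(Rd d, ℂ)) (z u : Rd d × Rd d) :
    ‖analysisS φ (conjS (tfShift z.1 z.2 ψ)) u‖ = ‖analysisS φ (conjS ψ) (u - z)‖ := by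
  rw [analysisS_apply, analysisS_apply,
    ← integral_add_right_eq_self (fun t => conjS (tfShift z.1 z.2 ψ) t * tfShift u.1 u.2 φ t) z.1]
  have e : ∀ t, conjS (tfShift z.1 z.2 ψ) (t + z.1) * tfShift u.1 u.2 φ (t + z.1) =
      osc (2 * Real.pi * inner ℝ z.1 (u.2 - z.2)) *
        (conjS ψ t * tfShift (u - z).1 (u - z).2 φ t) := fun t => by
    have e1 : t + z.1 - u.1 = t - (u - z).1 := by simp only [Prod.fst_sub]; abel
    rw [conjS_tfShift, tfShift_eq, tfShift_eq, tfShift_eq, add_sub_cancel_right, e1]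
    have e2 : osc (2 * Real.pi * inner ℝ (t + z.1) (-z.2)) *
        osc (2 * Real.pi * inner ℝ (t + z.1) u.2) =
        osc (2 * Real.pi * inner ℝ z.1 (u.2 - z.2)) * osc (2 * Real.pi * inner ℝ t (u - z).2) := by
      rw [← osc_add, ← osc_add]
      congr 1
      simp only [Prod.snd_sub, inner_add_left, inner_sub_right, inner_neg_right]
      ring
    linear_combination (conjS ψ t * φ (t - (u - z).1)) * e2
  simp only [e]
  rw [integral_const_mul, norm_mul, norm_osc, one_mul]

/-- Pointwise domination of the short-time Fourier transform under a change of the window. -/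
theorem enorm_stft_le {φ : 𝓢(Rd d, ℂ)} (hφ : φ ≠ 0) (ψ : 𝓢(Rd d, ℂ)) :
    ∃ K : 𝓢(Rd d × Rd d, ℂ), ∀ (f : 𝓢'(Rd d, ℂ)) (z : Rd d × Rd d),
      ‖stft ψ f z‖ₑ ≤ ∫⁻ u, ‖stft φ f u‖ₑ * ‖K (u - z)‖ₑ := by
  have hc := integral_norm_sq_pos hφ
  set c := ∫ y, ‖φ y‖ ^ 2 with hcdef
  refine ⟨((c⁻¹ : ℝ) : ℂ) • analysisS φ (conjS ψ), fun f z => ?_⟩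
  have h := stft_inversion φ (conjS (tfShift z.1 z.2 ψ)) f
  have h2 : stft ψ f z = ((c⁻¹ : ℝ) : ℂ) * ∫ u, analysisS φ (conjS (tfShift z.1 z.2 ψ)) u * stft φ f u := by
    rw [← h, ← mul_assoc, ← Complex.ofReal_mul, inv_mul_cancel₀ hc.ne']
    simp [stft]
  rw [h2, ← integral_const_mul]
  refine (enorm_integral_le_lintegral_enorm _).trans (lintegral_mono fun u => le_of_eq ?_)
  have h3 : ‖analysisS φ (conjS (tfShift z.1 z.2 ψ)) u‖ₑ = ‖analysisS φ (conjS ψ) (u - z)‖ₑ := by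
    rw [← ofReal_norm, ← ofReal_norm, norm_analysisS_tfShift]
  rw [smul_apply, smul_eq_mul, enorm_mul, enorm_mul, enorm_mul, h3]
  ring

end TimeFrequency


/-! ### Maximal functions of Peetre type -/

section MaximalFunction

variable {X : Type*} [NormedAddCommGroup X]

/-- The weight `1 + ‖x‖`, with values in `[0, ∞]`. -/
def jap (x : X) : ℝ≥0∞ := 1 + ‖x‖ₑ

theorem one_le_jap (x : X) : 1 ≤ jap x := le_self_add

theorem jap_ne_zero (x : X) : jap x ≠ 0 := (zero_lt_one.trans_le (one_le_jap x)).ne'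

theorem jap_ne_top (x : X) : jap x ≠ ⊤ := by simp [jap]

theorem jap_eq_ofReal (x : X) : jap x = ENNReal.ofReal (1 + ‖x‖) := by
  rw [ENNReal.ofReal_add zero_le_one (norm_nonneg x), ofReal_norm, ENNReal.ofReal_one, jap]

theorem jap_add_le (x y : X) : jap (x + y) ≤ jap x * jap y := by
  unfold jap
  calc 1 + ‖x + y‖ₑ ≤ 1 + (‖x‖ₑ + ‖y‖ₑ) := by gcongr; exact enorm_add_le x y
    _ ≤ 1 + (‖x‖ₑ + ‖y‖ₑ) + ‖x‖ₑ * ‖y‖ₑ := le_self_add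
    _ = _ := by ring

theorem jap_sub_le (x y z : X) : jap (x - z) ≤ jap (x - y) * jap (y - z) := by
  have := jap_add_le (x - y) (y - z)
  rwa [sub_add_sub_cancel] at this

theorem jap_zero : jap (0 : X) = 1 := by simp [jap]

theorem jap_pow_ne_zero (x : X) (N : ℕ) : jap x ^ N ≠ 0 := pow_ne_zero _ (jap_ne_zero x)

theorem jap_pow_ne_top (x : X) (N : ℕ) : jap x ^ N ≠ ⊤ := ENNReal.pow_ne_top (jap_ne_top x)

variable [MeasurableSpace X] [BorelSpace X] {μ : Measure X}

theorem measurable_jap : Measurable (jap : X → ℝ≥0∞) := measurable_const.add measurable_enorm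

/-- The Peetre maximal function `sup_w F(w) (1 + ‖w - z‖)^{-N}`. -/
noncomputable def peetreMax (F : X → ℝ≥0∞) (N : ℕ) (z : X) : ℝ≥0∞ :=
  ⨆ w, F w * (jap (w - z) ^ N)⁻¹

/-- The average `∫ F(u)^r (1 + ‖u - z‖)^{-Nr} du`. -/
noncomputable def peetreAvg (μ : Measure X) (F : X → ℝ≥0∞) (r : ℝ) (N : ℕ) (z : X) : ℝ≥0∞ :=
  ∫⁻ u, F u ^ r * ((jap (u - z) ^ N)⁻¹) ^ r ∂μ

omit [MeasurableSpace X] [BorelSpace X] in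
theorem le_peetreMax_mul (F : X → ℝ≥0∞) (N : ℕ) (z w : X) :
    F w ≤ peetreMax F N z * jap (w - z) ^ N := by
  have h : F w * (jap (w - z) ^ N)⁻¹ ≤ peetreMax F N z :=
    le_iSup (fun w => F w * (jap (w - z) ^ N)⁻¹) w
  calc F w = F w * (jap (w - z) ^ N)⁻¹ * jap (w - z) ^ N := by
        rw [mul_assoc, ENNReal.inv_mul_cancel (jap_pow_ne_zero _ _) (jap_pow_ne_top _ _), mul_one]
    _ ≤ _ := by gcongr

/-- If `g ≤ (F * K)(w)`, splitting `F = F^r F^{1-r}` and bounding the second factor by the maximal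
function at `z` estimates `g` by an average of `F^r`. -/
theorem le_of_convolution_le {F K : X → ℝ≥0∞} (hF : Measurable F) {r : ℝ} (hr0 : 0 < r)
    (hr1 : r ≤ 1) {N : ℕ} {A : ℝ≥0∞} (hK : ∀ v, K v * jap v ^ N ≤ A) (z w : X) {g : ℝ≥0∞}
    (hg : g ≤ ∫⁻ u, F u * K (u - w) ∂μ) :
    g ≤ jap (w - z) ^ N * (peetreMax F N z ^ (1 - r) * A * peetreAvg μ F r N z) := by
  set M := peetreMax F N z
  have hm : Measurable fun u => F u ^ r * ((jap (u - z) ^ N)⁻¹) ^ r :=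
    (hF.pow_const r).mul
      ((((measurable_jap.comp (measurable_id.sub_const z)).pow_const N).inv).pow_const r)
  unfold peetreAvg
  rw [← mul_assoc, ← lintegral_const_mul _ hm]
  refine hg.trans (lintegral_mono fun u => ?_)
  set j := jap (u - z) ^ N with hj
  have hj0 : j ≠ 0 := jap_pow_ne_zero _ _
  have hjt : j ≠ ⊤ := jap_pow_ne_top _ _
  have h1 : F u ≤ F u ^ r * (M ^ (1 - r) * j ^ (1 - r)) := by
    calc F u = F u ^ r * F u ^ (1 - r) := by
          rw [← ENNReal.rpow_add_of_nonneg _ _ hr0.le (by linarith)]; simp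
      _ ≤ F u ^ r * (M * j) ^ (1 - r) := by
          refine mul_le_mul' le_rfl (ENNReal.rpow_le_rpow ?_ (by linarith))
          exact le_peetreMax_mul F N z u
      _ = _ := by rw [ENNReal.mul_rpow_of_nonneg _ _ (by linarith)]
  have h2 : j ^ (1 - r) = (j⁻¹) ^ r * j := by
    rw [ENNReal.inv_rpow, ← ENNReal.rpow_neg, sub_eq_neg_add, ENNReal.rpow_add _ _ hj0 hjt,
      ENNReal.rpow_one]
  have h3 : j ≤ jap (u - w) ^ N * jap (w - z) ^ N := by
    rw [hj, ← mul_pow]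
    exact pow_le_pow_left' (jap_sub_le u w z) N
  calc F u * K (u - w) ≤ F u ^ r * (M ^ (1 - r) * ((j⁻¹) ^ r * j)) * K (u - w) := by
        rw [← h2]; gcongr
    _ ≤ F u ^ r * (M ^ (1 - r) * ((j⁻¹) ^ r * (jap (u - w) ^ N * jap (w - z) ^ N))) *
        K (u - w) := by gcongr
    _ = jap (w - z) ^ N * M ^ (1 - r) * (K (u - w) * jap (u - w) ^ N) *
        (F u ^ r * (j⁻¹) ^ r) := by ring
    _ ≤ jap (w - z) ^ N * M ^ (1 - r) * A * (F u ^ r * (j⁻¹) ^ r) := by gcongr; exact hK _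
    _ = _ := by ring

/-- If `F` is dominated by its convolution with a rapidly decaying kernel, `le_of_convolution_le`
reads `M ≤ A M^{1-r} I`, and a finite maximal function `M` may be divided out. -/
theorem peetreMax_rpow_le_of_ne_top {F K : X → ℝ≥0∞} (hF : Measurable F)
    (hFK : ∀ w, F w ≤ ∫⁻ u, F u * K (u - w) ∂μ) {r : ℝ} (hr0 : 0 < r) (hr1 : r ≤ 1) {N : ℕ}
    {A : ℝ≥0∞} (hK : ∀ v, K v * jap v ^ N ≤ A) {z : X} (hfin : peetreMax F N z ≠ ⊤) :
    peetreMax F N z ^ r ≤ A * peetreAvg μ F r N z := by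
  set M := peetreMax F N z with hM
  rcases eq_or_ne M 0 with h0 | h0
  · rw [h0, ENNReal.zero_rpow_of_pos hr0]; exact zero_le
  have h : M ≤ M ^ (1 - r) * A * peetreAvg μ F r N z := by
    refine iSup_le fun w => ?_
    have := le_of_convolution_le hF hr0 hr1 hK z w (hFK w)
    rw [← div_eq_mul_inv]
    exact ENNReal.div_le_of_le_mul' this
  have hne0 : M ^ (1 - r) ≠ 0 := (ENNReal.rpow_pos (pos_iff_ne_zero.2 h0) hfin).ne'
  have hnet : M ^ (1 - r) ≠ ⊤ := ENNReal.rpow_ne_top_of_nonneg (by linarith) hfin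
  rw [← ENNReal.mul_le_mul_iff_right hne0 hnet, ← ENNReal.rpow_add _ _ h0 hfin]
  simpa [mul_assoc] using h

/-- For functions of polynomial growth the finiteness assumption of `peetreMax_rpow_le_of_ne_top`
is superfluous: the estimate for a large exponent, whose constant is irrelevant, shows that the
maximal function is finite as soon as the right-hand side is. -/
theorem peetreMax_rpow_le {F K : X → ℝ≥0∞} (hF : Measurable F)
    (hFK : ∀ w, F w ≤ ∫⁻ u, F u * K (u - w) ∂μ)
    (hK : ∀ N : ℕ, ∃ A : ℝ≥0∞, A ≠ ⊤ ∧ ∀ v, K v * jap v ^ N ≤ A)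
    {C : ℝ≥0∞} (hC : C ≠ ⊤) {N₀ : ℕ} (hgrowth : ∀ w, F w ≤ C * jap w ^ N₀)
    {r : ℝ} (hr0 : 0 < r) (hr1 : r ≤ 1) {N : ℕ} {A : ℝ≥0∞} (hA1 : 1 ≤ A)
    (hA : ∀ v, K v * jap v ^ N ≤ A) (z : X) :
    peetreMax F N z ^ r ≤ A * peetreAvg μ F r N z := by
  rcases eq_or_ne (peetreAvg μ F r N z) ⊤ with hI | hI
  · rw [hI, ENNReal.mul_top (zero_lt_one.trans_le hA1).ne']; exact le_top
  refine peetreMax_rpow_le_of_ne_top hF hFK hr0 hr1 hA ?_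
  set N' := max N N₀ with hN'
  obtain ⟨A', hA't, hA'⟩ := hK N'
  have hfin' : ∀ w, peetreMax F N' w ≠ ⊤ := fun w => by
    refine ne_top_of_le_ne_top (ENNReal.mul_ne_top hC (jap_pow_ne_top w N')) (iSup_le fun u => ?_)
    rw [← div_eq_mul_inv]
    refine ENNReal.div_le_of_le_mul ?_
    calc F u ≤ C * jap u ^ N₀ := hgrowth u
      _ ≤ C * jap u ^ N' := by
        gcongr
        · exact one_le_jap u
        · exact le_max_right _ _
      _ ≤ C * (jap (u - w) * jap w) ^ N' := by
        gcongr
        have := jap_add_le (u - w) w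
        rwa [sub_add_cancel] at this
      _ = _ := by rw [mul_pow]; ring
  have hpt : ∀ w, F w ^ r ≤ A' * peetreAvg μ F r N w := fun w => by
    calc F w ^ r ≤ peetreMax F N' w ^ r := by
          gcongr
          simpa [jap_zero] using le_peetreMax_mul F N' w w
      _ ≤ A' * peetreAvg μ F r N' w := peetreMax_rpow_le_of_ne_top hF hFK hr0 hr1 hA' (hfin' w)
      _ ≤ _ := by
          unfold peetreAvg
          gcongr with u
          · exact one_le_jap _
          · exact le_max_left _ _
  have hbound : peetreMax F N z ^ r ≤ A' * peetreAvg μ F r N z := by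
    rw [← ENNReal.le_rpow_inv_iff hr0]
    refine iSup_le fun w => ?_
    rw [ENNReal.le_rpow_inv_iff hr0, ENNReal.mul_rpow_of_nonneg _ _ hr0.le]
    have hw : ((jap (w - z) ^ N)⁻¹) ^ r ≠ ⊤ :=
      ENNReal.rpow_ne_top_of_nonneg hr0.le (ENNReal.inv_ne_top.2 (jap_pow_ne_zero _ _))
    calc _ ≤ A' * peetreAvg μ F r N w * ((jap (w - z) ^ N)⁻¹) ^ r := by gcongr; exact hpt w
      _ = A' * ∫⁻ u, F u ^ r * ((jap (u - w) ^ N)⁻¹) ^ r * ((jap (w - z) ^ N)⁻¹) ^ r ∂μ := by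
          rw [lintegral_mul_const' _ _ hw, mul_assoc]; rfl
      _ ≤ _ := by
          refine mul_le_mul' le_rfl (lintegral_mono fun u => ?_)
          rw [mul_assoc, ← ENNReal.mul_rpow_of_nonneg _ _ hr0.le]
          gcongr
          rw [← ENNReal.mul_inv (Or.inl (jap_pow_ne_zero _ _)) (Or.inl (jap_pow_ne_top _ _)),
            ← mul_pow]
          gcongr
          exact jap_sub_le u w z
  intro htop
  rw [htop, ENNReal.top_rpow_of_pos hr0] at hbound
  exact ENNReal.mul_ne_top hA't hI (top_le_iff.1 hbound)

/-- A function that is dominated by a convolution with `F` is, in the power `r ≤ 1`, dominated by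
the averages of `F^r`. -/
theorem rpow_le_peetreAvg {F K : X → ℝ≥0∞} (hF : Measurable F)
    (hFK : ∀ w, F w ≤ ∫⁻ u, F u * K (u - w) ∂μ)
    (hK : ∀ N : ℕ, ∃ A : ℝ≥0∞, A ≠ ⊤ ∧ ∀ v, K v * jap v ^ N ≤ A)
    {C : ℝ≥0∞} (hC : C ≠ ⊤) {N₀ : ℕ} (hgrowth : ∀ w, F w ≤ C * jap w ^ N₀)
    {r : ℝ} (hr0 : 0 < r) (hr1 : r ≤ 1) {N : ℕ} {A B : ℝ≥0∞} (hA1 : 1 ≤ A)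
    (hA : ∀ v, K v * jap v ^ N ≤ A) {K' : X → ℝ≥0∞} (hB : ∀ v, K' v * jap v ^ N ≤ B) (z : X)
    {g : ℝ≥0∞} (hg : g ≤ ∫⁻ u, F u * K' (u - z) ∂μ) :
    g ^ r ≤ A ^ (1 - r) * B ^ r * peetreAvg μ F r N z := by
  have h1 := le_of_convolution_le hF hr0 hr1 hB z z hg
  rw [sub_self, jap_zero, one_pow, one_mul] at h1
  have h2 := peetreMax_rpow_le hF hFK hK hC hgrowth hr0 hr1 hA1 hA z
  set I := peetreAvg μ F r N z
  have hr2 : 0 ≤ 1 - r := by linarith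
  calc g ^ r ≤ (peetreMax F N z ^ (1 - r) * B * I) ^ r := by gcongr
    _ = (peetreMax F N z ^ r) ^ (1 - r) * B ^ r * I ^ r := by
      rw [ENNReal.mul_rpow_of_nonneg _ _ hr0.le, ENNReal.mul_rpow_of_nonneg _ _ hr0.le,
        ← ENNReal.rpow_mul, ← ENNReal.rpow_mul, mul_comm r]
    _ ≤ (A * I) ^ (1 - r) * B ^ r * I ^ r := by gcongr
    _ = A ^ (1 - r) * B ^ r * (I ^ (1 - r) * I ^ r) := by
      rw [ENNReal.mul_rpow_of_nonneg _ _ hr2]; ring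
    _ = _ := by rw [← ENNReal.rpow_add_of_nonneg _ _ hr2 hr0.le]; simp

end MaximalFunction

/-! ### Change of the Schwartz window in the full range of exponents -/

section WindowChange

variable {d : ℕ}

theorem exists_enorm_mul_jap_le {X : Type*} [NormedAddCommGroup X] [NormedSpace ℝ X]
    (K : 𝓢(X, ℂ)) (N : ℕ) : ∃ A : ℝ≥0, 1 ≤ A ∧ ∀ v, ‖K v‖ₑ * jap v ^ N ≤ A := by
  obtain ⟨C, hC⟩ := decay_one_add K N
  refine ⟨max 1 C.toNNReal, le_max_left _ _, fun v => ?_⟩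
  rw [jap_eq_ofReal, ← ofReal_norm, ← ENNReal.ofReal_pow (by positivity),
    ← ENNReal.ofReal_mul (norm_nonneg _), mul_comm]
  refine (ENNReal.ofReal_le_ofReal (hC v)).trans ?_
  exact ENNReal.coe_le_coe.2 (le_max_right _ _)

theorem wt_abs_le_jap (σ : ℝ) : ∃ C : ℝ≥0, ∀ z : Rd d × Rd d, wt |σ| z ≤ C * jap z ^ |σ| := by
  refine ⟨((2 : ℝ) ^ |σ|).toNNReal, fun z => ?_⟩
  rw [jap_eq_ofReal, ENNReal.ofReal_rpow_of_pos (by positivity)]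
  change _ ≤ ENNReal.ofReal _ * _
  rw [← ENNReal.ofReal_mul (by positivity)]
  refine ENNReal.ofReal_le_ofReal ?_
  rw [← Real.mul_rpow (by norm_num) (by positivity)]
  unfold vWeight
  have h1 : 1 + (‖z.1‖ ^ 2 + ‖z.2‖ ^ 2) ≤ (2 * (1 + ‖z‖)) ^ 2 := by
    have h2 := norm_fst_le z
    have h3 := norm_snd_le z
    nlinarith [norm_nonneg z.1, norm_nonneg z.2, norm_nonneg z,
      mul_le_mul h2 h2 (norm_nonneg _) (norm_nonneg _),
      mul_le_mul h3 h3 (norm_nonneg _) (norm_nonneg _)]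
  calc _ ≤ ((2 * (1 + ‖z‖)) ^ 2) ^ (|σ| / 2) := Real.rpow_le_rpow (by positivity) h1 (by positivity)
    _ = _ := by
      rw [← Real.rpow_natCast, ← Real.rpow_mul (by positivity)]
      congr 1
      push_cast
      ring

theorem lintegral_jap_rpow_mul_wt_ne_top {σ a : ℝ}
    (ha : (Module.finrank ℝ (Rd d × Rd d) : ℝ) + |σ| < a) :
    ∫⁻ z : Rd d × Rd d, jap z ^ (-a) * wt |σ| z ≠ ⊤ := by
  obtain ⟨C, hC⟩ := wt_abs_le_jap (d := d) σ
  have h := finite_integral_one_add_norm (μ := (volume : Measure (Rd d × Rd d))) (r := a - |σ|)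
    (by linarith)
  have h2 : ∫⁻ z : Rd d × Rd d, jap z ^ (-a) * wt |σ| z ≤
      ∫⁻ z : Rd d × Rd d, C * ENNReal.ofReal ((1 + ‖z‖) ^ (-(a - |σ|))) := by
    refine lintegral_mono fun z => ?_
    calc _ ≤ jap z ^ (-a) * (C * jap z ^ |σ|) := by gcongr; exact hC z
      _ = C * jap z ^ (-(a - |σ|)) := by
        rw [mul_left_comm, ← ENNReal.rpow_add _ _ (jap_ne_zero z) (jap_ne_top z)]
        ring_nf
      _ = _ := by rw [jap_eq_ofReal, ENNReal.ofReal_rpow_of_pos (by positivity)]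
  refine ne_top_of_le_ne_top ?_ h2
  rw [lintegral_const_mul' _ _ ENNReal.coe_ne_top]
  exact ENNReal.mul_ne_top ENNReal.coe_ne_top h.ne

theorem lintegral_schwartz_mul_wt_ne_top (K : 𝓢(Rd d × Rd d, ℂ)) (s : ℝ) :
    ∫⁻ z, ‖K z‖ₑ * wt |s| z ≠ ⊤ := by
  obtain ⟨N, hN⟩ := exists_nat_gt ((Module.finrank ℝ (Rd d × Rd d) : ℝ) + |s|)
  obtain ⟨A, -, hA⟩ := exists_enorm_mul_jap_le K N
  have h2 : ∫⁻ z, ‖K z‖ₑ * wt |s| z ≤ ∫⁻ z : Rd d × Rd d, (A : ℝ≥0∞) * (jap z ^ (-(N : ℝ)) * wt |s| z) := by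
    refine lintegral_mono fun z => ?_
    rw [← mul_assoc]
    gcongr
    rw [ENNReal.rpow_neg, ENNReal.rpow_natCast, ← div_eq_mul_inv,
      ENNReal.le_div_iff_mul_le (Or.inl (jap_pow_ne_zero _ _)) (Or.inl (jap_pow_ne_top _ _))]
    exact hA z
  refine ne_top_of_le_ne_top ?_ h2
  rw [lintegral_const_mul' _ _ ENNReal.coe_ne_top]
  exact ENNReal.mul_ne_top ENNReal.coe_ne_top (lintegral_jap_rpow_mul_wt_ne_top hN)

theorem measurable_enorm_stft (φ : 𝓢(Rd d, ℂ)) (f : 𝓢'(Rd d, ℂ)) :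
    Measurable fun z => ‖stft φ f z‖ₑ := (continuous_stft φ f).measurable.enorm

/-- `|V_ψ f|^r` is dominated by a convolution of `|V_φ f|^r` with an arbitrarily fast decaying kernel. -/
theorem exists_stft_rpow_le {φ : 𝓢(Rd d, ℂ)} (hφ : φ ≠ 0) (ψ : 𝓢(Rd d, ℂ)) {r : ℝ}
    (hr0 : 0 < r) (hr1 : r ≤ 1) (N : ℕ) :
    ∃ C : ℝ≥0, ∀ (f : 𝓢'(Rd d, ℂ)) (z : Rd d × Rd d), ‖stft ψ f z‖ₑ ^ r ≤
      C * peetreAvg volume (fun u => ‖stft φ f u‖ₑ) r N z := by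
  obtain ⟨K, hK⟩ := enorm_stft_le hφ φ
  obtain ⟨K', hK'⟩ := enorm_stft_le hφ ψ
  obtain ⟨A, hA1, hA⟩ := exists_enorm_mul_jap_le K N
  obtain ⟨B, hB1, hB⟩ := exists_enorm_mul_jap_le K' N
  refine ⟨A ^ (1 - r) * B ^ r, fun f z => ?_⟩
  obtain ⟨C, N₀, hC⟩ := polyBounded_stft φ f
  have h := rpow_le_peetreAvg (μ := volume) (measurable_enorm_stft φ f) (K := fun v => ‖K v‖ₑ)
    (hK f)
    (fun N => by
      obtain ⟨A, -, hA⟩ := exists_enorm_mul_jap_le K N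
      exact ⟨A, ENNReal.coe_ne_top, hA⟩)
    (C := ENNReal.ofReal C) ENNReal.ofReal_ne_top (N₀ := N₀)
    (fun w => by
      rw [jap_eq_ofReal, ← ofReal_norm, ← ENNReal.ofReal_pow (by positivity),
        ← ENNReal.ofReal_mul' (by positivity)]
      exact ENNReal.ofReal_le_ofReal (hC w))
    hr0 hr1 (N := N) (A := A) (B := B) (by exact_mod_cast hA1) hA (K' := fun v => ‖K' v‖ₑ) hB z
    (hK' f z)
  refine h.trans (le_of_eq ?_)
  rw [ENNReal.coe_mul, ENNReal.coe_rpow_of_nonneg _ (by linarith),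
    ENNReal.coe_rpow_of_nonneg _ hr0.le]

theorem modulationNorm_vWeight (φ : 𝓢(Rd d, ℂ)) (p q : ℝ≥0∞) (s : ℝ) (f : 𝓢'(Rd d, ℂ)) :
    modulationNorm φ p q (vWeight s) f = mixN p q (fun z => wt s z * ‖stft φ f z‖ₑ) :=
  mixedNorm_vWeight p q s _

/-- The modulation space quasi-norms for two Schwartz windows are comparable, in the full range of
exponents. Raising to a power `r ≤ min(1, p, q)` reduces this to Young's inequality. -/
theorem exists_modulationNorm_le {φ : 𝓢(Rd d, ℂ)} (hφ : φ ≠ 0) (ψ : 𝓢(Rd d, ℂ)) {p q : ℝ≥0∞}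
    (hp : 0 < p) (hq : 0 < q) (s : ℝ) :
    ∃ C : ℝ≥0, ∀ f : 𝓢'(Rd d, ℂ),
      modulationNorm ψ p q (vWeight s) f ≤ C * modulationNorm φ p q (vWeight s) f := by
  -- With `r = min(1, p, q)` the exponents `p / r` and `q / r` are at least one.
  set R : ℝ≥0∞ := min 1 (min p q) with hR
  have hRt : R ≠ ⊤ := ne_top_of_le_ne_top ENNReal.one_ne_top (min_le_left _ _)
  have hR0 : R ≠ 0 := (lt_min zero_lt_one (lt_min hp hq)).ne'
  set r := R.toReal with hr
  have hr0 : 0 < r := ENNReal.toReal_pos hR0 hRt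
  have hr1 : r ≤ 1 := ENNReal.toReal_mono ENNReal.one_ne_top (min_le_left _ _)
  have hofr : ENNReal.ofReal r = R := ENNReal.ofReal_toReal hRt
  have hP : 1 ≤ p / R := by
    rw [ENNReal.le_div_iff_mul_le (Or.inl hR0) (Or.inl hRt), one_mul]
    exact (min_le_right _ _).trans (min_le_left _ _)
  have hQ : 1 ≤ q / R := by
    rw [ENNReal.le_div_iff_mul_le (Or.inl hR0) (Or.inl hRt), one_mul]
    exact (min_le_right _ _).trans (min_le_right _ _)
  have hpow : ∀ ψ f, (mixN p q fun z => wt s z * ‖stft ψ f z‖ₑ) ^ r =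
      mixN (p / R) (q / R) (fun z : Rd d × Rd d => wt (s * r) z * ‖stft ψ f z‖ₑ ^ r) := by
    intro ψ f
    have := mixN_rpow hr0 (p / R) (q / R) fun z => wt s z * ‖stft ψ f z‖ₑ
    rw [hofr, ENNReal.div_mul_cancel hR0 hRt, ENNReal.div_mul_cancel hR0 hRt] at this
    rw [← this]
    congr 1
    funext z
    rw [ENNReal.mul_rpow_of_nonneg _ _ hr0.le, wt_rpow]
  obtain ⟨N, hN⟩ := exists_nat_gt (((Module.finrank ℝ (Rd d × Rd d) : ℝ) + |s * r|) / r)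
  rw [div_lt_iff₀ hr0] at hN
  obtain ⟨C₁, hC₁⟩ := exists_stft_rpow_le hφ ψ hr0 hr1 N
  obtain ⟨C₂, hC₂⟩ := exists_mixN_young (d := d) one_ne_zero one_ne_zero 1 1 hP hQ (s * r)
  let k : Rd d × Rd d → ℝ≥0∞ := fun w => jap w ^ (-(N * r))
  have hk : Measurable k := measurable_jap.pow_const _
  have hkt : ∀ w, k w ≠ ⊤ := fun w => by
    simp [k, ENNReal.rpow_eq_top_iff, jap_ne_zero, jap_ne_top]
  have hint : ∫⁻ w, k w * wt |s * r| w ≠ ⊤ := lintegral_jap_rpow_mul_wt_ne_top hN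
  set I := ∫⁻ w, k w * wt |s * r| w with hI
  refine ⟨(C₁ * (C₂ * I.toNNReal)) ^ r⁻¹, fun f => ?_⟩
  rw [modulationNorm_vWeight, modulationNorm_vWeight, ← ENNReal.rpow_le_rpow_iff hr0,
    ENNReal.mul_rpow_of_nonneg _ _ hr0.le, hpow, hpow, ← ENNReal.coe_rpow_of_nonneg _ hr0.le,
    ← NNReal.rpow_mul, inv_mul_cancel₀ hr0.ne', NNReal.rpow_one]
  have havg : ∀ z, peetreAvg volume (fun u => ‖stft φ f u‖ₑ) r N z =
      ∫⁻ w, k w * ‖stft φ f ((1 : ℝ) • z.1 + (1 : ℝ) • w.1, (1 : ℝ) • z.2 + (1 : ℝ) • w.2)‖ₑ ^ r := by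
    intro z
    unfold peetreAvg
    rw [← lintegral_add_right_eq_self _ z]
    refine lintegral_congr fun w => ?_
    have e : ((1 : ℝ) • z.1 + (1 : ℝ) • w.1, (1 : ℝ) • z.2 + (1 : ℝ) • w.2) = w + z := by
      ext <;> simp [add_comm]
    rw [e, add_sub_cancel_right, mul_comm]
    congr 1
    simp only [k]
    rw [ENNReal.inv_rpow, ← ENNReal.rpow_natCast, ← ENNReal.rpow_mul, ← ENNReal.rpow_neg]
  calc _ ≤ mixN (p / R) (q / R) (fun z => C₁ * (wt (s * r) z *
        peetreAvg volume (fun u => ‖stft φ f u‖ₑ) r N z)) := by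
        refine mixN_mono fun z => ?_
        rw [mul_left_comm]
        gcongr
        exact hC₁ f z
    _ = C₁ * mixN (p / R) (q / R) (fun z => wt (s * r) z *
        peetreAvg volume (fun u => ‖stft φ f u‖ₑ) r N z) :=
        mixN_const_mul ENNReal.coe_ne_top _ _ _
    _ ≤ C₁ * (C₂ * I * mixN (p / R) (q / R)
        (fun z => wt (s * r) z * ‖stft φ f z‖ₑ ^ r)) := by
        gcongr
        simp only [havg]
        exact hC₂ (fun u => ‖stft φ f u‖ₑ ^ r) k ((measurable_enorm_stft φ f).pow_const r) hk hkt
    _ = _ := by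
        push_cast
        rw [ENNReal.coe_toNNReal hint]
        ring

end WindowChange


/-! ### The cross-`τ`-Wigner distribution with a Schwartz window -/

section SchwartzWigner

variable {d : ℕ}

/-- The dilation `x ↦ c x` by `c ≠ 0`. -/
noncomputable def dilation {V : Type*} [NormedAddCommGroup V] [NormedSpace ℝ V] {c : ℝ}
    (hc : c ≠ 0) : V ≃L[ℝ] V :=
  ContinuousLinearEquiv.smulLeft (Units.mk0 c hc)

/-- The window `t ↦ g (-((1 - τ) / τ) t)`. -/
noncomputable def tauWindow {τ : ℝ} (h : -((1 - τ) / τ) ≠ 0) (g : 𝓢(Rd d, ℂ)) : 𝓢(Rd d, ℂ) :=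
  compCLMOfContinuousLinearEquiv ℂ (dilation h) g

theorem tauWindow_apply {τ : ℝ} (h : -((1 - τ) / τ) ≠ 0) (g : 𝓢(Rd d, ℂ)) (t : Rd d) :
    tauWindow h g t = g (-((1 - τ) / τ) • t) := rfl

theorem neg_div_ne_zero {τ : ℝ} (h₀ : τ ≠ 0) (h₁ : τ ≠ 1) : -((1 - τ) / τ) ≠ 0 :=
  neg_ne_zero.2 (div_ne_zero (sub_ne_zero.2 h₁.symm) h₀)

theorem tauWindow_ne_zero {τ : ℝ} (h : -((1 - τ) / τ) ≠ 0) {g : 𝓢(Rd d, ℂ)} (hg : g ≠ 0) :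
    tauWindow h g ≠ 0 := by
  intro h0
  refine hg (SchwartzMap.ext fun x => ?_)
  have := DFunLike.congr_fun h0 ((-((1 - τ) / τ))⁻¹ • x)
  rwa [tauWindow_apply, smul_inv_smul₀ h] at this

/-- The function `|τ|⁻ᵈ e^{2πi x·ξ/τ} V_χ f (x / (1 - τ), ξ / τ)`, which represents the cross-`τ`-Wigner
distribution of `f` and `g` if `χ` is the window `tauWindow g`; see `isGivenBy_tauWigner`. -/
noncomputable def wignerFun (τ : ℝ) (χ : 𝓢(Rd d, ℂ)) (f : 𝓢'(Rd d, ℂ)) (z : Rd d × Rd d) : ℂ :=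
  (|(τ ^ d)⁻¹| : ℝ) * osc (2 * Real.pi / τ * inner ℝ z.1 z.2) *
    stft χ f ((1 - τ)⁻¹ • z.1, τ⁻¹ • z.2)

theorem continuous_wignerFun (τ : ℝ) (χ : 𝓢(Rd d, ℂ)) (f : 𝓢'(Rd d, ℂ)) :
    Continuous (wignerFun τ χ f) := by
  unfold wignerFun
  have h1 : Continuous fun z : Rd d × Rd d => osc (2 * Real.pi / τ * inner ℝ z.1 z.2) :=
    continuous_osc.comp (by fun_prop)
  have h2 : Continuous fun z : Rd d × Rd d => stft χ f ((1 - τ)⁻¹ • z.1, τ⁻¹ • z.2) :=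
    (continuous_stft χ f).comp (by fun_prop)
  exact (continuous_const.mul h1).mul h2

theorem enorm_wignerFun (τ : ℝ) (χ : 𝓢(Rd d, ℂ)) (f : 𝓢'(Rd d, ℂ)) (z : Rd d × Rd d) :
    ‖wignerFun τ χ f z‖ₑ =
      ENNReal.ofReal |(τ ^ d)⁻¹| * ‖stft χ f ((1 - τ)⁻¹ • z.1, τ⁻¹ • z.2)‖ₑ := by
  unfold wignerFun
  rw [enorm_mul, enorm_mul, ← ofReal_norm (osc _), norm_osc, ← ofReal_norm, Complex.norm_real,
    Real.norm_of_nonneg (abs_nonneg _), ENNReal.ofReal_one, mul_one]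

theorem PolyBounded.comp_clm {V W : Type*} [NormedAddCommGroup V] [NormedSpace ℝ V]
    [NormedAddCommGroup W] [NormedSpace ℝ W] {u : W → ℂ} (hu : PolyBounded u) (A : V →L[ℝ] W) :
    PolyBounded (fun v => u (A v)) := by
  obtain ⟨C, N, h⟩ := hu
  refine ⟨|C| * (1 + ‖A‖) ^ N, N, fun v => ?_⟩
  have h2 : 1 + ‖A v‖ ≤ (1 + ‖A‖) * (1 + ‖v‖) := by
    nlinarith [A.le_opNorm v, norm_nonneg v, norm_nonneg A]
  calc _ ≤ C * (1 + ‖A v‖) ^ N := h _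
    _ ≤ |C| * ((1 + ‖A‖) * (1 + ‖v‖)) ^ N := by
      gcongr
      exact le_abs_self C
    _ = _ := by rw [mul_pow]; ring

theorem polyBounded_wignerFun (τ : ℝ) (χ : 𝓢(Rd d, ℂ)) (f : 𝓢'(Rd d, ℂ)) :
    PolyBounded (wignerFun τ χ f) := by
  let A : (Rd d × Rd d) →L[ℝ] (Rd d × Rd d) :=
    ((1 - τ)⁻¹ • ContinuousLinearMap.fst ℝ (Rd d) (Rd d)).prod
      (τ⁻¹ • ContinuousLinearMap.snd ℝ (Rd d) (Rd d))
  obtain ⟨C, N, h⟩ := (polyBounded_stft χ f).comp_clm A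
  refine ⟨|(τ ^ d)⁻¹| * C, N, fun z => ?_⟩
  unfold wignerFun
  rw [norm_mul, norm_mul, norm_osc, Complex.norm_real, Real.norm_of_nonneg (abs_nonneg _), mul_one,
    mul_assoc]
  gcongr
  exact h z

/-- The dilation `(x, ξ) ↦ (a x, b ξ)`. -/
noncomputable def dilation₂ {a b : ℝ} (ha : a ≠ 0) (hb : b ≠ 0) :
    (Rd d × Rd d) ≃L[ℝ] (Rd d × Rd d) :=
  (dilation ha).prodCongr (dilation hb)

/-- The kernel `((x, ξ), y) ↦ |τ|⁻ᵈ e^{-2πi (y - x)·ξ/τ} conj g((x - (1 - τ) y) / τ) Φ(x, ξ)`;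
see `wignerKernel_apply`. It is written as a kernel of the short-time Fourier transform. -/
noncomputable def wignerKernel {τ : ℝ} (h₀ : τ ≠ 0) (h₁ : τ ≠ 1) (g : 𝓢(Rd d, ℂ))
    (Φ : 𝓢(Rd d × Rd d, ℂ)) : 𝓢((Rd d × Rd d) × Rd d, ℂ) :=
  let D : (Rd d × Rd d) ≃L[ℝ] (Rd d × Rd d) :=
    dilation₂ (inv_ne_zero (sub_ne_zero.2 h₁.symm)) (inv_ne_zero h₀)
  compCLMOfContinuousLinearEquiv ℂ (D.prodCongr (ContinuousLinearEquiv.refl ℝ (Rd d)))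
    (tfKernel (compCLMOfContinuousLinearEquiv ℂ D.symm
      (((|(τ ^ d)⁻¹| : ℝ) : ℂ) • chirpMul (2 * Real.pi / τ) (ContinuousLinearMap.fst ℝ (Rd d) (Rd d))
        (ContinuousLinearMap.snd ℝ (Rd d) (Rd d)) Φ)) (tauWindow (neg_div_ne_zero h₀ h₁) g))

theorem slice_wignerKernel_eq {τ : ℝ} (h₀ : τ ≠ 0) (h₁ : τ ≠ 1) (g : 𝓢(Rd d, ℂ))
    (Φ : 𝓢(Rd d × Rd d, ℂ)) (z : Rd d × Rd d) :
    slice z (wignerKernel h₀ h₁ g Φ) =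
      ((|(τ ^ d)⁻¹| : ℝ) * (osc (2 * Real.pi / τ * inner ℝ z.1 z.2) * Φ z)) •
        conjS (tfShift ((1 - τ)⁻¹ • z.1) (τ⁻¹ • z.2) (tauWindow (neg_div_ne_zero h₀ h₁) g)) := by
  let D : (Rd d × Rd d) ≃L[ℝ] (Rd d × Rd d) :=
    dilation₂ (inv_ne_zero (sub_ne_zero.2 h₁.symm)) (inv_ne_zero h₀)
  have h := slice_tfKernel (compCLMOfContinuousLinearEquiv ℂ D.symm
      (((|(τ ^ d)⁻¹| : ℝ) : ℂ) • chirpMul (2 * Real.pi / τ) (ContinuousLinearMap.fst ℝ (Rd d) (Rd d))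
        (ContinuousLinearMap.snd ℝ (Rd d) (Rd d)) Φ)) (tauWindow (neg_div_ne_zero h₀ h₁) g) (D z)
  have e : compCLMOfContinuousLinearEquiv ℂ D.symm
      (((|(τ ^ d)⁻¹| : ℝ) : ℂ) • chirpMul (2 * Real.pi / τ) (ContinuousLinearMap.fst ℝ (Rd d) (Rd d))
        (ContinuousLinearMap.snd ℝ (Rd d) (Rd d)) Φ) (D z) =
      (|(τ ^ d)⁻¹| : ℝ) * (osc (2 * Real.pi / τ * inner ℝ z.1 z.2) * Φ z) := by
    rw [compCLMOfContinuousLinearEquiv_apply, Function.comp_apply, D.symm_apply_apply, smul_apply,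
      chirpMul_apply]
    rfl
  rw [e] at h
  exact h

theorem apply_slice_wignerKernel {τ : ℝ} (h₀ : τ ≠ 0) (h₁ : τ ≠ 1) (g : 𝓢(Rd d, ℂ))
    (Φ : 𝓢(Rd d × Rd d, ℂ)) (f : 𝓢'(Rd d, ℂ)) (z : Rd d × Rd d) :
    f (slice z (wignerKernel h₀ h₁ g Φ)) =
      wignerFun τ (tauWindow (neg_div_ne_zero h₀ h₁) g) f z * Φ z := by
  rw [slice_wignerKernel_eq, map_smul, smul_eq_mul]
  unfold wignerFun stft
  ring

theorem wignerKernel_apply {τ : ℝ} (h₀ : τ ≠ 0) (h₁ : τ ≠ 1) (g : 𝓢(Rd d, ℂ))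
    (Φ : 𝓢(Rd d × Rd d, ℂ)) (x ξ y : Rd d) :
    wignerKernel h₀ h₁ g Φ ((x, ξ), y) = (|(τ ^ d)⁻¹| : ℝ) *
      ((starRingEnd ℂ) (g (τ⁻¹ • (x - (1 - τ) • y))) *
        (osc (-2 * Real.pi * inner ℝ ξ (τ⁻¹ • (y - x))) * Φ (x, ξ))) := by
  have h1 : 1 - τ ≠ 0 := sub_ne_zero.2 h₁.symm
  rw [← slice_apply, slice_wignerKernel_eq, smul_apply, conjS_tfShift, tfShift_eq, conjS_apply,
    tauWindow_apply, smul_eq_mul]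
  have e1 : -((1 - τ) / τ) • (y - (1 - τ)⁻¹ • x) = τ⁻¹ • (x - (1 - τ) • y) := by
    rw [smul_sub, smul_smul, smul_sub, smul_smul]
    have : -((1 - τ) / τ) * (1 - τ)⁻¹ = -τ⁻¹ := by field_simp
    rw [this, neg_smul, neg_smul, div_eq_inv_mul]
    abel
  have e2 : osc (-2 * Real.pi * inner ℝ ξ (τ⁻¹ • (y - x))) =
      osc (2 * Real.pi / τ * inner ℝ x ξ) * osc (2 * Real.pi * inner ℝ y (-(τ⁻¹ • ξ))) := by
    rw [← osc_add]
    congr 1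
    rw [inner_smul_right, inner_sub_right, inner_neg_right, inner_smul_right, real_inner_comm y ξ,
      real_inner_comm x ξ]
    field_simp
    ring
  rw [e1, e2]
  ring

theorem integral_comp_add_smul {h : Rd d → ℂ} {τ : ℝ} (a : Rd d) :
    ∫ t, h (a + τ • t) = (|(τ ^ d)⁻¹| : ℝ) * ∫ x, h x := by
  have h2 := Measure.integral_comp_smul volume (fun x => h (a + x)) τ
  rw [finrank_euclideanSpace_fin] at h2
  rw [h2, integral_add_left_eq_self h a]
  rfl

/-- The test function to which `f` is applied in the definition of `W_τ(f, g)(Φ)`. -/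
noncomputable def wignerTest (τ : ℝ) (g : 𝓢'(Rd d, ℂ)) (Φ : 𝓢(Rd d × Rd d, ℂ)) : 𝓢(Rd d, ℂ) :=
  partialPairing (conjDist g)
    (compCLMOfContinuousLinearEquiv ℂ (tauCoord τ).symm (partialFourier Φ))

theorem tauWigner_eq (τ : ℝ) (f g : 𝓢'(Rd d, ℂ)) (Φ : 𝓢(Rd d × Rd d, ℂ)) :
    tauWigner τ f g Φ = f (wignerTest τ g Φ) := rfl

theorem conjDist_toTemperedDistribution (g ψ : 𝓢(Rd d, ℂ)) :
    conjDist (SchwartzMap.toTemperedDistributionCLM _ ℂ volume g) ψ =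
      ∫ t, (starRingEnd ℂ) (g t) * ψ t := by
  rw [conjDist_apply, SchwartzMap.toTemperedDistributionCLM_apply_apply (μ := volume) g (conjS ψ),
    ← integral_conj]
  refine integral_congr_ae (Filter.Eventually.of_forall fun t => ?_)
  simp [mul_comm]

/-- The inner integral over `ξ` is a partial Fourier transform; the substitution
`x = (1 - τ) y + τ t` then turns the outer one into the pairing with `conj g`. -/
theorem wignerTest_schwartz_apply {τ : ℝ} (h₀ : τ ≠ 0) (h₁ : τ ≠ 1) (g : 𝓢(Rd d, ℂ))
    (Φ : 𝓢(Rd d × Rd d, ℂ)) (y : Rd d) :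
    wignerTest τ (SchwartzMap.toTemperedDistributionCLM _ ℂ volume g) Φ y =
      ∫ z, wignerKernel h₀ h₁ g Φ (z, y) := by
  have hint : Integrable (fun z => wignerKernel h₀ h₁ g Φ (z, y)) :=
    (slice y (swapS (wignerKernel h₀ h₁ g Φ))).integrable
  have inner_eq : ∀ x : Rd d, ∫ ξ, wignerKernel h₀ h₁ g Φ ((x, ξ), y) = (|(τ ^ d)⁻¹| : ℝ) *
      ((starRingEnd ℂ) (g (τ⁻¹ • (x - (1 - τ) • y))) * partialFourier Φ (x, τ⁻¹ • (y - x))) := by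
    intro x
    simp only [wignerKernel_apply]
    rw [integral_const_mul, integral_const_mul, partialFourier_apply]
    rfl
  rw [Measure.volume_eq_prod] at hint ⊢
  rw [integral_prod _ hint]
  simp only [inner_eq]
  rw [integral_const_mul, ← integral_comp_add_smul (h := fun x =>
    (starRingEnd ℂ) (g (τ⁻¹ • (x - (1 - τ) • y))) * partialFourier Φ (x, τ⁻¹ • (y - x)))
    ((1 - τ) • y), wignerTest, partialPairing_apply, conjDist_toTemperedDistribution]
  refine integral_congr_ae (Filter.Eventually.of_forall fun t => ?_)
  have e1 : τ⁻¹ • ((1 - τ) • y + τ • t - (1 - τ) • y) = t := by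
    rw [add_sub_cancel_left, inv_smul_smul₀ h₀]
  have e2 : τ⁻¹ • (y - ((1 - τ) • y + τ • t)) = y - t := by
    have : y - ((1 - τ) • y + τ • t) = τ • (y - t) := by
      rw [sub_smul, one_smul, smul_sub]; abel
    rw [this, inv_smul_smul₀ h₀]
  simp only [e1, e2]
  rfl

/-- For Schwartz windows the cross-`τ`-Wigner distribution is a short-time Fourier transform, up to a
dilation and a phase factor. -/
theorem isGivenBy_tauWigner {τ : ℝ} (h₀ : τ ≠ 0) (h₁ : τ ≠ 1) (g : 𝓢(Rd d, ℂ)) (f : 𝓢'(Rd d, ℂ)) :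
    IsGivenBy (tauWigner τ f (SchwartzMap.toTemperedDistributionCLM _ ℂ volume g))
      (wignerFun τ (tauWindow (neg_div_ne_zero h₀ h₁) g) f) := by
  refine ⟨(continuous_wignerFun _ _ _).aestronglyMeasurable, fun Φ =>
    ⟨(polyBounded_wignerFun _ _ _).integrable_mul (continuous_wignerFun _ _ _).aestronglyMeasurable
      Φ, ?_⟩⟩
  rw [tauWigner_eq, distribution_integral_comm (μ := volume) f
    (V := fun _ : Rd d × Rd d => (1 : ℂ)) aestronglyMeasurable_const PolyBounded.one
    (wignerKernel h₀ h₁ g Φ) _ (fun y => by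
      simp only [one_mul]
      exact wignerTest_schwartz_apply h₀ h₁ g Φ y)]
  simp only [one_mul, apply_slice_wignerKernel]

end SchwartzWigner

/-! ### Representing functions and the case of Schwartz windows -/

section Representation

variable {d : ℕ}

theorem locallyIntegrable_of_isGivenBy {T : 𝓢'(Rd d × Rd d, ℂ)} {F : Rd d × Rd d → ℂ}
    (hF : IsGivenBy T F) : LocallyIntegrable F := by
  intro z
  let b : ContDiffBump z := ⟨1, 2, one_pos, one_lt_two⟩
  let χ : 𝓢(Rd d × Rd d, ℂ) := HasCompactSupport.toSchwartzMap (f := fun w => (b w : ℂ))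
    (b.hasCompactSupport.comp_left (g := fun r : ℝ => (r : ℂ)) (by simp))
    (Complex.ofRealCLM.contDiff.comp b.contDiff)
  refine ⟨Metric.closedBall z 1, Metric.closedBall_mem_nhds z one_pos, ?_⟩
  refine ((hF.2 χ).1.integrableOn (s := Metric.closedBall z 1)).congr_fun (fun w hw => ?_)
    Metric.isClosed_closedBall.measurableSet
  have hχ : χ w = 1 := by
    change ((b w : ℝ) : ℂ) = 1
    rw [b.one_of_mem_closedBall hw]; simp
  simp [hχ]

/-- The function that represents a distribution is unique almost everywhere. -/
theorem ae_eq_of_isGivenBy {T : 𝓢'(Rd d × Rd d, ℂ)} {F G : Rd d × Rd d → ℂ}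
    (hF : IsGivenBy T F) (hG : IsGivenBy T G) : ∀ᵐ z, F z = G z := by
  refine ae_eq_of_integral_contDiff_smul_eq (locallyIntegrable_of_isGivenBy hF)
    (locallyIntegrable_of_isGivenBy hG) fun g hg hgc => ?_
  let χ : 𝓢(Rd d × Rd d, ℂ) := HasCompactSupport.toSchwartzMap (f := fun w => (g w : ℂ))
    (hgc.comp_left (g := fun r : ℝ => (r : ℂ)) (by simp))
    (Complex.ofRealCLM.contDiff.comp hg)
  have h := ((hF.2 χ).2.symm.trans (hG.2 χ).2)
  have e : ∀ (F : Rd d × Rd d → ℂ) z, g z • F z = F z * χ z := fun F z => by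
    have : χ z = (g z : ℂ) := rfl
    rw [this, mul_comm, Complex.real_smul]
  simpa only [e] using h

theorem distMixedNorm_eq {T : 𝓢'(Rd d × Rd d, ℂ)} {F : Rd d × Rd d → ℂ} (hF : IsGivenBy T F)
    (p q : ℝ≥0∞) (s : ℝ) :
    distMixedNorm p q (vWeight s) T = mixN p q (fun z => wt s z * ‖F z‖ₑ) := by
  refine le_antisymm ((iInf₂_le F hF).trans (mixedNorm_vWeight p q s F).le) (le_iInf₂ fun G hG => ?_)
  rw [mixedNorm_vWeight]
  refine mixN_mono_ae ?_
  filter_upwards [ae_eq_of_isGivenBy hF hG] with z hz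
  rw [hz]

theorem memMixedLp_iff (p q : ℝ≥0∞) (m : Rd d × Rd d → ℝ) (T : 𝓢'(Rd d × Rd d, ℂ)) :
    MemMixedLp p q m T ↔ distMixedNorm p q m T < ⊤ := by
  simp [MemMixedLp, distMixedNorm, iInf_lt_iff]

/-- Two-sided estimates of the norms yield the characterization of the modulation space. -/
theorem modulationSpace_iff_of_le {φ : 𝓢(Rd d, ℂ)} {p q : ℝ≥0∞} {s : ℝ}
    {W : 𝓢'(Rd d, ℂ) → 𝓢'(Rd d × Rd d, ℂ)} {A B : ℝ≥0}
    (hA : ∀ f, modulationNorm φ p q (vWeight s) f ≤ A * distMixedNorm p q (vWeight s) (W f))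
    (hB : ∀ f, distMixedNorm p q (vWeight s) (W f) ≤ B * modulationNorm φ p q (vWeight s) f) :
    (∀ f, f ∈ modulationSpace φ p q (vWeight s) ↔ MemMixedLp p q (vWeight s) (W f)) ∧
      ∃ C : ℝ≥0, 0 < C ∧ ∀ f,
        modulationNorm φ p q (vWeight s) f ≤ C * distMixedNorm p q (vWeight s) (W f) ∧
        distMixedNorm p q (vWeight s) (W f) ≤ C * modulationNorm φ p q (vWeight s) f := by
  refine ⟨fun f => ?_, max 1 (max A B), by positivity, fun f => ⟨(hA f).trans ?_, (hB f).trans ?_⟩⟩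
  · rw [memMixedLp_iff]
    exact ⟨fun h => (hB f).trans_lt (ENNReal.mul_lt_top ENNReal.coe_lt_top h),
      fun h => (hA f).trans_lt (ENNReal.mul_lt_top ENNReal.coe_lt_top h)⟩
  · gcongr
    exact (le_max_left A B).trans (le_max_right _ _)
  · gcongr
    exact (le_max_right A B).trans (le_max_right _ _)

/-- The modulation space norm is that of a dilation of the representing function, computed with the
window `tauWindow g` instead of `φ`. -/
theorem exists_modulationNorm_le_distMixedNorm_schwartz {τ : ℝ} (h₀ : τ ≠ 0) (h₁ : τ ≠ 1)
    {p q : ℝ≥0∞} (hp : 0 < p) (hq : 0 < q) (s : ℝ) (φ : 𝓢(Rd d, ℂ)) {g : 𝓢(Rd d, ℂ)} (hg : g ≠ 0) :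
    ∃ C : ℝ≥0, ∀ f : 𝓢'(Rd d, ℂ), modulationNorm φ p q (vWeight s) f ≤
      C * distMixedNorm p q (vWeight s)
        (tauWigner τ f (SchwartzMap.toTemperedDistributionCLM _ ℂ volume g)) := by
  have h1 : 1 - τ ≠ 0 := sub_ne_zero.2 h₁.symm
  obtain ⟨A, hA⟩ := exists_modulationNorm_le (tauWindow_ne_zero (neg_div_ne_zero h₀ h₁) hg) φ hp hq s
  obtain ⟨B, hB⟩ := exists_mixN_wt_comp_smul_le (d := d) h1 h₀ p q s
  refine ⟨A * (B * |τ ^ d|.toNNReal), fun f => (hA f).trans ?_⟩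
  rw [distMixedNorm_eq (isGivenBy_tauWigner h₀ h₁ g f), modulationNorm_vWeight, ENNReal.coe_mul,
    mul_assoc]
  gcongr
  set χ := tauWindow (neg_div_ne_zero h₀ h₁) g
  have e : ∀ z : Rd d × Rd d, ‖stft χ f z‖ₑ =
      ENNReal.ofReal |τ ^ d| * ‖wignerFun τ χ f ((1 - τ) • z.1, τ • z.2)‖ₑ := fun z => by
    rw [enorm_wignerFun, ← mul_assoc, ← ENNReal.ofReal_mul (abs_nonneg _), ← abs_mul,
      mul_inv_cancel₀ (pow_ne_zero d h₀), abs_one, ENNReal.ofReal_one, one_mul,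
      inv_smul_smul₀ h1, inv_smul_smul₀ h₀]
  calc _ = ENNReal.ofReal |τ ^ d| *
        mixN p q (fun z => wt s z * ‖wignerFun τ χ f ((1 - τ) • z.1, τ • z.2)‖ₑ) := by
        rw [← mixN_const_mul ENNReal.ofReal_ne_top]
        simp only [e, mul_left_comm]
    _ ≤ ENNReal.ofReal |τ ^ d| * (B * mixN p q (fun z => wt s z * ‖wignerFun τ χ f z‖ₑ)) := by
        gcongr
        exact hB fun z => ‖wignerFun τ χ f z‖ₑ
    _ = _ := by
        rw [ENNReal.coe_mul, ENNReal.ofReal]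
        ring

theorem exists_distMixedNorm_schwartz_le_modulationNorm {τ : ℝ} (h₀ : τ ≠ 0) (h₁ : τ ≠ 1)
    {p q : ℝ≥0∞} (hp : 0 < p) (hq : 0 < q) (s : ℝ) {φ : 𝓢(Rd d, ℂ)} (hφ : φ ≠ 0) (g : 𝓢(Rd d, ℂ)) :
    ∃ C : ℝ≥0, ∀ f : 𝓢'(Rd d, ℂ), distMixedNorm p q (vWeight s)
        (tauWigner τ f (SchwartzMap.toTemperedDistributionCLM _ ℂ volume g)) ≤
      C * modulationNorm φ p q (vWeight s) f := by
  have h1 : 1 - τ ≠ 0 := sub_ne_zero.2 h₁.symm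
  set χ := tauWindow (neg_div_ne_zero h₀ h₁) g with hχ
  obtain ⟨A, hA⟩ := exists_modulationNorm_le hφ χ hp hq s
  obtain ⟨B, hB⟩ := exists_mixN_wt_comp_smul_le (d := d) (inv_ne_zero h1) (inv_ne_zero h₀) p q s
  refine ⟨|(τ ^ d)⁻¹|.toNNReal * (B * A), fun f => ?_⟩
  rw [distMixedNorm_eq (isGivenBy_tauWigner h₀ h₁ g f)]
  have hA' := hA f
  rw [modulationNorm_vWeight χ] at hA'
  calc _ = ENNReal.ofReal |(τ ^ d)⁻¹| *
        mixN p q (fun z => wt s z * ‖stft χ f ((1 - τ)⁻¹ • z.1, τ⁻¹ • z.2)‖ₑ) := by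
        rw [← mixN_const_mul ENNReal.ofReal_ne_top]
        simp only [enorm_wignerFun, mul_left_comm, hχ]
    _ ≤ ENNReal.ofReal |(τ ^ d)⁻¹| * (B * mixN p q (fun z => wt s z * ‖stft χ f z‖ₑ)) := by
        gcongr
        exact hB fun z => ‖stft χ f z‖ₑ
    _ ≤ ENNReal.ofReal |(τ ^ d)⁻¹| * (B * (A * modulationNorm φ p q (vWeight s) f)) := by gcongr
    _ = _ := by
        rw [ENNReal.coe_mul, ENNReal.coe_mul, ENNReal.ofReal]
        ring

end Representation


/-! ### Recovering the short-time Fourier transform from the cross-`τ`-Wigner distribution -/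

section Recovery

variable {d : ℕ}

/-- The test function with `𝓕₂` given by `(ψ ⊗ γ) ∘ L_τ`, that is,
`(x, ξ) ↦ ∫ e^{2πi t·ξ} ψ(x + τ t) γ(x - (1 - τ) t) dt`. -/
noncomputable def wignerSynth (τ : ℝ) (ψ γ : 𝓢(Rd d, ℂ)) : 𝓢(Rd d × Rd d, ℂ) :=
  partialMap (FourierTransform.fourierInvCLM ℂ 𝓢(Rd d, ℂ))
    (compCLMOfContinuousLinearEquiv ℂ (tauCoord τ) (tensorS ψ γ))

theorem wignerSynth_apply (τ : ℝ) (ψ γ : 𝓢(Rd d, ℂ)) (u : Rd d × Rd d) :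
    wignerSynth τ ψ γ u = ∫ t, osc (2 * Real.pi * inner ℝ t u.2) *
      (ψ (u.1 + τ • t) * γ (u.1 - (1 - τ) • t)) := by
  change (𝓕⁻ (slice u.1 (compCLMOfContinuousLinearEquiv ℂ (tauCoord τ) (tensorS ψ γ))) :
    𝓢(Rd d, ℂ)) u.2 = _
  rw [fourierInv_coe, Real.fourierInv_eq']
  rfl

/-- `W_τ(f, g)` tested against `wignerSynth τ ψ γ` recovers `f(ψ)`. -/
theorem tauWigner_wignerSynth {g : 𝓢'(Rd d, ℂ)} {γ : 𝓢(Rd d, ℂ)} (hγ : conjDist g γ = 1) (τ : ℝ)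
    (f : 𝓢'(Rd d, ℂ)) (ψ : 𝓢(Rd d, ℂ)) : tauWigner τ f g (wignerSynth τ ψ γ) = f ψ := by
  rw [tauWigner_apply]
  congr 1
  have e1 : partialFourier (wignerSynth τ ψ γ) =
      compCLMOfContinuousLinearEquiv ℂ (tauCoord τ) (tensorS ψ γ) := by
    ext ⟨x, ξ⟩
    set Θ := compCLMOfContinuousLinearEquiv ℂ (tauCoord τ) (tensorS ψ γ)
    have : slice x (wignerSynth τ ψ γ) = 𝓕⁻ (slice x Θ) := by ext t; rfl
    change (𝓕 (slice x (wignerSynth τ ψ γ)) : 𝓢(Rd d, ℂ)) ξ = slice x Θ ξ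
    rw [this, FourierTransform.fourier_fourierInv_eq]
  ext x
  rw [e1, partialPairing_apply]
  have e2 : slice x (compCLMOfContinuousLinearEquiv ℂ (tauCoord τ).symm
      (compCLMOfContinuousLinearEquiv ℂ (tauCoord τ) (tensorS ψ γ))) = ψ x • γ := by
    ext t
    change tensorS ψ γ ((tauCoord τ) ((tauCoord τ).symm (x, t))) = ψ x • γ t
    rw [ContinuousLinearEquiv.apply_symm_apply]
    rfl
  rw [e2, map_smul, hγ, smul_eq_mul, mul_one]

/-- A time-frequency shift of `ψ` by `z` is a translation of `wignerSynth` by `((1 - τ) z₁, τ z₂)`, up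
to a phase. -/
theorem norm_wignerSynth_tfShift (τ : ℝ) (φ γ : 𝓢(Rd d, ℂ)) (z u : Rd d × Rd d) :
    ‖wignerSynth τ (conjS (tfShift z.1 z.2 φ)) γ u‖ =
      ‖wignerSynth τ (conjS φ) γ (u - ((1 - τ) • z.1, τ • z.2))‖ := by
  rw [wignerSynth_apply, wignerSynth_apply, ← integral_add_right_eq_self _ z.1]
  have e : ∀ t, osc (2 * Real.pi * inner ℝ (t + z.1) u.2) *
      (conjS (tfShift z.1 z.2 φ) (u.1 + τ • (t + z.1)) * γ (u.1 - (1 - τ) • (t + z.1))) =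
      osc (2 * Real.pi * (inner ℝ z.1 u.2 - inner ℝ (u.1 + τ • z.1) z.2)) *
      (osc (2 * Real.pi * inner ℝ t (u - ((1 - τ) • z.1, τ • z.2)).2) *
      (conjS φ ((u - ((1 - τ) • z.1, τ • z.2)).1 + τ • t) *
        γ ((u - ((1 - τ) • z.1, τ • z.2)).1 - (1 - τ) • t))) := fun t => by
    have e1 : u.1 + τ • (t + z.1) - z.1 = (u - ((1 - τ) • z.1, τ • z.2)).1 + τ • t := by
      simp only [Prod.fst_sub, sub_smul, one_smul, smul_add]; abel
    have e2 : u.1 - (1 - τ) • (t + z.1) = (u - ((1 - τ) • z.1, τ • z.2)).1 - (1 - τ) • t := by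
      simp only [Prod.fst_sub, smul_add]; abel
    rw [conjS_tfShift, tfShift_eq, e1, e2]
    have e3 : osc (2 * Real.pi * inner ℝ (t + z.1) u.2) *
        osc (2 * Real.pi * inner ℝ (u.1 + τ • (t + z.1)) (-z.2)) =
        osc (2 * Real.pi * (inner ℝ z.1 u.2 - inner ℝ (u.1 + τ • z.1) z.2)) *
        osc (2 * Real.pi * inner ℝ t (u - ((1 - τ) • z.1, τ • z.2)).2) := by
      rw [← osc_add, ← osc_add]
      congr 1
      simp only [Prod.snd_sub, inner_add_left, inner_sub_right, inner_neg_right, inner_smul_left,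
        inner_smul_right, smul_add]
      simp
      ring
    linear_combination (conjS φ ((u - ((1 - τ) • z.1, τ • z.2)).1 + τ • t) *
        γ ((u - ((1 - τ) • z.1, τ • z.2)).1 - (1 - τ) • t)) * e3
  simp only [e]
  rw [integral_const_mul, norm_mul, norm_osc, one_mul]

theorem exists_conjDist_eq_one {g : 𝓢'(Rd d, ℂ)} (hg : g ≠ 0) : ∃ γ, conjDist g γ = 1 := by
  obtain ⟨ψ, hψ⟩ : ∃ ψ, g ψ ≠ 0 := by
    by_contra! h
    exact hg (by ext ψ; simpa using h ψ)
  refine ⟨((starRingEnd ℂ) (g ψ))⁻¹ • conjS ψ, ?_⟩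
  have h2 : (starRingEnd ℂ) (g ψ) ≠ 0 := by simpa using hψ
  rw [map_smul, conjDist_apply, conjS_conjS, smul_eq_mul, inv_mul_cancel₀ h2]

/-- `V_φ f(z)` is the pairing of `W_τ(f, g)` with translates of one fixed Schwartz function, hence
dominated by a dilated convolution of the representing function; no regularity of `g` is used. -/
theorem exists_modulationNorm_le_distMixedNorm {τ : ℝ} (h₀ : τ ≠ 0) (h₁ : τ ≠ 1)
    {p q : ℝ≥0∞} (hp : 1 ≤ p) (hq : 1 ≤ q) (s : ℝ) (φ : 𝓢(Rd d, ℂ)) {g : 𝓢'(Rd d, ℂ)}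
    (hg : g ≠ 0) :
    ∃ C : ℝ≥0, ∀ f : 𝓢'(Rd d, ℂ), modulationNorm φ p q (vWeight s) f ≤
      C * distMixedNorm p q (vWeight s) (tauWigner τ f g) := by
  have h1 : 1 - τ ≠ 0 := sub_ne_zero.2 h₁.symm
  obtain ⟨γ, hγ⟩ := exists_conjDist_eq_one hg
  obtain ⟨C, hC⟩ := exists_mixN_young (d := d) h1 h₀ 1 1 hp hq s
  set K := wignerSynth τ (conjS φ) γ with hK
  have hI := lintegral_schwartz_mul_wt_ne_top K s
  set I := ∫⁻ w, ‖K w‖ₑ * wt |s| w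
  -- The constant is positive, so that the bound holds if `W_τ(f, g)` is not a function.
  refine ⟨max 1 (C * I.toNNReal), fun f => ?_⟩
  by_cases hF : ∃ F, IsGivenBy (tauWigner τ f g) F
  swap
  · have : distMixedNorm p q (vWeight s) (tauWigner τ f g) = ⊤ := by
      push Not at hF
      simp [distMixedNorm, hF]
    rw [this, ENNReal.mul_top (by positivity)]
    exact le_top
  obtain ⟨F₁, hF₁⟩ := hF
  -- A strongly measurable representative, as Young's inequality is stated for measurable functions.
  obtain ⟨F, hFm, hF⟩ : ∃ F, Measurable F ∧ IsGivenBy (tauWigner τ f g) F := by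
    refine ⟨hF₁.1.mk F₁, hF₁.1.stronglyMeasurable_mk.measurable,
      hF₁.1.stronglyMeasurable_mk.aestronglyMeasurable, fun Φ => ?_⟩
    have h : (fun z => F₁ z * Φ z) =ᵐ[volume] fun z => hF₁.1.mk F₁ z * Φ z := by
      filter_upwards [hF₁.1.ae_eq_mk] with z hz
      rw [hz]
    exact ⟨(hF₁.2 Φ).1.congr h, (hF₁.2 Φ).2.trans (integral_congr_ae h)⟩
  rw [distMixedNorm_eq hF, modulationNorm_vWeight]
  have hpt : ∀ z : Rd d × Rd d, ‖stft φ f z‖ₑ ≤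
      ∫⁻ w, ‖K w‖ₑ * ‖F ((1 - τ) • z.1 + (1 : ℝ) • w.1, τ • z.2 + (1 : ℝ) • w.2)‖ₑ := fun z => by
    have e : stft φ f z = ∫ u, F u * wignerSynth τ (conjS (tfShift z.1 z.2 φ)) γ u := by
      rw [← (hF.2 _).2, tauWigner_wignerSynth hγ]
      rfl
    rw [e]
    refine (enorm_integral_le_lintegral_enorm _).trans (le_of_eq ?_)
    rw [← lintegral_add_right_eq_self _ ((1 - τ) • z.1, τ • z.2)]
    refine lintegral_congr fun w => ?_
    rw [enorm_mul, ← ofReal_norm (wignerSynth _ _ _ _), norm_wignerSynth_tfShift,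
      add_sub_cancel_right, ofReal_norm, mul_comm]
    congr 3
    ext <;> simp [add_comm]
  calc _ ≤ mixN p q (fun z => wt s z * ∫⁻ w, ‖K w‖ₑ *
        ‖F ((1 - τ) • z.1 + (1 : ℝ) • w.1, τ • z.2 + (1 : ℝ) • w.2)‖ₑ) :=
        mixN_mono fun z => mul_le_mul' le_rfl (hpt z)
    _ ≤ C * I * mixN p q (fun z => wt s z * ‖F z‖ₑ) :=
        hC (fun z => ‖F z‖ₑ) (fun w => ‖K w‖ₑ) hFm.enorm K.continuous.measurable.enorm
          (fun w => enorm_ne_top)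
    _ ≤ _ := by
        gcongr
        rw [← ENNReal.coe_toNNReal hI, ← ENNReal.coe_mul]
        exact ENNReal.coe_le_coe.2 (le_max_right _ _)

end Recovery


/-! ### Mixed norms of Schwartz functions -/

section Decay

variable {d : ℕ}

theorem eLpNorm_inv_jap_pow_ne_top {p : ℝ≥0∞} (hp : 1 ≤ p) {N : ℕ} (hN : d < N) :
    eLpNorm (fun x : Rd d => (jap x ^ N)⁻¹) p volume ≠ ⊤ := by
  rcases eq_or_ne p ⊤ with rfl | ht
  · refine ne_top_of_le_ne_top ENNReal.one_ne_top ?_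
    rw [eLpNorm_exponent_top, eLpNormEssSup_eq_essSup_enorm]
    refine essSup_le_of_ae_le 1 (Filter.Eventually.of_forall fun x => ?_)
    simp only [enorm_eq_self]
    exact ENNReal.inv_le_one.2 (one_le_pow_of_one_le' (one_le_jap x) N)
  · have h0 : p ≠ 0 := (zero_lt_one.trans_le hp).ne'
    have h1 : 1 ≤ p.toReal := ENNReal.toReal_mono ht hp
    refine (eLpNorm_lt_top_iff_lintegral_rpow_enorm_lt_top h0 ht |>.2 ?_).ne
    have h2 : ((Module.finrank ℝ (Rd d) : ℕ) : ℝ) < N * p.toReal := by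
      rw [finrank_euclideanSpace_fin]
      have : (d : ℝ) < N := by exact_mod_cast hN
      nlinarith
    have h3 := finite_integral_one_add_norm (μ := (volume : Measure (Rd d))) h2
    refine lt_of_le_of_lt (le_of_eq (lintegral_congr fun x => ?_)) h3
    rw [enorm_eq_self, jap_eq_ofReal, ← ENNReal.ofReal_rpow_of_pos (by positivity),
      ENNReal.inv_rpow, ← ENNReal.rpow_natCast, ← ENNReal.rpow_mul, ENNReal.rpow_neg]

/-- Schwartz functions have finite mixed norms. -/
theorem mixN_schwartz_ne_top {p q : ℝ≥0∞} (hp : 1 ≤ p) (hq : 1 ≤ q) (Φ : 𝓢(Rd d × Rd d, ℂ)) :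
    mixN p q (fun z => ‖Φ z‖ₑ) ≠ ⊤ := by
  obtain ⟨A, -, hA⟩ := exists_enorm_mul_jap_le Φ ((d + 1) + (d + 1))
  have hle : ∀ z : Rd d × Rd d, ‖Φ z‖ₑ ≤ A * ((jap z.2 ^ (d + 1))⁻¹ * (jap z.1 ^ (d + 1))⁻¹) := by
    intro z
    have h1 : jap z.1 ≤ jap z := by
      unfold jap
      gcongr
      rw [← ofReal_norm, ← ofReal_norm]
      exact ENNReal.ofReal_le_ofReal (norm_fst_le z)
    have h2 : jap z.2 ≤ jap z := by
      unfold jap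
      gcongr
      rw [← ofReal_norm, ← ofReal_norm]
      exact ENNReal.ofReal_le_ofReal (norm_snd_le z)
    rw [← ENNReal.mul_inv (Or.inl (jap_pow_ne_zero _ _)) (Or.inl (jap_pow_ne_top _ _)),
      ← div_eq_mul_inv, ENNReal.le_div_iff_mul_le
        (Or.inl (mul_ne_zero (jap_pow_ne_zero _ _) (jap_pow_ne_zero _ _)))
        (Or.inl (ENNReal.mul_ne_top (jap_pow_ne_top _ _) (jap_pow_ne_top _ _)))]
    refine le_trans ?_ (hA z)
    rw [pow_add _ (d + 1) (d + 1)]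
    gcongr
  refine ne_top_of_le_ne_top ?_ (mixN_mono hle)
  have ha : ∀ {p : ℝ≥0∞}, 1 ≤ p →
      eLpNorm (fun x : Rd d => (jap x ^ (d + 1))⁻¹) p volume ≠ ⊤ := fun hp =>
    eLpNorm_inv_jap_pow_ne_top hp d.lt_succ_self
  rw [mixN_const_mul ENNReal.coe_ne_top]
  refine ENNReal.mul_ne_top ENNReal.coe_ne_top ?_
  unfold mixN
  have hb : ∀ ξ : Rd d, (jap ξ ^ (d + 1))⁻¹ ≠ ⊤ := fun ξ => ENNReal.inv_ne_top.2 (jap_pow_ne_zero _ _)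
  simp only [eLpNorm_ennreal_const_mul (hb _)]
  simp only [mul_comm _ (eLpNorm (fun x : Rd d => (jap x ^ (d + 1))⁻¹) p volume)]
  rw [eLpNorm_ennreal_const_mul (ha hp)]
  exact ENNReal.mul_ne_top (ha hp) (ha hq)

end Decay

/-! ### Windows in `M^1`: superposition of time-frequency shifts -/

section WindowExpansion

variable {d : ℕ}

/-- The map `ψ ↦ (w ↦ ∫ ψ(t) conj (π(w) φ)(t) dt)`; see `coanalysisCLM_apply`. -/
noncomputable def coanalysisCLM (φ : 𝓢(Rd d, ℂ)) : 𝓢(Rd d, ℂ) →L[ℂ] 𝓢(Rd d × Rd d, ℂ) :=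
  partialFourier ∘L compCLMOfContinuousLinearEquiv ℂ windowCoord ∘L
    partialMap ((asCLM (TemperedDistribution.delta (0 : EuclideanSpace ℝ (Fin 0)))).smulRight
      (conjS φ)) ∘L
    compCLMOfContinuousLinearEquiv ℂ
      (ContinuousLinearEquiv.prodUnique ℝ (Rd d) (EuclideanSpace ℝ (Fin 0)))

theorem coanalysisCLM_eq (φ ψ : 𝓢(Rd d, ℂ)) : coanalysisCLM φ ψ =
    partialFourier (compCLMOfContinuousLinearEquiv ℂ windowCoord (tensorS ψ (conjS φ))) := rfl

theorem coanalysisCLM_apply (φ ψ : 𝓢(Rd d, ℂ)) (w : Rd d × Rd d) :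
    coanalysisCLM φ ψ w = ∫ t, conjS (tfShift w.1 w.2 φ) t * ψ t := by
  rw [coanalysisCLM_eq]
  obtain ⟨x, ξ⟩ := w
  rw [partialFourier_apply]
  refine integral_congr_ae (Filter.Eventually.of_forall fun t => ?_)
  have : compCLMOfContinuousLinearEquiv ℂ windowCoord (tensorS ψ (conjS φ)) (x, t) =
    ψ t * conjS φ (t - x) := rfl
  simp only [this, conjS_tfShift, tfShift_eq, inner_neg_right]
  unfold osc
  push_cast
  ring_nf

theorem coanalysisCLM_conjS (φ ψ : 𝓢(Rd d, ℂ)) (w : Rd d × Rd d) :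
    (starRingEnd ℂ) (analysisS φ (conjS ψ) w) = coanalysisCLM φ ψ w := by
  rw [analysisS_apply, coanalysisCLM_apply, ← integral_conj]
  refine integral_congr_ae (Filter.Eventually.of_forall fun t => ?_)
  simp [mul_comm]

/-- The inversion formula of the short-time Fourier transform, for the conjugate of `g`. -/
theorem conjDist_inversion (φ ψ : 𝓢(Rd d, ℂ)) (g : 𝓢'(Rd d, ℂ)) :
    (∫ y, ‖φ y‖ ^ 2 : ℝ) * conjDist g ψ =
      ∫ w, (starRingEnd ℂ) (stft φ g w) * coanalysisCLM φ ψ w := by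
  have h := congrArg (starRingEnd ℂ) (stft_inversion φ (conjS ψ) g)
  rw [map_mul, Complex.conj_ofReal, ← integral_conj] at h
  rw [conjDist_apply, h]
  refine integral_congr_ae (Filter.Eventually.of_forall fun w => ?_)
  simp only [map_mul, coanalysisCLM_conjS]
  ring

/-- The Schwartz kernel `(w, y) ↦ wignerTest τ (π(w) φ) Φ y`. -/
noncomputable def wignerTestKernel (τ : ℝ) (φ : 𝓢(Rd d, ℂ)) (Φ : 𝓢(Rd d × Rd d, ℂ)) :
    𝓢((Rd d × Rd d) × Rd d, ℂ) :=
  swapS (partialMap (coanalysisCLM φ)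
    (compCLMOfContinuousLinearEquiv ℂ (tauCoord τ).symm (partialFourier Φ)))

theorem wignerTestKernel_apply (τ : ℝ) (φ : 𝓢(Rd d, ℂ)) (Φ : 𝓢(Rd d × Rd d, ℂ))
    (w : Rd d × Rd d) (y : Rd d) : wignerTestKernel τ φ Φ (w, y) = coanalysisCLM φ (slice y
      (compCLMOfContinuousLinearEquiv ℂ (tauCoord τ).symm (partialFourier Φ))) w := rfl

theorem slice_wignerTestKernel (τ : ℝ) (φ : 𝓢(Rd d, ℂ)) (Φ : 𝓢(Rd d × Rd d, ℂ))
    (w : Rd d × Rd d) : slice w (wignerTestKernel τ φ Φ) = wignerTest τ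
      (SchwartzMap.toTemperedDistributionCLM _ ℂ volume (tfShift w.1 w.2 φ)) Φ := by
  ext y
  rw [slice_apply, wignerTestKernel_apply, coanalysisCLM_apply, wignerTest, partialPairing_apply,
    conjDist_toTemperedDistribution]
  rfl

/-- Expansion of `W_τ(f, g)` into the distributions `W_τ(f, π(w) φ)`. -/
theorem tauWigner_expansion (τ : ℝ) (φ : 𝓢(Rd d, ℂ)) (f g : 𝓢'(Rd d, ℂ))
    (Φ : 𝓢(Rd d × Rd d, ℂ)) :
    (∫ y, ‖φ y‖ ^ 2 : ℝ) * tauWigner τ f g Φ = ∫ w, (starRingEnd ℂ) (stft φ g w) *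
      tauWigner τ f
        (SchwartzMap.toTemperedDistributionCLM _ ℂ volume (tfShift w.1 w.2 φ)) Φ := by
  have hV : Continuous fun w => (starRingEnd ℂ) (stft φ g w) :=
    Complex.continuous_conj.comp (continuous_stft φ g)
  have hVb : PolyBounded fun w => (starRingEnd ℂ) (stft φ g w) := by
    obtain ⟨C, N, h⟩ := polyBounded_stft φ g
    exact ⟨C, N, fun w => by simpa using h w⟩
  have h := distribution_integral_comm (μ := volume) f hV.aestronglyMeasurable hVb
    (wignerTestKernel τ φ Φ) (((∫ y, ‖φ y‖ ^ 2 : ℝ) : ℂ) • wignerTest τ g Φ) (fun y => by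
      rw [smul_apply, smul_eq_mul, wignerTest, partialPairing_apply, conjDist_inversion]
      rfl)
  rw [map_smul, smul_eq_mul] at h
  simp only [slice_wignerTestKernel] at h
  exact h

/-- `tauWindow` turns time-frequency shifts into time-frequency shifts, which compose with the outer
shift up to a phase. -/
theorem tfShift_tauWindow_tfShift {τ : ℝ} (h : -((1 - τ) / τ) ≠ 0) (φ : 𝓢(Rd d, ℂ))
    (w z : Rd d × Rd d) :
    conjS (tfShift z.1 z.2 (tauWindow h (tfShift w.1 w.2 φ))) =
      osc (2 * Real.pi * (-((1 - τ) / τ) * inner ℝ z.1 w.2)) •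
        conjS (tfShift (z.1 + (-((1 - τ) / τ))⁻¹ • w.1) (z.2 + -((1 - τ) / τ) • w.2)
          (tauWindow h φ)) := by
  set c := -((1 - τ) / τ)
  ext y
  rw [smul_apply, smul_eq_mul, conjS_apply, conjS_apply, tfShift_eq, tfShift_eq, tauWindow_apply,
    tauWindow_apply, tfShift_eq]
  have e1 : c • (y - z.1) - w.1 = c • (y - (z.1 + c⁻¹ • w.1)) := by
    rw [smul_sub, smul_sub, smul_add, smul_inv_smul₀ h]; abel
  rw [e1, ← mul_assoc, ← osc_add, map_mul, map_mul, conj_osc, conj_osc, ← mul_assoc, ← osc_add]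
  congr 2
  simp only [inner_add_right, inner_smul_right, inner_smul_left, inner_sub_left]
  simp
  ring

/-- The function that represents `W_τ(f, π(w) φ)`, jointly in `w` and the phase space variable. -/
theorem wignerFun_tauWindow_tfShift {τ : ℝ} (h : -((1 - τ) / τ) ≠ 0) (φ : 𝓢(Rd d, ℂ))
    (f : 𝓢'(Rd d, ℂ)) (w u : Rd d × Rd d) :
    wignerFun τ (tauWindow h (tfShift w.1 w.2 φ)) f u =
      (|(τ ^ d)⁻¹| : ℝ) * osc (2 * Real.pi / τ * inner ℝ u.1 u.2) *
        (osc (2 * Real.pi * (-((1 - τ) / τ) * inner ℝ ((1 - τ)⁻¹ • u.1) w.2)) *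
          stft (tauWindow h φ) f ((1 - τ)⁻¹ • u.1 + (-((1 - τ) / τ))⁻¹ • w.1,
            τ⁻¹ • u.2 + -((1 - τ) / τ) • w.2)) := by
  unfold wignerFun
  congr 1
  have := congrArg f (tfShift_tauWindow_tfShift h φ w ((1 - τ)⁻¹ • u.1, τ⁻¹ • u.2))
  rwa [map_smul] at this

theorem continuous_wignerFun_tauWindow_tfShift {τ : ℝ} (h : -((1 - τ) / τ) ≠ 0) (φ : 𝓢(Rd d, ℂ))
    (f : 𝓢'(Rd d, ℂ)) : Continuous fun v : (Rd d × Rd d) × (Rd d × Rd d) =>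
      wignerFun τ (tauWindow h (tfShift v.1.1 v.1.2 φ)) f v.2 := by
  simp only [wignerFun_tauWindow_tfShift h φ f]
  refine (continuous_const.mul (continuous_osc.comp (by fun_prop))).mul
    ((continuous_osc.comp (by fun_prop)).mul ((continuous_stft _ f).comp (by fun_prop)))

theorem enorm_wignerFun_tauWindow_tfShift {τ : ℝ} (h : -((1 - τ) / τ) ≠ 0) (φ : 𝓢(Rd d, ℂ))
    (f : 𝓢'(Rd d, ℂ)) (w u : Rd d × Rd d) :
    ‖wignerFun τ (tauWindow h (tfShift w.1 w.2 φ)) f u‖ₑ = ENNReal.ofReal |(τ ^ d)⁻¹| *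
      ‖stft (tauWindow h φ) f ((1 - τ)⁻¹ • u.1 + (-((1 - τ) / τ))⁻¹ • w.1,
        τ⁻¹ • u.2 + -((1 - τ) / τ) • w.2)‖ₑ := by
  rw [wignerFun_tauWindow_tfShift, enorm_mul, enorm_mul, enorm_mul, ← ofReal_norm (osc _), norm_osc,
    ← ofReal_norm (osc _), norm_osc, ← ofReal_norm, Complex.norm_real,
    Real.norm_of_nonneg (abs_nonneg _), ENNReal.ofReal_one, mul_one, one_mul]

/-- If the superposition of the functions that represent `W_τ(f, π(w) φ)` converges absolutely in a
weighted mixed norm, then it represents `W_τ(f, g)`. -/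
theorem isGivenBy_tauWigner_of_mixN_ne_top {τ : ℝ} (h₀ : τ ≠ 0) (h₁ : τ ≠ 1) {φ : 𝓢(Rd d, ℂ)}
    (hφ : φ ≠ 0) {p q : ℝ≥0∞} (hp : 1 ≤ p) (hq : 1 ≤ q) (f g : 𝓢'(Rd d, ℂ))
    (hN : mixN p q (fun u => ∫⁻ w, ‖stft φ g w‖ₑ *
      ‖wignerFun τ (tauWindow (neg_div_ne_zero h₀ h₁) (tfShift w.1 w.2 φ)) f u‖ₑ) ≠ ⊤) :
    IsGivenBy (tauWigner τ f g) (fun u => (((∫ y, ‖φ y‖ ^ 2)⁻¹ : ℝ) : ℂ) *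
      ∫ w, (starRingEnd ℂ) (stft φ g w) *
        wignerFun τ (tauWindow (neg_div_ne_zero h₀ h₁) (tfShift w.1 w.2 φ)) f u) := by
  set h := neg_div_ne_zero h₀ h₁
  set κ := ∫ y, ‖φ y‖ ^ 2 with hκ
  have hκ0 : κ ≠ 0 := (integral_norm_sq_pos hφ).ne'
  let S : Rd d × Rd d → Rd d × Rd d → ℂ := fun w u => (starRingEnd ℂ) (stft φ g w) *
    wignerFun τ (tauWindow h (tfShift w.1 w.2 φ)) f u
  have hS : Continuous fun v : (Rd d × Rd d) × (Rd d × Rd d) => S v.1 v.2 :=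
    (Complex.continuous_conj.comp ((continuous_stft φ g).comp continuous_fst)).mul
      (continuous_wignerFun_tauWindow_tfShift h φ f)
  have hSn : ∀ w u, ‖S w u‖ₑ = ‖stft φ g w‖ₑ * ‖wignerFun τ (tauWindow h (tfShift w.1 w.2 φ)) f u‖ₑ :=
    fun w u => by rw [enorm_mul, RCLike.enorm_conj]
  have hSm : Measurable fun u => ∫⁻ w, ‖S w u‖ₑ := by
    have : Measurable fun v : (Rd d × Rd d) × (Rd d × Rd d) => ‖S v.2 v.1‖ₑ :=
      (hS.comp continuous_swap).measurable.enorm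
    exact this.lintegral_prod_right'
  have hprod : ∀ Φ : 𝓢(Rd d × Rd d, ℂ), Integrable
      (fun v : (Rd d × Rd d) × (Rd d × Rd d) => S v.1 v.2 * Φ v.2) (volume.prod volume) := fun Φ => by
    have hc : Continuous fun v : (Rd d × Rd d) × (Rd d × Rd d) => S v.1 v.2 * Φ v.2 :=
      hS.mul (Φ.continuous.comp continuous_snd)
    refine ⟨hc.aestronglyMeasurable, ?_⟩
    unfold HasFiniteIntegral
    rw [lintegral_prod_symm _ hc.measurable.enorm.aemeasurable]
    have hpp : p.HolderConjugate p.conjExponent := .conjExponent hp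
    have hqq : q.HolderConjugate q.conjExponent := .conjExponent hq
    have e : ∀ u, ∫⁻ w, ‖S w u * Φ u‖ₑ = (∫⁻ w, ‖S w u‖ₑ) * ‖Φ u‖ₑ := fun u => by
      simp only [enorm_mul (S _ u)]
      exact lintegral_mul_const' _ _ enorm_ne_top
    simp only [e]
    refine (lintegral_mul_le_mixN_mul_mixN p q p.conjExponent q.conjExponent hSm
      Φ.continuous.measurable.enorm).trans_lt (ENNReal.mul_lt_top ?_ ?_)
    · simp only [hSn]
      exact hN.lt_top
    · exact (mixN_schwartz_ne_top le_self_add le_self_add Φ).lt_top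
  have hmul : ∀ (Φ : 𝓢(Rd d × Rd d, ℂ)) u, (((κ⁻¹ : ℝ) : ℂ) * ∫ w, S w u) * Φ u =
      ((κ⁻¹ : ℝ) : ℂ) * ∫ w, S w u * Φ u := fun Φ u => by
    rw [integral_mul_const, mul_assoc]
  refine ⟨?_, fun Φ => ⟨?_, ?_⟩⟩
  · have : StronglyMeasurable fun u => ∫ w, S w u :=
      hS.stronglyMeasurable.integral_prod_left'
    exact (this.const_mul _).aestronglyMeasurable
  · refine Integrable.congr ((hprod Φ).integral_prod_right.const_mul ((κ⁻¹ : ℝ) : ℂ)) ?_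
    exact Filter.Eventually.of_forall fun u => (hmul Φ u).symm
  · have h1 := tauWigner_expansion τ φ f g Φ
    have h2 : ∀ w : Rd d × Rd d, (starRingEnd ℂ) (stft φ g w) * tauWigner τ f
        (SchwartzMap.toTemperedDistributionCLM _ ℂ volume (tfShift w.1 w.2 φ)) Φ =
        ∫ u, S w u * Φ u := fun w => by
      rw [((isGivenBy_tauWigner h₀ h₁ _ f).2 Φ).2, ← integral_const_mul]
      simp only [S, mul_assoc]
    simp only [h2] at h1
    rw [integral_integral_swap (hprod Φ)] at h1
    have h3 : ∫ u, (((κ⁻¹ : ℝ) : ℂ) * ∫ w, S w u) * Φ u = ((κ⁻¹ : ℝ) : ℂ) * ∫ u, ∫ w, S w u * Φ u := by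
      simp only [hmul]
      exact integral_const_mul _ _
    refine Eq.trans ?_ h3.symm
    rw [← h1, ← mul_assoc, ← Complex.ofReal_mul, inv_mul_cancel₀ hκ0, Complex.ofReal_one, one_mul]

/-- The representing function is dominated by a dilated convolution of `|V_χ f|`, `χ = tauWindow φ`, with
`|V_φ g|`, and `g ∈ M^1_{v_s}` is the integrability that Young's inequality asks of the kernel. -/
theorem exists_distMixedNorm_le_modulationNorm {τ : ℝ} (h₀ : τ ≠ 0) (h₁ : τ ≠ 1)
    {p q : ℝ≥0∞} (hp : 1 ≤ p) (hq : 1 ≤ q) {s : ℝ} (hs : 0 ≤ s) {φ : 𝓢(Rd d, ℂ)} (hφ : φ ≠ 0)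
    {g : 𝓢'(Rd d, ℂ)} (hg : g ∈ modulationSpace φ 1 1 (vWeight s)) :
    ∃ C : ℝ≥0, ∀ f : 𝓢'(Rd d, ℂ), distMixedNorm p q (vWeight s) (tauWigner τ f g) ≤
      C * modulationNorm φ p q (vWeight s) f := by
  have h1 : 1 - τ ≠ 0 := sub_ne_zero.2 h₁.symm
  set h := neg_div_ne_zero h₀ h₁ with hh
  obtain ⟨A, hA⟩ := exists_modulationNorm_le hφ (tauWindow h φ) (zero_lt_one.trans_le hp)
    (zero_lt_one.trans_le hq) s
  obtain ⟨B, hB⟩ := exists_mixN_young (d := d) (inv_ne_zero h1) (inv_ne_zero h₀)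
    (-((1 - τ) / τ))⁻¹ (-((1 - τ) / τ)) hp hq s
  have hI : ∫⁻ w, ‖stft φ g w‖ₑ * wt |s| w ≠ ⊤ := by
    have h2 : modulationNorm φ 1 1 (vWeight s) g < ⊤ := hg
    have hm : Measurable fun z => wt s z * ‖stft φ g z‖ₑ :=
      (measurable_wt s).mul (measurable_enorm_stft φ g)
    rw [modulationNorm_vWeight, mixN_one_one hm] at h2
    rw [abs_of_nonneg hs]
    simpa only [mul_comm] using h2.ne
  set I := ∫⁻ w, ‖stft φ g w‖ₑ * wt |s| w
  set κ := ∫ y, ‖φ y‖ ^ 2 with hκ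
  set L : ℝ≥0 := |(τ ^ d)⁻¹|.toNNReal * (B * I.toNNReal * A) with hL
  let N : 𝓢'(Rd d, ℂ) → Rd d × Rd d → ℝ≥0∞ := fun f u => ∫⁻ w, ‖stft φ g w‖ₑ *
      ‖wignerFun τ (tauWindow h (tfShift w.1 w.2 φ)) f u‖ₑ
  have hNle : ∀ f, mixN p q (fun u => wt s u * N f u) ≤ L * modulationNorm φ p q (vWeight s) f := by
    intro f
    have hA' := hA f
    rw [modulationNorm_vWeight (tauWindow h φ)] at hA'
    have e : ∀ u, N f u = ENNReal.ofReal |(τ ^ d)⁻¹| * ∫⁻ w, ‖stft φ g w‖ₑ *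
        ‖stft (tauWindow h φ) f ((1 - τ)⁻¹ • u.1 + (-((1 - τ) / τ))⁻¹ • w.1,
          τ⁻¹ • u.2 + -((1 - τ) / τ) • w.2)‖ₑ := fun u => by
      rw [← lintegral_const_mul' _ _ ENNReal.ofReal_ne_top]
      simp only [N, enorm_wignerFun_tauWindow_tfShift, mul_left_comm]
    simp only [e, mul_left_comm (wt s _) (ENNReal.ofReal _)]
    rw [mixN_const_mul ENNReal.ofReal_ne_top]
    calc _ ≤ ENNReal.ofReal |(τ ^ d)⁻¹| * (B * I *
          mixN p q (fun z => wt s z * ‖stft (tauWindow h φ) f z‖ₑ)) := by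
          gcongr
          exact hB (fun z => ‖stft (tauWindow h φ) f z‖ₑ) _ (measurable_enorm_stft _ f)
            (measurable_enorm_stft φ g) fun w => enorm_ne_top
      _ ≤ ENNReal.ofReal |(τ ^ d)⁻¹| * (B * I * (A * modulationNorm φ p q (vWeight s) f)) := by
          gcongr
      _ = _ := by
          rw [hL]
          push_cast
          rw [ENNReal.coe_toNNReal hI, ENNReal.ofReal]
          ring
  -- The constant is positive, so that the bound is trivial if `f` has infinite norm.
  refine ⟨max 1 (κ⁻¹.toNNReal * L), fun f => ?_⟩
  rcases eq_or_ne (modulationNorm φ p q (vWeight s) f) ⊤ with hf | hf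
  · rw [hf, ENNReal.mul_top (by positivity)]
    exact le_top
  -- The weight is at least one, so the unweighted mixed norm is finite as well.
  have hNfin : mixN p q (N f) ≠ ⊤ := by
    refine ne_top_of_le_ne_top (ENNReal.mul_ne_top ENNReal.coe_ne_top hf)
      (le_trans (mixN_mono fun u => ?_) (hNle f))
    exact le_mul_of_one_le_left' (one_le_wt hs u)
  rw [distMixedNorm_eq (isGivenBy_tauWigner_of_mixN_ne_top h₀ h₁ hφ hp hq f g hNfin)]
  calc _ ≤ mixN p q (fun u => (κ⁻¹.toNNReal : ℝ≥0∞) * (wt s u * N f u)) := by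
        refine mixN_mono fun u => ?_
        rw [mul_left_comm]
        gcongr
        rw [enorm_mul]
        gcongr
        · rw [← ofReal_norm, Complex.norm_real, Real.norm_of_nonneg
            (inv_nonneg.2 (integral_norm_sq_pos hφ).le)]
          rfl
        · refine (enorm_integral_le_lintegral_enorm _).trans (le_of_eq ?_)
          simp only [enorm_mul, RCLike.enorm_conj]
          rfl
    _ = κ⁻¹.toNNReal * mixN p q (fun u => wt s u * N f u) := mixN_const_mul ENNReal.coe_ne_top _ _ _
    _ ≤ κ⁻¹.toNNReal * (L * modulationNorm φ p q (vWeight s) f) := by gcongr; exact hNle f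
    _ ≤ _ := by
        rw [← mul_assoc]
        gcongr
        exact_mod_cast le_max_right _ _

end WindowExpansion

theorem proposition2p16 (d : ℕ) (τ : ℝ) (hτ₀ : τ ≠ 0) (hτ₁ : τ ≠ 1) (s : ℝ)
    (p q : ℝ≥0∞) (hp : 0 < p) (hq : 0 < q)
    (φ : 𝓢(Rd d, ℂ)) (hφ : φ ≠ 0) :
    (∀ g : 𝓢(Rd d, ℂ), g ≠ 0 →
      (∀ f : 𝓢'(Rd d, ℂ),
        f ∈ modulationSpace φ p q (vWeight s) ↔
          MemMixedLp p q (vWeight s)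
            (tauWigner τ f (SchwartzMap.toTemperedDistributionCLM _ ℂ volume g))) ∧
      ∃ C : ℝ≥0, 0 < C ∧ ∀ f : 𝓢'(Rd d, ℂ),
        modulationNorm φ p q (vWeight s) f ≤
          C * distMixedNorm p q (vWeight s)
            (tauWigner τ f (SchwartzMap.toTemperedDistributionCLM _ ℂ volume g)) ∧
        distMixedNorm p q (vWeight s)
            (tauWigner τ f (SchwartzMap.toTemperedDistributionCLM _ ℂ volume g)) ≤
          C * modulationNorm φ p q (vWeight s) f) ∧
    (0 ≤ s → 1 ≤ p → 1 ≤ q →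
      ∀ g : 𝓢'(Rd d, ℂ),
        g ∈ modulationSpace φ 1 1 (vWeight s) → g ≠ 0 →
      (∀ f : 𝓢'(Rd d, ℂ),
        f ∈ modulationSpace φ p q (vWeight s) ↔
          MemMixedLp p q (vWeight s) (tauWigner τ f g)) ∧
      ∃ C : ℝ≥0, 0 < C ∧ ∀ f : 𝓢'(Rd d, ℂ),
        modulationNorm φ p q (vWeight s) f ≤
          C * distMixedNorm p q (vWeight s) (tauWigner τ f g) ∧
        distMixedNorm p q (vWeight s) (tauWigner τ f g) ≤
          C * modulationNorm φ p q (vWeight s) f) := by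
  refine ⟨fun g hg => ?_, fun hs hp1 hq1 g hgM hg => ?_⟩
  · obtain ⟨A, hA⟩ := exists_modulationNorm_le_distMixedNorm_schwartz hτ₀ hτ₁ hp hq s φ hg
    obtain ⟨B, hB⟩ := exists_distMixedNorm_schwartz_le_modulationNorm hτ₀ hτ₁ hp hq s hφ g
    exact modulationSpace_iff_of_le hA hB
  · obtain ⟨A, hA⟩ := exists_modulationNorm_le_distMixedNorm hτ₀ hτ₁ hp1 hq1 s φ hg
    obtain ⟨B, hB⟩ := exists_distMixedNorm_le_modulationNorm hτ₀ hτ₁ hp1 hq1 hs hφ hgM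
    exact modulationSpace_iff_of_le hA hB
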